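/- Let $s,m\ge 0$ and use coordinates $(w,z,\zeta)\in\mathbb C\oplus\mathbb C^s\oplus\mathbb C^{m}$. Let $M$ be the germ at $0$ of the real hypersurface $$\Re(w)=z^TH(\zeta,\bar\zeta)\bar z+\Re\big(\bar z^TS(\zeta,\bar\zeta)\bar z\big),\qquad(1)$$ where $H,S$ are real analytic $s\times s$ matrix valued functions near $\zeta=0$, $H$ is Hermitian, $S$ is symmetric, $\mathbf H:=H(0,0)$ is nondegenerate, and $M$ is uniformly $2$-nondegenerate near $0$: its Levi form has constant rank $s$, its Levi kernel $\mathcal K_2$ is nonzero, and the next term $\mathcal K_3$ of the Freeman filtration is zero. Put $S^{0,2}_\alpha:=(\mathbf H^T)^{-1}S_{\zeta_\alpha}(0,0)\mathbf H^{-1}$ and $W:=\mathrm{span}_{\mathbb C}\{S^{0,2}_1,\dots,S^{0,2}_m\}$. Order positions $(j,k)$ in symmetric $s\times s$ matrices by $\min\{j,k\}$ first and then by $\max\{j,k\}$ (so $(j,k)$ and $(k,j)$ count as the same position). (a) There are $m$-tuples of positions $((j_1,k_1),\dots,(j_m,k_m))$ for which the linear map $\zeta\mapsto\big(\sum_\alpha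 (S^{0,2}_\alpha)_{(j_\beta,k_\beta)}\zeta_\alpha\big)_{\beta=1}^m$ is injective. Let $((j_1,k_1),\dots,(j_m,k_m))$ be the lexicographically first one. For a symmetric matrix $\mathbf S(\zeta)$ of germs at $0$ of holomorphic functions with $\mathbf S(0)=0$ and linearly independent $\mathbf S_{\zeta_1}(0),\dots,\mathbf S_{\zeta_m}(0)$, let $M_{\mathbf S}$ be the germ at $0$ of the hypersurface (1) with $H,S$ replaced by $$\tfrac12\Big(\mathbf H(\mathrm{Id}-\overline{\mathbf S(\zeta)}\mathbf H^T\mathbf S(\zeta)\mathbf H)^{-1}+(\mathrm{Id}-\mathbf H\overline{\mathbf S(\zeta)}\mathbf H^T\mathbf S(\zeta))^{-1}\mathbf H\Big),\qquad \mathbf H^T(\mathrm{Id}-\mathbf S(\zeta)\mathbf H\overline{\mathbf S(\zeta)}\mathbf H^T)^{-1}\mathbf S(\zeta)\mathbf H .$$ Call $\mathbf S$ normalized if $(\mathbf S(\zeta))_{(j_\alpha,k_\alpha)}=\zeta_\alpha$ for all $\alpha$ and $\mathrm{span}_{\mathbb C}\{\mathbf S_{\zeta_\alpha}(0)\}=W$.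 A coordinate change is a local biholomorphism at $0$ fixing $0$; call it positive if the $\partial/\partial w$-derivative at $0$ of its $w$-component has positive real part. For $\varepsilon=\pm1$ let $\Gamma_\varepsilon$ be the set of $s\times s$ matrices $U$ with $U^T\mathbf H\overline U=\varepsilon\mathbf H$ and $UAU^T\in W\Leftrightarrow A\in W$; thus $\Gamma_1=\mathrm U(\mathbf H)\cap G_{0,0}$. (b) There is a positive coordinate change that transforms $M$ to $M_{\mathbf S}$ for some normalized $\mathbf S$. (c) This normal form is unique up to the action of $\mathrm U(\mathbf H)\cap G_{0,0}$: if coordinate changes $\varphi$ and $\varphi'$ transform $M$ to $M_{\mathbf S}$ and $M_{\mathbf S'}$ with $\mathbf S,\mathbf S'$ normalized, and both or neither of $\varphi,\varphi'$ are positive, then there are $U\in\mathrm U(\mathbf H)\cap G_{0,0}$ and a holomorphic germ $g$ with $g(0)=0$ such that $(w,z,\zeta)\mapsto(w,Uz,\zeta+g(\zeta))$ is a coordinate change that transforms $M_{\mathbf S}$ to $M_{\mathbf S'}$. If exactly one of $\varphi,\varphi'$ is positive, the same holds with $U\in\Gamma_{-1}$ and $(w,z,\zeta)\mapsto(-w,Uz,\zeta+g(\zeta))$;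 this requires $\mathbf H$ to have split signature, since otherwise $\Gamma_{-1}=\emptyset$. (d) If a coordinate change transforms $M$ to $M_{\mathbf S}$ with $\mathbf S$ normalized, then for each $U\in\mathrm U(\mathbf H)\cap G_{0,0}$ there is a germ $g_U$ of a holomorphic map with $g_U(0)=0$, unique as a germ, such that $(w,z,\zeta)\mapsto(w,Uz,\zeta+g_U(\zeta))$ is a coordinate change that transforms $M_{\mathbf S}$ to $M_{\mathbf S'}$ for some normalized $\mathbf S'$. -/

import Mathlib

open Filter Topology Matrix Complex
open scoped ContDiff

noncomputable section

namespace CRModel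

/-! ### Wirtinger derivatives -/

section Wirtinger

variable {E F : Type*} [NormedAddCommGroup E] [NormedSpace ℂ E]
  [NormedAddCommGroup F] [NormedSpace ℂ F]

/-- `∂f_p(v) = ½ (Df_p(v) - i Df_p(i v))`, the derivative of `f` along the `(1,0)`-vector
`∑ v_j ∂/∂Z_j`; it is complex linear in `v`. -/
def dHol (f : E → F) (p : E) : E →ₗ[ℂ] F where
  toFun v := (1 / 2 : ℂ) • (fderiv ℝ f p v - I • fderiv ℝ f p (I • v))
  map_add' v w := by
    simp only [map_add, smul_add, smul_sub]
    abel
  map_smul' c v := by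
    have key : ∀ u : E, fderiv ℝ f p (c • u)
        = c.re • fderiv ℝ f p u + c.im • fderiv ℝ f p (I • u) := by
      intro u
      rw [← map_smul, ← map_smul, ← map_add]
      congr 1
      rw [← Complex.coe_smul, ← Complex.coe_smul, smul_smul, ← add_smul, Complex.re_add_im]
    have h2 : fderiv ℝ f p (I • c • v) = c.re • fderiv ℝ f p (I • v) - c.im • fderiv ℝ f p v := by
      rw [smul_comm, key, smul_smul, I_mul_I, neg_one_smul, map_neg, smul_neg, sub_eq_add_neg]
    rw [key, h2]
    simp only [RingHom.id_apply, ← Complex.coe_smul]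
    conv_rhs => rw [← Complex.re_add_im c]
    have hI : (1 / 2 * (c.im : ℂ)) • fderiv ℝ f p (I • v)
        = (-(1 / 2) * c.im * (I * I)) • fderiv ℝ f p (I • v) := by
      rw [I_mul_I]
      module
    simp only [smul_sub, smul_add, smul_smul]
    rw [hI]
    module

/-- `∂̄f_p(v) = ½ (Df_p(v) + i Df_p(i v))`, the derivative of `f` along the `(0,1)`-vector
`∑ conj(v_j) ∂/∂(conj Z_j)`, the conjugate of the `(1,0)`-vector `v`. -/
def dAnti (f : E → F) (p v : E) : F :=
  (1 / 2 : ℂ) • (fderiv ℝ f p v + I • fderiv ℝ f p (I • v))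

end Wirtinger

/-! ### The Freeman filtration of a real hypersurface `{ρ = 0}` -/

section Freeman

variable {E : Type*} [NormedAddCommGroup E] [NormedSpace ℂ E]

/-- `K₁`: the fibre at `p` of the CR structure of `{ρ = 0}`, i.e. the `(1,0)`-vectors
tangent to the hypersurface. -/
def crSpace (ρ : E → ℝ) (p : E) : Submodule ℂ E :=
  LinearMap.ker (dHol (fun q => (ρ q : ℂ)) p)

/-- The complex Hessian `∂∂̄ρ_p(v, conj w)`. Its restriction to `crSpace ρ p` is the Levi form of
`{ρ = 0}` at `p`. -/
def leviForm (ρ : E → ℝ) (p w : E) : E →ₗ[ℂ] ℂ :=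
  dHol (fun q => dAnti (fun q' => (ρ q' : ℂ)) q w) p

/-- `K₂`: the Levi kernel at `p`. -/
def leviKernel (ρ : E → ℝ) (p : E) : Submodule ℂ E :=
  crSpace ρ p ⊓ ⨅ w ∈ crSpace ρ p, LinearMap.ker (leviForm ρ p w)

/-- `K₃`: the kernel at `p` of the second order generalized Levi form. A vector `v` of the Levi
kernel lies in it iff, for smooth sections `X` of the Levi kernel with `X(p) = v` and sections `Y`
of the CR structure, the bracket `[X, conj Y]` at `p` lies in `K₂ ⊕ conj K₁`. As `X` is of type
`(1,0)` and `conj Y` of type `(0,1)`, the `(1,0)`-part of that bracket at `p` is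
`-∂̄X_p(Y(p))`. -/
def secondLeviKernel (ρ : E → ℝ) (p : E) : Set E :=
  {v | v ∈ leviKernel ρ p ∧
    ∀ X : E → E, ContDiffAt ℝ ∞ X p → (∀ᶠ q in 𝓝 p, ρ q = 0 → X q ∈ leviKernel ρ q) → X p = v →
      ∀ y ∈ crSpace ρ p, dAnti X p y ∈ leviKernel ρ p}

/-- Near the point `p₀` the hypersurface `{ρ = 0}` has Levi form of constant rank `s` and is
`2`-nondegenerate everywhere: `K₂ ≠ 0` and `K₃ = 0`. -/
def IsUniformlyTwoNondegenerate (ρ : E → ℝ) (s : ℕ) (p₀ : E) : Prop :=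
  ∀ᶠ p in 𝓝 p₀, ρ p = 0 →
    Module.finrank ℂ (crSpace ρ p) = Module.finrank ℂ (leviKernel ρ p) + s ∧
    leviKernel ρ p ≠ ⊥ ∧
    ∀ v ∈ secondLeviKernel ρ p, v = 0

end Freeman

/-! ### Hypersurfaces of the model form -/

/-- `ℂ ⊕ ℂ^s ⊕ ℂ^m` with coordinates `(w, z, ζ)`; here `m = n - s`. -/
abbrev Amb (s m : ℕ) : Type := ℂ × (Fin s → ℂ) × (Fin m → ℂ)

variable {s m : ℕ}

/-- The function `Re w - (zᵀ H(ζ) z̄ + Re (z̄ᵀ S(ζ) z̄))`; a function of `(ζ, ζ̄)` is written as a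
function of `ζ`. -/
def defFun (H S : (Fin m → ℂ) → Matrix (Fin s) (Fin s) ℂ) (q : Amb s m) : ℝ :=
  q.1.re - ((q.2.1 ⬝ᵥ H q.2.2 *ᵥ star q.2.1).re + (star q.2.1 ⬝ᵥ S q.2.2 *ᵥ star q.2.1).re)

/-- Entrywise complex conjugate. -/
def conjM (A : Matrix (Fin s) (Fin s) ℂ) : Matrix (Fin s) (Fin s) ℂ := A.map star

/-- `½ (𝐇 (1 - 𝐒̄ 𝐇ᵀ 𝐒 𝐇)⁻¹ + (1 - 𝐇 𝐒̄ 𝐇ᵀ 𝐒)⁻¹ 𝐇)` -/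
def modelH (H₀ : Matrix (Fin s) (Fin s) ℂ) (T : (Fin m → ℂ) → Matrix (Fin s) (Fin s) ℂ)
    (ζ : Fin m → ℂ) : Matrix (Fin s) (Fin s) ℂ :=
  (1 / 2 : ℂ) • (H₀ * (1 - conjM (T ζ) * H₀ᵀ * T ζ * H₀)⁻¹
    + (1 - H₀ * conjM (T ζ) * H₀ᵀ * T ζ)⁻¹ * H₀)

/-- `𝐇ᵀ (1 - 𝐒 𝐇 𝐒̄ 𝐇ᵀ)⁻¹ 𝐒 𝐇` -/
def modelS (H₀ : Matrix (Fin s) (Fin s) ℂ) (T : (Fin m → ℂ) → Matrix (Fin s) (Fin s) ℂ)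
    (ζ : Fin m → ℂ) : Matrix (Fin s) (Fin s) ℂ :=
  H₀ᵀ * (1 - T ζ * H₀ * conjM (T ζ) * H₀ᵀ)⁻¹ * T ζ * H₀

/-- The defining function of the explicit model given by the pair `𝐇`, `𝐒(ζ)`. -/
def modelFun (H₀ : Matrix (Fin s) (Fin s) ℂ) (T : (Fin m → ℂ) → Matrix (Fin s) (Fin s) ℂ) :
    Amb s m → ℝ :=
  defFun (modelH H₀ T) (modelS H₀ T)

/-- The matrix `A_{ζ_α}(0)` of Wirtinger derivatives. -/
def partialAt (A : (Fin m → ℂ) → Matrix (Fin s) (Fin s) ℂ) (α : Fin m) :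
    Matrix (Fin s) (Fin s) ℂ :=
  Matrix.of fun j k => dHol (fun ζ => A ζ j k) 0 (Pi.single α 1)

/-- `S^{0,2}_α = (𝐇ᵀ)⁻¹ S_{ζ_α}(0,0) 𝐇⁻¹` with `𝐇 = H(0,0)`. -/
def symbolMatrix (H S : (Fin m → ℂ) → Matrix (Fin s) (Fin s) ℂ) (α : Fin m) :
    Matrix (Fin s) (Fin s) ℂ :=
  ((H 0)ᵀ)⁻¹ * partialAt S α * (H 0)⁻¹

/-- The span of the matrices `S^{0,2}_1, …, S^{0,2}_m`. -/
def symbolSpan (H S : (Fin m → ℂ) → Matrix (Fin s) (Fin s) ℂ) :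
    Submodule ℂ (Matrix (Fin s) (Fin s) ℂ) :=
  Submodule.span ℂ (Set.range (symbolMatrix H S))

/-! ### Positions in symmetric matrices -/

/-- Positions are compared by their minimum first and then by their maximum. -/
def posKey (p : Fin s × Fin s) : Fin s ×ₗ Fin s := toLex (min p.1 p.2, max p.1 p.2)

/-- The linear map `ζ ↦ (∑_α (B_α)_{p_β} ζ_α)_β` is injective. -/
def SeparatingPositions (B : Fin m → Matrix (Fin s) (Fin s) ℂ) (p : Fin m → Fin s × Fin s) : Prop :=
  Function.Injective
    (fun (ζ : Fin m → ℂ) (β : Fin m) => ∑ α, B α (p β).1 (p β).2 * ζ α)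

/-- `p` is lexicographically first among the tuples of positions with the injectivity property. -/
def IsFirstPositions (B : Fin m → Matrix (Fin s) (Fin s) ℂ) (p : Fin m → Fin s × Fin s) : Prop :=
  SeparatingPositions B p ∧ ∀ q : Fin m → Fin s × Fin s, SeparatingPositions B q →
    toLex (fun α => posKey (p α)) ≤ toLex (fun α => posKey (q α))

/-! ### Normal forms and coordinate changes -/

/-- `𝐒(ζ) = T ζ` is a symmetric matrix of germs at `0` of holomorphic functions with `𝐒(0) = 0` and
linearly independent `𝐒_{ζ_α}(0)`, normalized by `𝐒(ζ)_{p_α} = ζ_α` and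
`span {𝐒_{ζ_α}(0)} = W`. -/
structure IsNormalized (W : Submodule ℂ (Matrix (Fin s) (Fin s) ℂ)) (p : Fin m → Fin s × Fin s)
    (T : (Fin m → ℂ) → Matrix (Fin s) (Fin s) ℂ) : Prop where
  holomorphic : ∀ j k, AnalyticAt ℂ (fun ζ => T ζ j k) 0
  symmetric : ∀ᶠ ζ in 𝓝 0, (T ζ).IsSymm
  map_zero : T 0 = 0
  independent : LinearIndependent ℂ (partialAt T)
  entries : ∀ᶠ ζ in 𝓝 0, ∀ α, T ζ (p α).1 (p α).2 = ζ α
  span_eq : Submodule.span ℂ (Set.range (partialAt T)) = W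

/-- `φ` is a local biholomorphism at `0` fixing `0` (holomorphic with invertible differential),
and carries the germ at `0` of `{ρ = 0}` to the germ at `0` of `{ρ' = 0}`. -/
structure IsLocalEquiv (φ : Amb s m → Amb s m) (ρ ρ' : Amb s m → ℝ) : Prop where
  holomorphic : AnalyticAt ℂ φ 0
  map_zero : φ 0 = 0
  bijective : Function.Bijective (fderiv ℂ φ 0)
  germ : ∀ᶠ q in 𝓝 0, ρ q = 0 ↔ ρ' (φ q) = 0

/-- `Re ∂φ_w/∂w (0) > 0`: the change of coordinates `φ` does not interchange the two sides of the
hypersurfaces, `{Re w > …}` and `{Re w < …}`. -/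
def PreservesSides (φ : Amb s m → Amb s m) : Prop :=
  0 < ((fderiv ℂ φ 0 ((1, 0, 0) : Amb s m)).1).re

/-- For `ε = 1` this is `U(𝐇) ∩ G_{0,0}`: the matrices with `Uᵀ 𝐇 Ū = 𝐇` whose action
`A ↦ U A Uᵀ` preserves `W`. For `ε = -1` the matrices send `𝐇` to `-𝐇`
instead. -/
def symbolGroup (ε : ℂ) (H₀ : Matrix (Fin s) (Fin s) ℂ)
    (W : Submodule ℂ (Matrix (Fin s) (Fin s) ℂ)) : Set (Matrix (Fin s) (Fin s) ℂ) :=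
  {U | Uᵀ * H₀ * conjM U = ε • H₀ ∧ ∀ A, U * A * Uᵀ ∈ W ↔ A ∈ W}

/-- The map `(w, z, ζ) ↦ (ε w, U z, ζ + g(ζ))`. -/
def linMap (ε : ℂ) (U : Matrix (Fin s) (Fin s) ℂ) (g : (Fin m → ℂ) → (Fin m → ℂ))
    (q : Amb s m) : Amb s m :=
  (ε * q.1, U *ᵥ q.2.1, q.2.2 + g q.2.2)

end CRModel

end

/-! Existence. Polarize: replace the conjugates of z and ζ by independent variables χ and η. The
right side of the equation becomes Q = zᵀHχ + ½χᵀSχ + ½zᵀS'z with H, S, S' holomorphic in (ζ, η),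
and identities of holomorphic functions need only be checked for η = conj ζ (`eq_zero_of_diagonal`).
A vector of the Levi kernel is determined by its ζ-part. When the Levi form has rank s, every
ζ-direction lifts to the kernel; eliminating the z-part of the lift gives a second order system for
H, S, S' (`IsPolarization.isMinimalRank`).

The system is integrated by a zero curvature argument. For fixed ζ the vectors (z, ∂Q/∂z) with χ =
conj z form a real subspace of ℂ^{2s}, the fixed set of an antilinear involution with matrix J. The
system makes J⁻¹ ∂_η J independent of ζ, so J(ζ,η) = J(ζ,0) J(0,0)⁻¹ J(0,η). Hence H and S are
determined by H(ζ,0), S(ζ,0) and S'(ζ,0) (`IsMinimalRank.inv_transpose_eq`). A linear change z ↦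
G(ζ)z absorbs the first, w ↦ w - zᵀS'(ζ,0)z absorbs the third, and (𝐇ᵀ)⁻¹(S(ζ,0) - S(0,0))𝐇⁻¹ is the
matrix 𝐒(ζ) of the model (`model_factorization`, `exists_normalForm`). Its first derivatives at 0
are the S^{0,2}_α, which are linearly independent because 𝒦₃ = 0 (`linearIndependent_symbolMatrix`).
The inverse function theorem then makes the entries at the chosen positions equal to ζ.

Uniqueness. Two normalizations differ by an equivalence ψ of models 𝐒 and 𝐒'. The pair of ψ and its
conjugate preserves the complexified hypersurfaces (`IsPolarization.eventually_polFun_eq_zero`). At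
η = 0 the model reduces to zᵀ𝐇χ + ½χᵀ𝐇ᵀ𝐒(ζ)𝐇χ. It follows that ψ preserves {w = 0} and {w = z = 0},
and that the w-component of its differential at 0 is b dw with b real and nonzero. Comparing terms
of second order in (z, χ) gives Bᵀ𝐇 conj B = b𝐇 and b𝐒'(f(ζ)) = B𝐒(ζ)Bᵀ, where B is the z-block of
the differential at 0 and f the restriction of ψ to the ζ-space (`exists_linearPart`). Dividing B by
√|b| gives U in Γ₁ or Γ₋₁ according to the sign of b, and that sign records whether ψ interchanges
the sides.

Group action. For U in Γ₁ the matrix U𝐒Uᵀ again spans W to first order, so it is normalized by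
exactly one reparametrization: the entries of U𝐒Uᵀ at the chosen positions are the new coordinates.
-/

noncomputable section

namespace CRModel

/-! ### Analytic functions and conjugation -/

section Conjugation

variable {E F : Type*} [NormedAddCommGroup E] [NormedSpace ℂ E] [StarAddMonoid E]
  [NormedStarGroup E] [StarModule ℂ E] [NormedAddCommGroup F] [NormedSpace ℂ F] [StarAddMonoid F]
  [NormedStarGroup F] [StarModule ℂ F]

/-- The multilinear map `v ↦ conj (p (conj v))`. -/
def conjMultilinear {n : ℕ} (p : E [×n]→L[ℂ] F) : E [×n]→L[ℂ] F :=
  MultilinearMap.mkContinuous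
    { toFun := fun v => star (p fun i => star (v i))
      map_update_add' := by
        intro _ v i x y
        have h : ∀ x, (fun j => star (Function.update v i x j))
            = Function.update (fun j => star (v j)) i (star x) := by
          intro x; funext j
          by_cases hj : j = i
          · subst hj; simp
          · simp [hj]
        simp only [h, star_add, ContinuousMultilinearMap.map_update_add]
      map_update_smul' := by
        intro _ v i c x
        have h : ∀ x, (fun j => star (Function.update v i x j))
            = Function.update (fun j => star (v j)) i (star x) := by
          intro x; funext j
          by_cases hj : j = i
          · subst hj; simp
          · simp [hj]
        simp only [h, star_smul, ContinuousMultilinearMap.map_update_smul, star_star] }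
    ‖p‖ (fun v => by
      simp only [MultilinearMap.coe_mk, norm_star]
      refine (p.le_opNorm _).trans_eq ?_
      simp)

theorem conjMultilinear_apply {n : ℕ} (p : E [×n]→L[ℂ] F) (v : Fin n → E) :
    conjMultilinear p v = star (p fun i => star (v i)) := rfl

theorem norm_conjMultilinear_le {n : ℕ} (p : E [×n]→L[ℂ] F) : ‖conjMultilinear p‖ ≤ ‖p‖ :=
  MultilinearMap.mkContinuous_norm_le _ (norm_nonneg _) _

/-- The conjugate `x ↦ conj (f (conj x))` of a holomorphic function is holomorphic. -/
theorem AnalyticAt.star_comp_star {f : E → F} {x : E} (hf : AnalyticAt ℂ f (star x)) :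
    AnalyticAt ℂ (fun y => star (f (star y))) x := by
  obtain ⟨p, r, hp⟩ := hf
  refine ⟨fun n => conjMultilinear (p n), r, ?_, hp.r_pos, ?_⟩
  · refine hp.r_le.trans (ENNReal.le_of_forall_nnreal_lt fun ρ hρ => ?_)
    obtain ⟨C, -, hC⟩ := p.norm_mul_pow_le_of_lt_radius hρ
    refine FormalMultilinearSeries.le_radius_of_bound _ C fun n => le_trans ?_ (hC n)
    gcongr
    exact norm_conjMultilinear_le _
  · intro y hy
    have hy' : star y ∈ Metric.eball (0 : E) r := by
      simpa [Metric.mem_eball, edist_zero_right, enorm_eq_nnnorm] using hy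
    have h := (hp.hasSum hy').star
    simpa only [star_add, conjMultilinear_apply] using h

end Conjugation

/-! ### Local inverses -/

section Inverse

variable {E F : Type*} [NormedAddCommGroup E] [NormedSpace ℂ E] [CompleteSpace E]
  [NormedAddCommGroup F] [NormedSpace ℂ F] [CompleteSpace F]

/-- The inverse function theorem for germs at `0` of holomorphic maps. -/
theorem exists_analytic_inverse {f : E → F} (hf : AnalyticAt ℂ f 0) (h0 : f 0 = 0)
    (hb : Function.Bijective (fderiv ℂ f 0)) :
    ∃ g : F → E, AnalyticAt ℂ g 0 ∧ g 0 = 0 ∧ (∀ᶠ x in 𝓝 0, g (f x) = x) ∧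
      (∀ᶠ y in 𝓝 0, f (g y) = y) ∧ Function.Bijective (fderiv ℂ g 0) := by
  let i : E ≃L[ℂ] F := ContinuousLinearEquiv.ofBijective (fderiv ℂ f 0)
    (LinearMap.ker_eq_bot.2 hb.1) (LinearMap.range_eq_top.2 hb.2)
  have hi : (i : E →L[ℂ] F) = fderiv ℂ f 0 := by ext; rfl
  have hs : HasStrictFDerivAt f (i : E →L[ℂ] F) 0 := by
    rw [hi]; exact hf.hasStrictFDerivAt
  let R : OpenPartialHomeomorph E F := hs.toOpenPartialHomeomorph f
  have hx : (0 : E) ∈ R.source := hs.mem_toOpenPartialHomeomorph_source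
  have hg : AnalyticAt ℂ R.symm (R 0) := R.analyticAt_symm' hx hf hi.symm
  have hR0 : R 0 = 0 := h0
  have hl : ∀ᶠ x in 𝓝 (0 : E), R.symm (f x) = x := R.eventually_left_inverse hx
  have hr : ∀ᶠ y in 𝓝 (0 : F), f (R.symm y) = y := by
    have := R.eventually_right_inverse (R.map_source hx)
    rwa [hR0] at this
  have hg0 : R.symm 0 = 0 := by simpa [hR0] using R.left_inv hx
  rw [hR0] at hg
  refine ⟨R.symm, hg, hg0, hl, hr, ?_⟩
  have hf' : HasFDerivAt f (fderiv ℂ f 0) 0 := hf.differentiableAt.hasFDerivAt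
  have hg' : HasFDerivAt R.symm (fderiv ℂ R.symm 0) 0 := hg.differentiableAt.hasFDerivAt
  have e1 : (fderiv ℂ R.symm 0).comp (fderiv ℂ f 0) = ContinuousLinearMap.id ℂ E := by
    have h1 : HasFDerivAt R.symm (fderiv ℂ R.symm 0) (f 0) := by rwa [h0]
    exact (h1.comp 0 hf').unique ((hasFDerivAt_id (0 : E)).congr_of_eventuallyEq hl)
  have e2 : (fderiv ℂ f 0).comp (fderiv ℂ R.symm 0) = ContinuousLinearMap.id ℂ F := by
    have h1 : HasFDerivAt f (fderiv ℂ f 0) (R.symm 0) := by rwa [hg0]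
    exact (h1.comp 0 hg').unique ((hasFDerivAt_id (0 : F)).congr_of_eventuallyEq hr)
  refine ⟨fun a b hab => ?_, fun a => ⟨fderiv ℂ f 0 a, congrArg (fun L => L a) e1⟩⟩
  have := congrArg (fderiv ℂ f 0) hab
  exact (congrArg (fun L => L a) e2).symm.trans (this.trans (congrArg (fun L => L b) e2))

end Inverse

/-! ### Complexification of real analytic functions -/

section Complexification

/-- Each homogeneous term of the real power series is a polynomial with coefficients `p n (e_{i₁},
…, e_{iₙ})`, and the same polynomial makes sense on complex vectors. There are `card ι ^ n`
coefficients in degree n, so norms grow at most geometrically and the radius stays positive. -/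
theorem exists_complexification_pi {ι : Type*} [Fintype ι] {G : (ι → ℝ) → ℂ}
    (hG : AnalyticAt ℝ G 0) :
    ∃ Gc : (ι → ℂ) → ℂ, AnalyticAt ℂ Gc 0 ∧ ∀ᶠ x : ι → ℝ in 𝓝 0, Gc (fun i => (x i : ℂ)) = G x := by
  classical
  obtain ⟨p, r, hp⟩ := hG
  let q : FormalMultilinearSeries ℂ (ι → ℂ) ℂ := fun n =>
    ∑ idx : Fin n → ι, (p n fun j => Pi.single (idx j) 1) •
      (ContinuousMultilinearMap.mkPiAlgebra ℂ (Fin n) ℂ).compContinuousLinearMap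
        (fun j => ContinuousLinearMap.proj (R := ℂ) (φ := fun _ : ι => ℂ) (idx j))
  have hq : ∀ n (v : Fin n → ι → ℂ),
      q n v = ∑ idx : Fin n → ι, (p n fun j => Pi.single (idx j) 1) * ∏ j, v j (idx j) := by
    intro n v
    simp [q]
  have hqn : ∀ n, ‖q n‖ ≤ (Fintype.card ι : ℝ) ^ n * ‖p n‖ := by
    intro n
    refine ContinuousMultilinearMap.opNorm_le_bound (by positivity) fun v => ?_
    rw [hq]
    refine (norm_sum_le _ _).trans ?_
    have : ∀ idx : Fin n → ι, ‖(p n fun j => Pi.single (idx j) (1 : ℝ)) * ∏ j, v j (idx j)‖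
        ≤ ‖p n‖ * ∏ j, ‖v j‖ := by
      intro idx
      rw [norm_mul, norm_prod]
      gcongr with j _
      · refine ((p n).le_opNorm _).trans_eq ?_
        simp [Pi.norm_single]
      · exact norm_le_pi_norm _ _
    refine (Finset.sum_le_sum fun idx _ => this idx).trans_eq ?_
    simp [mul_assoc]
  have hqr : 0 < q.radius := by
    obtain ⟨C, a, hC, ha, h⟩ := p.le_mul_pow_of_radius_pos (hp.r_pos.trans_le hp.r_le)
    -- The added 1 keeps b positive when `ι` is empty.
    let b : ℝ := ((Fintype.card ι : ℝ) + 1) * a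
    have hb : 0 < b := by positivity
    have h1 : ∀ n, ‖q n‖ * ((⟨b⁻¹, by positivity⟩ : NNReal) : ℝ) ^ n ≤ C := by
      intro n
      have h2 : ‖q n‖ ≤ C * b ^ n := by
        refine (hqn n).trans ?_
        calc (Fintype.card ι : ℝ) ^ n * ‖p n‖
            ≤ ((Fintype.card ι : ℝ) + 1) ^ n * (C * a ^ n) := by
              gcongr
              · linarith
              · exact h n
          _ = C * b ^ n := by rw [mul_pow]; ring
      calc ‖q n‖ * (b⁻¹) ^ n ≤ C * b ^ n * (b⁻¹) ^ n := by gcongr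
        _ = C := by rw [mul_assoc, ← mul_pow, mul_inv_cancel₀ hb.ne', one_pow, mul_one]
    refine lt_of_lt_of_le ?_ (q.le_radius_of_bound C h1)
    exact ENNReal.coe_pos.2 (inv_pos.2 hb)
  refine ⟨q.sum, (q.hasFPowerSeriesOnBall hqr).analyticAt, ?_⟩
  have hball : ∀ᶠ x : ι → ℝ in 𝓝 0, x ∈ Metric.eball (0 : ι → ℝ) r :=
    Metric.eball_mem_nhds _ hp.r_pos
  filter_upwards [hball] with x hx
  have h := hp.hasSum hx
  rw [zero_add] at h
  rw [← h.tsum_eq, FormalMultilinearSeries.sum]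
  congr 1
  funext n
  rw [hq]
  have hx' : (fun _ : Fin n => x) = fun _ => ∑ i, x i • (Pi.single i 1 : ι → ℝ) := by
    funext j
    conv_lhs => rw [← Finset.univ_sum_single x]
    refine Finset.sum_congr rfl fun i _ => ?_
    rw [← Pi.single_smul, smul_eq_mul, mul_one]
  have key := (p n).toMultilinearMap.map_sum fun (_ : Fin n) i => x i • (Pi.single i 1 : ι → ℝ)
  rw [hx']
  refine Eq.trans ?_ key.symm
  refine Finset.sum_congr rfl fun idx _ => ?_
  rw [MultilinearMap.map_smul_univ]
  simp [mul_comm, Complex.real_smul]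

end Complexification

section Complexification

/-- A real analytic germ `F(ζ)` at `0 ∈ ℂ^k` is the restriction to `η = conj ζ` of a germ of a
holomorphic function of `(ζ, η)`. -/
theorem exists_complexification {k : ℕ} {F : (Fin k → ℂ) → ℂ} (hF : AnalyticAt ℝ F 0) :
    ∃ Fc : (Fin k → ℂ) × (Fin k → ℂ) → ℂ, AnalyticAt ℂ Fc 0 ∧
      ∀ᶠ ζ in 𝓝 0, Fc (ζ, star ζ) = F ζ := by
  let L : (Fin k ⊕ Fin k → ℝ) →L[ℝ] (Fin k → ℂ) :=
    ContinuousLinearMap.pi fun j =>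
      Complex.ofRealCLM.comp (ContinuousLinearMap.proj (R := ℝ) (φ := fun _ => ℝ) (Sum.inl j))
      + (I • Complex.ofRealCLM).comp
        (ContinuousLinearMap.proj (R := ℝ) (φ := fun _ => ℝ) (Sum.inr j))
  have hL : ∀ x j, L x j = x (Sum.inl j) + I * x (Sum.inr j) := fun x j => by simp [L]
  have hFL : AnalyticAt ℝ (fun x => F (L x)) 0 :=
    AnalyticAt.comp (g := F) (by simpa using hF) (L.analyticAt 0)
  obtain ⟨Gc, hGc, hG⟩ := exists_complexification_pi hFL
  -- The complex linear map (ζ, η) ↦ ((ζ + η)/2, (ζ - η)/(2i)); for η = conj ζ it gives the real and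
  -- imaginary parts of ζ.
  let A : (Fin k → ℂ) × (Fin k → ℂ) →L[ℂ] (Fin k ⊕ Fin k → ℂ) :=
    ContinuousLinearMap.pi fun i => Sum.elim
      (fun j => (1 / 2 : ℂ) • ((ContinuousLinearMap.proj (R := ℂ) (φ := fun _ => ℂ) j).comp
        (ContinuousLinearMap.fst ℂ (Fin k → ℂ) (Fin k → ℂ))
        + (ContinuousLinearMap.proj (R := ℂ) (φ := fun _ => ℂ) j).comp
        (ContinuousLinearMap.snd ℂ (Fin k → ℂ) (Fin k → ℂ))))
      (fun j => (-(1 / 2) * I : ℂ) • ((ContinuousLinearMap.proj (R := ℂ) (φ := fun _ => ℂ) j).comp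
        (ContinuousLinearMap.fst ℂ (Fin k → ℂ) (Fin k → ℂ))
        - (ContinuousLinearMap.proj (R := ℂ) (φ := fun _ => ℂ) j).comp
        (ContinuousLinearMap.snd ℂ (Fin k → ℂ) (Fin k → ℂ)))) i
  refine ⟨fun x => Gc (A x), AnalyticAt.comp (g := Gc) (by simpa using hGc) (A.analyticAt 0), ?_⟩
  let R : (Fin k → ℂ) → (Fin k ⊕ Fin k → ℝ) :=
    fun ζ => Sum.elim (fun j => (ζ j).re) (fun j => (ζ j).im)
  have hR : Continuous R := by
    refine continuous_pi fun i => ?_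
    rcases i with j | j
    · exact Complex.continuous_re.comp (continuous_apply j)
    · exact Complex.continuous_im.comp (continuous_apply j)
  have hR0 : R 0 = 0 := by
    funext i
    rcases i with j | j <;> simp [R]
  have hAR : ∀ ζ, A (ζ, star ζ) = fun i => ((R ζ i : ℝ) : ℂ) := by
    intro ζ; funext i
    rcases i with j | j
    · apply Complex.ext <;> simp [A, R] <;> ring
    · apply Complex.ext <;> simp [A, R] <;> ring
  have hLR : ∀ ζ, L (R ζ) = ζ := by
    intro ζ; funext j
    rw [hL]
    simp only [R, Sum.elim_inl, Sum.elim_inr]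
    rw [mul_comm, Complex.re_add_im]
  have ht : Tendsto R (𝓝 0) (𝓝 0) := by simpa [hR0] using hR.tendsto 0
  filter_upwards [ht.eventually hG] with ζ hζ
  rw [hAR, hζ, hLR]

end Complexification

/-! ### Functions on `E × E` -/

section Product

variable {E F : Type*} [NormedAddCommGroup E] [NormedSpace ℂ E]
  [NormedAddCommGroup F] [NormedSpace ℂ F]

/-- A holomorphic function of `(ζ, η)` vanishing for `η = conj ζ` vanishes identically. -/
theorem eq_zero_of_diagonal [StarAddMonoid E] [NormedStarGroup E] [StarModule ℂ E]
    [CompleteSpace F] {G : E × E → F} {r : ℝ} (hr : 0 < r)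
    (hG : AnalyticOnNhd ℂ G (Metric.ball 0 r))
    (h : ∀ᶠ ζ in 𝓝 (0 : E), G (ζ, star ζ) = 0) : ∀ x ∈ Metric.ball (0 : E × E) r, G x = 0 := by
  have hpre : ∀ {V : Type _} [NormedAddCommGroup V] [NormedSpace ℂ V] (ρ : ℝ),
      IsPreconnected (Metric.ball (0 : V) ρ) := by
    intro V _ _ ρ
    let _ : NormedSpace ℝ V := NormedSpace.restrictScalars ℝ ℂ V
    exact (convex_ball (0 : V) ρ).isPreconnected
  have hpreE : IsPreconnected (Metric.ball (0 : E × E) r) := by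
    let _ : NormedSpace ℝ (E × E) := NormedSpace.restrictScalars ℝ ℂ (E × E)
    exact (convex_ball (0 : E × E) r).isPreconnected
  refine hG.eqOn_zero_of_preconnected_of_eventuallyEq_zero hpreE (Metric.mem_ball_self hr) ?_
  obtain ⟨δ, hδ, hδG⟩ := Metric.eventually_nhds_iff_ball.1 h
  filter_upwards [Metric.ball_mem_nhds (0 : E × E) (show 0 < min r δ / 4 by positivity)] with x hx
  obtain ⟨ζ, η⟩ := x
  set a : E := (1 / 2 : ℂ) • (ζ + star η) with ha
  set b : E := (-(1 / 2) * I : ℂ) • (ζ - star η) with hb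
  have hx' : ‖ζ‖ < min r δ / 4 ∧ ‖η‖ < min r δ / 4 := by
    rw [mem_ball_zero_iff, Prod.norm_def] at hx
    exact max_lt_iff.1 hx
  have hna : ‖a‖ < min r δ / 4 := by
    rw [ha, norm_smul]
    have := norm_add_le ζ (star η)
    rw [norm_star] at this
    norm_num
    linarith [hx'.1, hx'.2]
  have hnb : ‖b‖ < min r δ / 4 := by
    rw [hb, norm_smul]
    have := norm_sub_le ζ (star η)
    rw [norm_star] at this
    norm_num
    linarith [hx'.1, hx'.2]
  -- A complex line that lies in the set η = conj ζ for real τ and passes through the given point at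
  -- τ = i. G vanishes on it for small real τ, hence on the disc of radius 2, which contains i. The
  -- quarter in the bounds leaves room for ‖a‖ + 2‖b‖ < r.
  let γ : ℂ → E × E := fun τ => (a + τ • b, star a + τ • star b)
  have hγn : ∀ τ : ℂ, ‖τ‖ < 2 → γ τ ∈ Metric.ball (0 : E × E) r := by
    intro τ hτ
    have h1 : ‖τ • b‖ ≤ 2 * ‖b‖ := by rw [norm_smul]; gcongr
    have h1' : ‖τ • star b‖ ≤ 2 * ‖b‖ := by rw [norm_smul, norm_star]; gcongr
    have h2 := norm_add_le a (τ • b)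
    have h3 := norm_add_le (star a) (τ • star b)
    rw [norm_star] at h3
    have h4 := min_le_left r δ
    rw [mem_ball_zero_iff, Prod.norm_def]
    exact max_lt (by simp only [γ]; linarith) (by simp only [γ]; linarith)
  have hγa : ∀ τ, AnalyticAt ℂ γ τ := by
    intro τ
    simp only [γ]
    fun_prop
  have hana : AnalyticOnNhd ℂ (fun τ => G (γ τ)) (Metric.ball (0 : ℂ) 2) := by
    intro τ hτ
    exact AnalyticAt.comp (hG _ (hγn τ (by simpa using hτ))) (hγa τ)
  have hfreq : ∃ᶠ τ in 𝓝[≠] (0 : ℂ), G (γ τ) = 0 := by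
    have ht : Tendsto (fun t : ℝ => (t : ℂ)) (𝓝[≠] (0 : ℝ)) (𝓝[≠] (0 : ℂ)) := by
      refine tendsto_nhdsWithin_iff.2 ⟨?_, ?_⟩
      · exact (Complex.continuous_ofReal.tendsto' 0 0 (by simp)).mono_left nhdsWithin_le_nhds
      · filter_upwards [self_mem_nhdsWithin] with t ht
        simpa using ht
    refine ht.frequently (Eventually.frequently ?_)
    have h1 : ∀ᶠ t : ℝ in 𝓝 0, ‖t‖ < 1 := by
      have := Metric.ball_mem_nhds (0 : ℝ) one_pos
      filter_upwards [this] with t ht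
      simpa using ht
    filter_upwards [h1.filter_mono nhdsWithin_le_nhds] with t ht
    have : γ t = (a + (t : ℂ) • b, star (a + (t : ℂ) • b)) := by
      simp only [γ, star_add, star_smul]
      congr 3
      simp
    rw [this]
    refine hδG _ ?_
    rw [mem_ball_zero_iff]
    have h1 : ‖(t : ℂ) • b‖ ≤ 1 * ‖b‖ := by
      rw [norm_smul]; gcongr; simpa using ht.le
    have h2 := norm_add_le a ((t : ℂ) • b)
    have h4 := min_le_right r δ
    linarith [norm_nonneg b]
  have hz := hana.eqOn_zero_of_preconnected_of_frequently_eq_zero (hpre 2)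
    (Metric.mem_ball_self two_pos) hfreq (show I ∈ Metric.ball (0 : ℂ) 2 by simp)
  have hγI : γ I = (ζ, η) := by
    simp only [γ, ha, hb, star_smul, star_add, star_sub, star_star, smul_smul]
    have e1 : I * (-(1 / 2) * I) = 1 / 2 := by linear_combination (-1 / 2 : ℂ) * I_mul_I
    have e2 : star (1 / 2 : ℂ) = 1 / 2 := by simp
    have e3 : I * star (-(1 / 2) * I) = -(1 / 2) := by
      simp; linear_combination (1 / 2 : ℂ) * I_mul_I
    rw [e1, e2, e3]
    refine Prod.ext ?_ ?_
    · simp only; module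
    · simp only; module
  simpa [hγI] using hz

theorem eq_of_fderiv_snd_eq_zero {E' : Type*} [NormedAddCommGroup E'] [NormedSpace ℂ E']
    {G : E × E' → F} {r : ℝ} (hG : DifferentiableOn ℂ G (Metric.ball 0 r))
    (h : ∀ x ∈ Metric.ball (0 : E × E') r, ∀ b, fderiv ℂ G x (0, b) = 0) :
    ∀ x ∈ Metric.ball (0 : E × E') r, G x = G (x.1, 0) := by
  rintro ⟨ζ, η⟩ hx
  have hx' : ‖ζ‖ < r ∧ ‖η‖ < r := by
    rw [mem_ball_zero_iff, Prod.norm_def] at hx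
    exact max_lt_iff.1 hx
  have hmem : ∀ η' ∈ Metric.ball (0 : E') r, (ζ, η') ∈ Metric.ball (0 : E × E') r := by
    intro η' h'
    rw [mem_ball_zero_iff] at h' ⊢
    exact max_lt hx'.1 h'
  have hd : ∀ η' ∈ Metric.ball (0 : E') r, HasFDerivAt (fun y => G (ζ, y)) (0 : E' →L[ℂ] F) η' := by
    intro η' h'
    have h1 := (hG.differentiableAt (Metric.isOpen_ball.mem_nhds (hmem η' h'))).hasFDerivAt
    have h2 := h1.comp η' (hasFDerivAt_prodMk_right ζ η')
    refine h2.congr_fderiv ?_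
    ext b
    simpa using h _ (hmem η' h') b
  let _ : NormedSpace ℝ E' := NormedSpace.restrictScalars ℝ ℂ E'
  refine Metric.isOpen_ball.is_const_of_fderiv_eq_zero (𝕜 := ℂ) (f := fun y => G (ζ, y))
    (convex_ball (0 : E') r).isPreconnected
    (fun y hy => (hd y hy).differentiableAt.differentiableWithinAt)
    (fun y hy => (hd y hy).fderiv) (by simpa using hx'.2)
    (Metric.mem_ball_self ((norm_nonneg _).trans_lt hx'.1))

theorem eq_of_fderiv_fst_eq_zero {E' : Type*} [NormedAddCommGroup E'] [NormedSpace ℂ E']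
    {G : E × E' → F} {r : ℝ} (hG : DifferentiableOn ℂ G (Metric.ball 0 r))
    (h : ∀ x ∈ Metric.ball (0 : E × E') r, ∀ a, fderiv ℂ G x (a, 0) = 0) :
    ∀ x ∈ Metric.ball (0 : E × E') r, G x = G (0, x.2) := by
  have hmem : ∀ x : E' × E, x ∈ Metric.ball (0 : E' × E) r → x.swap ∈ Metric.ball (0 : E × E') r := by
    intro x hx
    rw [mem_ball_zero_iff, Prod.norm_def] at hx ⊢
    rwa [max_comm]
  have hsw : ∀ x : E' × E, HasFDerivAt (Prod.swap : E' × E → E × E')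
      ((ContinuousLinearMap.snd ℂ E' E).prod (ContinuousLinearMap.fst ℂ E' E)) x := fun x =>
    ((ContinuousLinearMap.snd ℂ E' E).prod (ContinuousLinearMap.fst ℂ E' E)).hasFDerivAt
  have hd : ∀ x ∈ Metric.ball (0 : E' × E) r, HasFDerivAt (fun y => G (Prod.swap y))
      ((fderiv ℂ G x.swap).comp
        ((ContinuousLinearMap.snd ℂ E' E).prod (ContinuousLinearMap.fst ℂ E' E))) x :=
    fun x hx => ((hG.differentiableAt
      (Metric.isOpen_ball.mem_nhds (hmem x hx))).hasFDerivAt).comp x (hsw x)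
  rintro x hx
  refine eq_of_fderiv_snd_eq_zero (G := fun y => G (Prod.swap y)) (r := r)
    (fun y hy => (hd y hy).differentiableAt.differentiableWithinAt) (fun y hy b => ?_) x.swap ?_
  · rw [(hd y hy).fderiv]
    simpa using h _ (hmem y hy) b
  · rw [mem_ball_zero_iff, Prod.norm_def] at hx ⊢
    rwa [max_comm]

end Product

/-! ### Matrix valued holomorphic functions -/

section MatrixCalculus

variable {X Y : Type*} [NormedAddCommGroup X] [NormedSpace ℂ X]
  [NormedAddCommGroup Y] [NormedSpace ℂ Y]
  {p q k n : Type*}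

/-- The entries of `M` are holomorphic at `x`. -/
def MatAnalyticAt (M : X → Matrix p q ℂ) (x : X) : Prop :=
  ∀ i j, AnalyticAt ℂ (fun y => M y i j) x

/-- The derivative of the matrix valued function `M` at `x` in the direction `v`. -/
def matDeriv (M : X → Matrix p q ℂ) (x v : X) : Matrix p q ℂ :=
  Matrix.of fun i j => fderiv ℂ (fun y => M y i j) x v

theorem matDeriv_apply (M : X → Matrix p q ℂ) (x v : X) (i : p) (j : q) :
    matDeriv M x v i j = fderiv ℂ (fun y => M y i j) x v := rfl

namespace MatAnalyticAt

variable {M N : X → Matrix p q ℂ} {x : X}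

theorem differentiableAt (hM : MatAnalyticAt M x) (i : p) (j : q) :
    DifferentiableAt ℂ (fun y => M y i j) x := (hM i j).differentiableAt

theorem const (A : Matrix p q ℂ) : MatAnalyticAt (fun _ : X => A) x := fun _ _ => analyticAt_const

theorem add (hM : MatAnalyticAt M x) (hN : MatAnalyticAt N x) :
    MatAnalyticAt (fun y => M y + N y) x := fun i j => (hM i j).add (hN i j)

theorem sub (hM : MatAnalyticAt M x) (hN : MatAnalyticAt N x) :
    MatAnalyticAt (fun y => M y - N y) x := fun i j => (hM i j).sub (hN i j)

theorem neg (hM : MatAnalyticAt M x) : MatAnalyticAt (fun y => -M y) x := fun i j => (hM i j).neg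

theorem transpose (hM : MatAnalyticAt M x) : MatAnalyticAt (fun y => (M y)ᵀ) x :=
  fun i j => hM j i

theorem mul [Fintype q] {N : X → Matrix q k ℂ} (hM : MatAnalyticAt M x) (hN : MatAnalyticAt N x) :
    MatAnalyticAt (fun y => M y * N y) x := fun i j => by
  simp only [Matrix.mul_apply]
  exact Finset.analyticAt_fun_sum _ fun l _ => (hM i l).mul (hN l j)

theorem comp {M : Y → Matrix p q ℂ} {f : X → Y} (hM : MatAnalyticAt M (f x))
    (hf : AnalyticAt ℂ f x) : MatAnalyticAt (fun y => M (f y)) x :=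
  fun i j => AnalyticAt.comp (g := fun y => M y i j) (hM i j) hf

theorem fromBlocks {p' q' : Type*} {A : X → Matrix p q ℂ} {B : X → Matrix p q' ℂ}
    {C : X → Matrix p' q ℂ} {D : X → Matrix p' q' ℂ} (hA : MatAnalyticAt A x)
    (hB : MatAnalyticAt B x) (hC : MatAnalyticAt C x) (hD : MatAnalyticAt D x) :
    MatAnalyticAt (fun y => Matrix.fromBlocks (A y) (B y) (C y) (D y)) x := by
  rintro (i | i) (j | j)
  exacts [hA i j, hB i j, hC i j, hD i j]

theorem det [Fintype n] [DecidableEq n] {M : X → Matrix n n ℂ} (hM : MatAnalyticAt M x) :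
    AnalyticAt ℂ (fun y => (M y).det) x := by
  simp only [Matrix.det_apply]
  refine Finset.analyticAt_fun_sum _ fun σ _ => ?_
  have h : AnalyticAt ℂ (fun y => ∏ i, M y (σ i) i) x :=
    Finset.analyticAt_fun_prod _ fun i _ => hM _ _
  rcases Int.units_eq_one_or (Equiv.Perm.sign σ) with h1 | h1
  · simpa [h1] using h
  · simp only [h1, Units.neg_smul, one_smul]
    exact h.fun_neg

theorem eventually_isUnit_det [Fintype n] [DecidableEq n] {M : X → Matrix n n ℂ}
    (hM : MatAnalyticAt M x) (hu : IsUnit (M x).det) : ∀ᶠ y in 𝓝 x, IsUnit (M y).det :=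
  (hM.det.continuousAt.eventually_ne hu.ne_zero).mono fun _ hy => hy.isUnit

theorem inv [Fintype n] [DecidableEq n] {M : X → Matrix n n ℂ} (hM : MatAnalyticAt M x)
    (hu : IsUnit (M x).det) : MatAnalyticAt (fun y => (M y)⁻¹) x := by
  intro i j
  have h1 : AnalyticAt ℂ (fun y => (M y).adjugate i j) x := by
    simp only [Matrix.adjugate_apply]
    refine det fun a b => ?_
    by_cases ha : a = j
    · subst ha; simpa using analyticAt_const
    · simpa [ha] using hM a b
  have h2 := (hM.det.fun_inv hu.ne_zero).fun_mul h1
  simp only [Matrix.inv_def, Ring.inverse_eq_inv', Matrix.smul_apply, smul_eq_mul]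
  exact h2

theorem matDeriv [CompleteSpace X] (hM : MatAnalyticAt M x) (v : X) :
    MatAnalyticAt (fun y => matDeriv M y v) x := fun i j => by
  have h1 : AnalyticAt ℂ (fderiv ℂ fun y => M y i j) x := (hM i j).fderiv
  exact ((ContinuousLinearMap.apply ℂ ℂ v).analyticAt _).comp h1

end MatAnalyticAt

variable {M N : X → Matrix p q ℂ} {x : X}

theorem matDeriv_congr (h : M =ᶠ[𝓝 x] N) (v : X) : matDeriv M x v = matDeriv N x v := by
  ext i j
  have h' : (fun y => M y i j) =ᶠ[𝓝 x] fun y => N y i j := h.mono fun y hy => by simp only [hy]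
  rw [matDeriv_apply, matDeriv_apply, h'.fderiv_eq]

theorem matDeriv_const (A : Matrix p q ℂ) (x v : X) : matDeriv (fun _ => A) x v = 0 := by
  ext i j
  simp [matDeriv_apply]

theorem matDeriv_add (hM : MatAnalyticAt M x) (hN : MatAnalyticAt N x) (v : X) :
    matDeriv (fun y => M y + N y) x v = matDeriv M x v + matDeriv N x v := by
  ext i j
  simp only [matDeriv_apply, Matrix.add_apply]
  rw [fderiv_fun_add (hM.differentiableAt i j) (hN.differentiableAt i j)]
  rfl

theorem matDeriv_sub (hM : MatAnalyticAt M x) (hN : MatAnalyticAt N x) (v : X) :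
    matDeriv (fun y => M y - N y) x v = matDeriv M x v - matDeriv N x v := by
  ext i j
  simp only [matDeriv_apply, Matrix.sub_apply]
  rw [fderiv_fun_sub (hM.differentiableAt i j) (hN.differentiableAt i j)]
  rfl

theorem matDeriv_neg (x v : X) : matDeriv (fun y => -M y) x v = -matDeriv M x v := by
  ext i j
  simp only [matDeriv_apply, Matrix.neg_apply]
  rw [fderiv_fun_neg]
  rfl

theorem matDeriv_transpose (x v : X) : matDeriv (fun y => (M y)ᵀ) x v = (matDeriv M x v)ᵀ := rfl

theorem matDeriv_mul [Fintype q] {N : X → Matrix q k ℂ} (hM : MatAnalyticAt M x)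
    (hN : MatAnalyticAt N x) (v : X) :
    matDeriv (fun y => M y * N y) x v = matDeriv M x v * N x + M x * matDeriv N x v := by
  ext i j
  simp only [matDeriv_apply, Matrix.mul_apply, Matrix.add_apply]
  have hd : ∀ l ∈ Finset.univ, DifferentiableAt ℂ (fun y => M y i l * N y l j) x :=
    fun l _ => (hM.differentiableAt i l).fun_mul (hN.differentiableAt l j)
  rw [fderiv_fun_sum hd, _root_.sum_apply, ← Finset.sum_add_distrib]
  refine Finset.sum_congr rfl fun l _ => ?_
  rw [fderiv_fun_mul (hM.differentiableAt i l) (hN.differentiableAt l j)]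
  simp only [_root_.add_apply, _root_.smul_apply, smul_eq_mul]
  ring

theorem matDeriv_comp {M : Y → Matrix p q ℂ} {f : X → Y} (hM : MatAnalyticAt M (f x))
    (hf : DifferentiableAt ℂ f x) (v : X) :
    matDeriv (fun y => M (f y)) x v = matDeriv M (f x) (fderiv ℂ f x v) := by
  ext i j
  simp only [matDeriv_apply]
  rw [fderiv_fun_comp x (hM.differentiableAt i j) hf]
  rfl

theorem matDeriv_fromBlocks {p' q' : Type*} (A : X → Matrix p q ℂ) (B : X → Matrix p q' ℂ)
    (C : X → Matrix p' q ℂ) (D : X → Matrix p' q' ℂ) (x v : X) :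
    matDeriv (fun y => Matrix.fromBlocks (A y) (B y) (C y) (D y)) x v
      = Matrix.fromBlocks (matDeriv A x v) (matDeriv B x v) (matDeriv C x v) (matDeriv D x v) := by
  ext (i | i) (j | j) <;> rfl

theorem matDeriv_inv [Fintype n] [DecidableEq n] {M : X → Matrix n n ℂ} (hM : MatAnalyticAt M x)
    (hu : IsUnit (M x).det) (v : X) :
    matDeriv (fun y => (M y)⁻¹) x v = -((M x)⁻¹ * matDeriv M x v * (M x)⁻¹) := by
  have h1 : (fun y => M y * (M y)⁻¹) =ᶠ[𝓝 x] fun _ => 1 :=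
    (hM.eventually_isUnit_det hu).mono fun y hy => Matrix.mul_nonsing_inv _ hy
  have h2 := matDeriv_congr h1 v
  rw [matDeriv_mul hM (hM.inv hu), matDeriv_const] at h2
  have h3 := congrArg (fun A => (M x)⁻¹ * A) h2
  simp only [mul_add, mul_zero] at h3
  rw [← mul_assoc (M x)⁻¹ (M x), Matrix.nonsing_inv_mul _ hu, one_mul, ← mul_assoc] at h3
  exact eq_neg_of_add_eq_zero_right h3

theorem eq_of_matDeriv_fst_eq_zero {E : Type*} [NormedAddCommGroup E] [NormedSpace ℂ E]
    {B : E × E → Matrix p q ℂ} {r : ℝ} (hB : ∀ x ∈ Metric.ball (0 : E × E) r, MatAnalyticAt B x)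
    (h : ∀ x ∈ Metric.ball (0 : E × E) r, ∀ a, matDeriv B x (a, 0) = 0) :
    ∀ x ∈ Metric.ball (0 : E × E) r, B x = B (0, x.2) := fun x hx => by
  ext i j
  exact eq_of_fderiv_fst_eq_zero (G := fun y => B y i j)
    (fun y hy => ((hB y hy) i j).differentiableAt.differentiableWithinAt)
    (fun y hy a => congrFun (congrFun (h y hy a) i) j) x hx

theorem eq_of_matDeriv_snd_eq_zero {E : Type*} [NormedAddCommGroup E] [NormedSpace ℂ E]
    {B : E × E → Matrix p q ℂ} {r : ℝ} (hB : ∀ x ∈ Metric.ball (0 : E × E) r, MatAnalyticAt B x)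
    (h : ∀ x ∈ Metric.ball (0 : E × E) r, ∀ a, matDeriv B x (0, a) = 0) :
    ∀ x ∈ Metric.ball (0 : E × E) r, B x = B (x.1, 0) := fun x hx => by
  ext i j
  exact eq_of_fderiv_snd_eq_zero (G := fun y => B y i j)
    (fun y hy => ((hB y hy) i j).differentiableAt.differentiableWithinAt)
    (fun y hy a => congrFun (congrFun (h y hy a) i) j) x hx

theorem mem_ball_fst {E : Type*} [NormedAddCommGroup E] {x : E × E} {r : ℝ}
    (hx : x ∈ Metric.ball (0 : E × E) r) : (x.1, (0 : E)) ∈ Metric.ball (0 : E × E) r := by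
  rw [mem_ball_zero_iff, Prod.norm_def] at hx ⊢
  exact max_lt (max_lt_iff.1 hx).1 (by simpa using (norm_nonneg _).trans_lt (max_lt_iff.1 hx).1)

theorem mem_ball_snd {E : Type*} [NormedAddCommGroup E] {x : E × E} {r : ℝ}
    (hx : x ∈ Metric.ball (0 : E × E) r) : ((0 : E), x.2) ∈ Metric.ball (0 : E × E) r := by
  rw [mem_ball_zero_iff, Prod.norm_def] at hx ⊢
  exact max_lt (by simpa using (norm_nonneg _).trans_lt (max_lt_iff.1 hx).1) (max_lt_iff.1 hx).2

/-- If `J⁻¹ ∂_η J` does not depend on `ζ`, then `J(ζ,η) = J(ζ,0) J(0,0)⁻¹ J(0,η)`. -/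
theorem eq_mul_of_logDeriv {E : Type*} [NormedAddCommGroup E] [NormedSpace ℂ E]
    [Fintype n] [DecidableEq n] {J : E × E → Matrix n n ℂ} {B : E → E × E → Matrix n n ℂ} {r : ℝ}
    (hJ : ∀ x ∈ Metric.ball (0 : E × E) r, MatAnalyticAt J x)
    (hu : ∀ x ∈ Metric.ball (0 : E × E) r, IsUnit (J x).det)
    (hB : ∀ b, ∀ x ∈ Metric.ball (0 : E × E) r, MatAnalyticAt (B b) x)
    (hJB : ∀ b, ∀ x ∈ Metric.ball (0 : E × E) r, matDeriv J x (0, b) = J x * B b x)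
    (hB0 : ∀ a b, ∀ x ∈ Metric.ball (0 : E × E) r, matDeriv (B b) x (a, 0) = 0) :
    ∀ x ∈ Metric.ball (0 : E × E) r, J x = J (x.1, 0) * (J 0)⁻¹ * J (0, x.2) := by
  let P : E × E →L[ℂ] E × E :=
    (0 : E × E →L[ℂ] E).prod (ContinuousLinearMap.snd ℂ E E)
  have hP : ∀ x, P x = (0, x.2) := fun x => rfl
  have hN : ∀ x ∈ Metric.ball (0 : E × E) r, MatAnalyticAt (fun y => J (P y)) x := fun x hx =>
    MatAnalyticAt.comp (f := P) (hJ _ (mem_ball_snd hx)) (P.analyticAt x)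
  have hNu : ∀ x ∈ Metric.ball (0 : E × E) r, IsUnit (J (P x)).det :=
    fun x hx => hu _ (mem_ball_snd hx)
  -- J(ζ,η) and J(0,η) satisfy the same linear equation in η, as B(ζ,η) = B(0,η); hence J(ζ,η)
  -- J(0,η)⁻¹ is constant in η.
  have key := eq_of_matDeriv_snd_eq_zero (B := fun y => J y * (J (P y))⁻¹)
    (fun x hx => (hJ x hx).mul ((hN x hx).inv (hNu x hx))) (fun x hx b => by
      rw [matDeriv_mul (hJ x hx) ((hN x hx).inv (hNu x hx)), matDeriv_inv (hN x hx) (hNu x hx),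
        matDeriv_comp (f := P) (hJ _ (mem_ball_snd hx)) P.differentiableAt]
      have e1 : fderiv ℂ P x (0, b) = (0, b) := by rw [P.fderiv]; rfl
      have e2 := hJB b (P x) (mem_ball_snd hx)
      rw [e1, e2, hJB b x hx, eq_of_matDeriv_fst_eq_zero (hB b) (fun y hy a => hB0 a b y hy) x hx,
        ← mul_assoc (J (P x))⁻¹, Matrix.nonsing_inv_mul _ (hNu x hx), one_mul, mul_neg, hP,
        mul_assoc, add_neg_cancel])
  intro x hx
  have h := key x hx
  simp only [hP] at h
  rw [← Prod.mk_zero_zero, ← h, mul_assoc, Matrix.nonsing_inv_mul _ (hu _ (mem_ball_snd hx)),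
    mul_one]

end MatrixCalculus

/-! ### Integration of the equations of Levi rank `s` -/

section Factorization

variable {E : Type*} [NormedAddCommGroup E] [NormedSpace ℂ E] [CompleteSpace E]
  {n : Type*} [Fintype n] [DecidableEq n]

/-- The system expressing that the hypersurface
`Re w = zᵀ H χ + ½ χᵀ S χ + ½ zᵀ S' z` has Levi form of minimal rank; here `χ = conj z`, and
`H`, `S`, `S'` are functions of `ζ` and `η = conj ζ`. -/
structure IsMinimalRank (H S S' : E × E → Matrix n n ℂ) (r : ℝ) : Prop where
  anH : ∀ x ∈ Metric.ball (0 : E × E) r, MatAnalyticAt H x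
  anS : ∀ x ∈ Metric.ball (0 : E × E) r, MatAnalyticAt S x
  anS' : ∀ x ∈ Metric.ball (0 : E × E) r, MatAnalyticAt S' x
  symS : ∀ x ∈ Metric.ball (0 : E × E) r, (S x)ᵀ = S x
  symS' : ∀ x ∈ Metric.ball (0 : E × E) r, (S' x)ᵀ = S' x
  unit : ∀ x ∈ Metric.ball (0 : E × E) r, IsUnit (H x).det
  eqH : ∀ x ∈ Metric.ball (0 : E × E) r, ∀ a b : E,
    matDeriv (fun y => matDeriv H y (0, b)) x (a, 0)
      = matDeriv H x (a, 0) * (H x)⁻¹ * matDeriv H x (0, b)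
        + matDeriv S' x (0, b) * ((H x)⁻¹)ᵀ * matDeriv S x (a, 0)
  eqS : ∀ x ∈ Metric.ball (0 : E × E) r, ∀ a b : E,
    matDeriv (fun y => matDeriv S y (0, b)) x (a, 0)
      = matDeriv S x (a, 0) * (H x)⁻¹ * matDeriv H x (0, b)
        + (matDeriv H x (0, b))ᵀ * ((H x)⁻¹)ᵀ * matDeriv S x (a, 0)
  eqS' : ∀ x ∈ Metric.ball (0 : E × E) r, ∀ a b : E,
    matDeriv (fun y => matDeriv S' y (0, b)) x (a, 0)
      = matDeriv S' x (0, b) * ((H x)⁻¹)ᵀ * (matDeriv H x (a, 0))ᵀ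
        + matDeriv H x (a, 0) * (H x)⁻¹ * matDeriv S' x (0, b)

variable {H S S' : E × E → Matrix n n ℂ} {r : ℝ}

omit [CompleteSpace E] [Fintype n] [DecidableEq n] in
theorem matDeriv_transpose_of_symm (h : ∀ x ∈ Metric.ball (0 : E × E) r, (S x)ᵀ = S x)
    {x : E × E} (hx : x ∈ Metric.ball (0 : E × E) r) (v : E × E) :
    (matDeriv S x v)ᵀ = matDeriv S x v := by
  rw [← matDeriv_transpose]
  exact matDeriv_congr (Filter.eventually_of_mem (Metric.isOpen_ball.mem_nhds hx) h) v

/-- The matrix of the antilinear involution of `ℂ^{2s}` whose fixed points are the vectors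
`(z, H conj z + S' z)`. -/
def involutionMatrix (H S S' : E × E → Matrix n n ℂ) (x : E × E) : Matrix (n ⊕ n) (n ⊕ n) ℂ :=
  fromBlocks (-(((H x)⁻¹)ᵀ * S x)) (((H x)⁻¹)ᵀ) (H x - S' x * (((H x)⁻¹)ᵀ * S x))
    (S' x * ((H x)⁻¹)ᵀ)

/-- Obtained from `involutionMatrix` by exchanging H with Hᵀ and S with S', which is entrywise
conjugation when η = conj ζ. That this is the inverse expresses J conj(J) = 1, the involution
property. -/
def involutionInv (H S S' : E × E → Matrix n n ℂ) (x : E × E) : Matrix (n ⊕ n) (n ⊕ n) ℂ :=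
  fromBlocks (-((H x)⁻¹ * S' x)) ((H x)⁻¹) ((H x)ᵀ - S x * ((H x)⁻¹ * S' x)) (S x * (H x)⁻¹)

omit [NormedAddCommGroup E] [NormedSpace ℂ E] [CompleteSpace E] in
theorem involutionMatrix_mul_inv {x : E × E} (hu : IsUnit (H x).det) :
    involutionMatrix H S S' x * involutionInv H S S' x = 1 := by
  have h1 : H x * (H x)⁻¹ = 1 := Matrix.mul_nonsing_inv _ hu
  have h2 : ((H x)⁻¹)ᵀ * (H x)ᵀ = 1 := by rw [← Matrix.transpose_mul, h1, Matrix.transpose_one]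
  rw [involutionMatrix, involutionInv, fromBlocks_multiply, ← fromBlocks_one]
  simp only [mul_sub, sub_mul, neg_mul, mul_neg, neg_neg, mul_assoc, h1, h2]
  congr 1
  · abel
  · abel
  · rw [← mul_assoc (H x), h1]; simp
  · simp

/-- The logarithmic derivative of `involutionMatrix` in `η`. -/
def involutionLogDeriv (H S S' : E × E → Matrix n n ℂ) (b : E) (x : E × E) :
    Matrix (n ⊕ n) (n ⊕ n) ℂ :=
  fromBlocks
    ((H x)⁻¹ * matDeriv H x (0, b) - (H x)⁻¹ * matDeriv S' x (0, b) * ((H x)⁻¹)ᵀ * S x)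
    ((H x)⁻¹ * matDeriv S' x (0, b) * ((H x)⁻¹)ᵀ)
    (S x * ((H x)⁻¹ * matDeriv H x (0, b) - (H x)⁻¹ * matDeriv S' x (0, b) * ((H x)⁻¹)ᵀ * S x)
      - matDeriv S x (0, b) + (matDeriv H x (0, b))ᵀ * ((H x)⁻¹)ᵀ * S x)
    (S x * ((H x)⁻¹ * matDeriv S' x (0, b) * ((H x)⁻¹)ᵀ)
      - (matDeriv H x (0, b))ᵀ * ((H x)⁻¹)ᵀ)

namespace IsMinimalRank

-- The product rule alone, valid for every holomorphic triple with H invertible; the rank equations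
-- enter in `matDeriv_involutionLogDeriv`.
omit [CompleteSpace E] in
theorem matDeriv_involutionMatrix (h : IsMinimalRank H S S' r) (b : E) {x : E × E}
    (hx : x ∈ Metric.ball (0 : E × E) r) :
    matDeriv (involutionMatrix H S S') x (0, b)
      = involutionMatrix H S S' x * involutionLogDeriv H S S' b x := by
  have hH := h.anH x hx
  have hS := h.anS x hx
  have hS' := h.anS' x hx
  have hu := h.unit x hx
  have hI := hH.inv hu
  have hIt := hI.transpose
  have h1 : H x * (H x)⁻¹ = 1 := Matrix.mul_nonsing_inv _ hu
  have h1' : ∀ A, H x * ((H x)⁻¹ * A) = A := fun A => by rw [← mul_assoc, h1, one_mul]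
  unfold involutionMatrix involutionLogDeriv
  rw [matDeriv_fromBlocks, fromBlocks_multiply, matDeriv_neg, matDeriv_mul hIt hS,
    matDeriv_sub hH (hS'.mul (hIt.mul hS)), matDeriv_mul hS' (hIt.mul hS), matDeriv_mul hIt hS,
    matDeriv_mul hS' hIt, matDeriv_transpose, matDeriv_inv hH hu]
  simp only [transpose_neg, transpose_mul, mul_sub, sub_mul, mul_add, neg_mul, mul_neg,
    mul_assoc, h1']
  congr 1 <;> abel

/-- The three rank equations are what makes the blocks independent of ζ: `eqS'` settles the upper
right block, `eqH` then the upper left one and, transposed, the lower right one, and `eqS` finally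
the lower left one. -/
theorem matDeriv_involutionLogDeriv (h : IsMinimalRank H S S' r) (a b : E) {x : E × E}
    (hx : x ∈ Metric.ball (0 : E × E) r) :
    matDeriv (involutionLogDeriv H S S' b) x (a, 0) = 0 := by
  have hH := h.anH x hx
  have hS := h.anS x hx
  have hS' := h.anS' x hx
  have hu := h.unit x hx
  have hI := hH.inv hu
  have hIt := hI.transpose
  have hHb := hH.matDeriv (0, b)
  have hSb := hS.matDeriv (0, b)
  have hSb' := hS'.matDeriv (0, b)
  have h1 : H x * (H x)⁻¹ = 1 := Matrix.mul_nonsing_inv _ hu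
  have h1' : ∀ A, H x * ((H x)⁻¹ * A) = A := fun A => by rw [← mul_assoc, h1, one_mul]
  have c12 := (hI.mul hSb').mul hIt
  have c11 := (hI.mul hHb).sub (c12.mul hS)
  have d12 : matDeriv (fun x => (H x)⁻¹ * matDeriv S' x (0, b) * ((H x)⁻¹)ᵀ) x (a, 0) = 0 := by
    rw [matDeriv_mul (hI.mul hSb') hIt, matDeriv_mul hI hSb', matDeriv_transpose,
      matDeriv_inv hH hu, h.eqS' x hx]
    simp only [transpose_neg, transpose_mul, mul_add, add_mul, neg_mul, mul_neg, mul_assoc]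
    abel
  have d11 : matDeriv (fun x => (H x)⁻¹ * matDeriv H x (0, b)
      - (H x)⁻¹ * matDeriv S' x (0, b) * ((H x)⁻¹)ᵀ * S x) x (a, 0) = 0 := by
    rw [matDeriv_sub (hI.mul hHb) (c12.mul hS), matDeriv_mul c12 hS, d12, matDeriv_mul hI hHb,
      matDeriv_inv hH hu, h.eqH x hx]
    simp only [mul_add, neg_mul, zero_mul, mul_assoc]
    abel
  have dHR : matDeriv (fun x => (matDeriv H x (0, b))ᵀ * ((H x)⁻¹)ᵀ) x (a, 0)
      = matDeriv S x (a, 0) * ((H x)⁻¹ * matDeriv S' x (0, b) * ((H x)⁻¹)ᵀ) := by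
    rw [matDeriv_mul hHb.transpose hIt, matDeriv_transpose, matDeriv_transpose,
      matDeriv_inv hH hu, h.eqH x hx]
    simp only [transpose_add, transpose_neg, transpose_mul, add_mul, mul_neg, mul_assoc,
      transpose_transpose, matDeriv_transpose_of_symm h.symS hx,
      matDeriv_transpose_of_symm h.symS' hx]
    abel
  unfold involutionLogDeriv
  rw [matDeriv_fromBlocks, ← fromBlocks_zero]
  congr 1
  · rw [matDeriv_add ((hS.mul c11).sub hSb) ((hHb.transpose.mul hIt).mul hS),
      matDeriv_sub (hS.mul c11) hSb, matDeriv_mul hS c11, d11,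
      matDeriv_mul (hHb.transpose.mul hIt) hS, dHR, h.eqS x hx]
    simp only [mul_sub, mul_zero, mul_assoc]
    abel
  · rw [matDeriv_sub (hS.mul c12) (hHb.transpose.mul hIt), matDeriv_mul hS c12, d12, dHR, mul_zero,
      add_zero, sub_self]

theorem involutionMatrix_eq (h : IsMinimalRank H S S' r) {x : E × E}
    (hx : x ∈ Metric.ball (0 : E × E) r) :
    involutionMatrix H S S' x = involutionMatrix H S S' (x.1, 0) * (involutionMatrix H S S' 0)⁻¹
      * involutionMatrix H S S' (0, x.2) := by
  have han : ∀ y ∈ Metric.ball (0 : E × E) r, MatAnalyticAt (involutionMatrix H S S') y := by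
    intro y hy
    have hI := ((h.anH y hy).inv (h.unit y hy)).transpose
    exact (hI.mul (h.anS y hy)).neg.fromBlocks hI
      ((h.anH y hy).sub ((h.anS' y hy).mul (hI.mul (h.anS y hy)))) ((h.anS' y hy).mul hI)
  refine eq_mul_of_logDeriv (B := involutionLogDeriv H S S') han (fun y hy => ?_)
    (fun b y hy => ?_) (fun b y hy => h.matDeriv_involutionMatrix b hy)
    (fun a b y hy => h.matDeriv_involutionLogDeriv a b hy) x hx
  · exact Matrix.isUnit_det_of_right_inverse (involutionMatrix_mul_inv (h.unit y hy))
  · have hS := h.anS y hy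
    have hI := (h.anH y hy).inv (h.unit y hy)
    have hHb := (h.anH y hy).matDeriv (0, b)
    have c12 := (hI.mul ((h.anS' y hy).matDeriv (0, b))).mul hI.transpose
    have c11 := (hI.mul hHb).sub (c12.mul hS)
    have c := hHb.transpose.mul hI.transpose
    exact c11.fromBlocks c12 (((hS.mul c11).sub (hS.matDeriv (0, b))).add (c.mul hS))
      ((hS.mul c12).sub c)

/-- The Hermitian part is determined by its restrictions to `η = 0` and `ζ = 0`. -/
theorem inv_transpose_eq (h : IsMinimalRank H S S' r) (h0 : S 0 = 0) (h0' : S' 0 = 0) {x : E × E}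
    (hx : x ∈ Metric.ball (0 : E × E) r) :
    ((H x)⁻¹)ᵀ = ((H (x.1, 0))⁻¹)ᵀ * ((H 0)ᵀ - S (x.1, 0) * (H 0)⁻¹ * S' (0, x.2))
        * ((H (0, x.2))⁻¹)ᵀ ∧
    S' x * ((H x)⁻¹)ᵀ = S' (x.1, 0) * ((H x)⁻¹)ᵀ
      + H (x.1, 0) * (H 0)⁻¹ * S' (0, x.2) * ((H (0, x.2))⁻¹)ᵀ := by
  have h00 := h.unit 0 (Metric.mem_ball_self ((norm_nonneg _).trans_lt (mem_ball_zero_iff.1 hx)))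
  have key := h.involutionMatrix_eq hx
  rw [Matrix.inv_eq_right_inv (involutionMatrix_mul_inv h00)] at key
  unfold involutionMatrix involutionInv at key
  rw [h0, h0', fromBlocks_multiply, fromBlocks_multiply, fromBlocks_inj] at key
  -- Since S and S' vanish at 0, the middle factor J(0)⁻¹ has only off-diagonal blocks. The right
  -- column of the product already determines H and S'.
  obtain ⟨-, k1, -, k2⟩ := key
  have k1' : ((H x)⁻¹)ᵀ = ((H (x.1, 0))⁻¹)ᵀ * ((H 0)ᵀ - S (x.1, 0) * (H 0)⁻¹ * S' (0, x.2))
        * ((H (0, x.2))⁻¹)ᵀ := by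
    rw [k1]
    simp only [mul_zero, zero_mul, neg_zero, sub_zero, zero_add, add_zero, neg_mul, mul_assoc,
      mul_sub, sub_mul]
    abel
  refine ⟨k1', ?_⟩
  rw [k2, k1']
  simp only [mul_zero, zero_mul, neg_zero, sub_zero, zero_add, add_zero, mul_assoc,
      mul_sub, sub_mul]
  abel

end IsMinimalRank

end Factorization

/-! ### Polarization of Wirtinger derivatives -/

section PolarizedWirtinger

variable {E : Type*} [NormedAddCommGroup E] [NormedSpace ℂ E] [StarAddMonoid E]
  [NormedStarGroup E] [StarModule ℂ E]

theorem hasFDerivAt_diagonal {F : E × E → ℂ} {f : E → ℂ} {p : E}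
    (hF : DifferentiableAt ℂ F (p, star p)) (h : ∀ᶠ q in 𝓝 p, f q = F (q, star q)) :
    HasFDerivAt f (((fderiv ℂ F (p, star p)).restrictScalars ℝ).comp
      ((ContinuousLinearMap.id ℝ E).prod ((starL' ℝ : E ≃L[ℝ] E) : E →L[ℝ] E))) p := by
  have h1 : HasFDerivAt (fun q : E => (q, star q))
      ((ContinuousLinearMap.id ℝ E).prod ((starL' ℝ : E ≃L[ℝ] E) : E →L[ℝ] E)) p :=
    (hasFDerivAt_id p).prodMk (starL' ℝ : E ≃L[ℝ] E).hasFDerivAt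
  have h2 := (hF.hasFDerivAt.restrictScalars ℝ).comp (f := fun q : E => (q, star q)) p h1
  exact h2.congr_of_eventuallyEq h

theorem dHol_eq_fderiv_fst {F : E × E → ℂ} {f : E → ℂ} {p : E}
    (hF : DifferentiableAt ℂ F (p, star p)) (h : ∀ᶠ q in 𝓝 p, f q = F (q, star q)) (v : E) :
    dHol f p v = fderiv ℂ F (p, star p) (v, 0) := by
  have h1 : ∀ u, fderiv ℝ f p u = fderiv ℂ F (p, star p) (u, star u) := fun u => by
    rw [(hasFDerivAt_diagonal hF h).fderiv]; rfl
  -- The set η = conj ζ is totally real: (v, 0) is a complex combination of the tangent vectors (v,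
  -- conj v) and (iv, conj(iv)).
  have e : ((v, 0) : E × E) = (1 / 2 : ℂ) • ((v, star v) - I • (I • v, star (I • v))) := by
    have hI : star I = -I := by simp
    refine Prod.ext ?_ ?_
    · simp only [Prod.smul_fst, Prod.fst_sub, smul_smul, smul_sub, mul_assoc, I_mul_I]; module
    · simp only [Prod.smul_snd, Prod.snd_sub, smul_smul, smul_sub, star_smul, hI, mul_neg, I_mul_I,
        mul_assoc]
      module
  change (1 / 2 : ℂ) • (fderiv ℝ f p v - I • fderiv ℝ f p (I • v)) = _
  rw [h1, h1, e, map_smul, map_sub, map_smul]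

theorem dAnti_eq_fderiv_snd {F : E × E → ℂ} {f : E → ℂ} {p : E}
    (hF : DifferentiableAt ℂ F (p, star p)) (h : ∀ᶠ q in 𝓝 p, f q = F (q, star q)) (v : E) :
    dAnti f p v = fderiv ℂ F (p, star p) (0, star v) := by
  have h1 : ∀ u, fderiv ℝ f p u = fderiv ℂ F (p, star p) (u, star u) := fun u => by
    rw [(hasFDerivAt_diagonal hF h).fderiv]; rfl
  have e : ((0, star v) : E × E) = (1 / 2 : ℂ) • ((v, star v) + I • (I • v, star (I • v))) := by
    have hI : star I = -I := by simp
    refine Prod.ext ?_ ?_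
    · simp only [Prod.smul_fst, Prod.fst_add, smul_smul, smul_add, mul_assoc, I_mul_I]; module
    · simp only [Prod.smul_snd, Prod.snd_add, smul_smul, smul_add, star_smul, hI, mul_neg, I_mul_I,
        mul_assoc]
      module
  change (1 / 2 : ℂ) • (fderiv ℝ f p v + I • fderiv ℝ f p (I • v)) = _
  rw [h1, h1, e, map_smul, map_add, map_smul]

theorem leviForm_eq_fderiv [CompleteSpace E] {F : E × E → ℂ} {ρ : E → ℝ} {p : E}
    (hF : AnalyticAt ℂ F (p, star p)) (h : ∀ᶠ q in 𝓝 p, (ρ q : ℂ) = F (q, star q)) (w v : E) :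
    leviForm ρ p w v = fderiv ℂ (fun x => fderiv ℂ F x (0, star w)) (p, star p) (v, 0) := by
  have hc : ContinuousAt (fun q : E => (q, star q)) p := by fun_prop
  have h1 : ∀ᶠ q in 𝓝 p, AnalyticAt ℂ F (q, star q) :=
    hc.eventually hF.eventually_analyticAt
  refine dHol_eq_fderiv_fst (F := fun x => fderiv ℂ F x (0, star w)) ?_ ?_ v
  · exact (((ContinuousLinearMap.apply ℂ ℂ ((0, star w) : E × E)).analyticAt _).comp
      hF.fderiv).differentiableAt
  · filter_upwards [h1, h.eventually_nhds] with q hq hq'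
    exact dAnti_eq_fderiv_snd hq.differentiableAt hq' w

end PolarizedWirtinger

/-! ### Derivatives of quadratic expressions -/

section Quadratic

variable {X : Type*} [NormedAddCommGroup X] [NormedSpace ℂ X] {p q : Type*} [Fintype p] [Fintype q]
  {u : X → p → ℂ} {v : X → q → ℂ} {M : X → Matrix p q ℂ} {x : X}

theorem analyticAt_dot (hu : AnalyticAt ℂ u x) (hv : AnalyticAt ℂ v x) (hM : MatAnalyticAt M x) :
    AnalyticAt ℂ (fun y => u y ⬝ᵥ M y *ᵥ v y) x := by
  simp only [dotProduct, mulVec]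
  refine Finset.analyticAt_fun_sum _ fun i _ => AnalyticAt.fun_mul ?_ ?_
  · exact ((ContinuousLinearMap.proj (R := ℂ) (φ := fun _ : p => ℂ) i).analyticAt _).comp hu
  · refine Finset.analyticAt_fun_sum _ fun j _ => AnalyticAt.fun_mul (hM i j) ?_
    exact ((ContinuousLinearMap.proj (R := ℂ) (φ := fun _ : q => ℂ) j).analyticAt _).comp hv

theorem fderiv_dot {u' : X →L[ℂ] p → ℂ} {v' : X →L[ℂ] q → ℂ} (hu : HasFDerivAt u u' x)
    (hv : HasFDerivAt v v' x) (hM : MatAnalyticAt M x) (d : X) :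
    fderiv ℂ (fun y => u y ⬝ᵥ M y *ᵥ v y) x d
      = u' d ⬝ᵥ M x *ᵥ v x + u x ⬝ᵥ matDeriv M x d *ᵥ v x + u x ⬝ᵥ M x *ᵥ v' d := by
  have hu' := hasFDerivAt_pi'.1 hu
  have hv' := hasFDerivAt_pi'.1 hv
  have h1 := fun i j => (hu' i).fun_mul ((hM.differentiableAt i j).hasFDerivAt.fun_mul (hv' j))
  have h2 := HasFDerivAt.fun_sum (u := Finset.univ) fun i _ =>
    HasFDerivAt.fun_sum (u := Finset.univ) fun j _ => h1 i j
  have e : (fun y => u y ⬝ᵥ M y *ᵥ v y) = fun y => ∑ i, ∑ j, u y i * (M y i j * v y j) := by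
    funext y
    simp only [dotProduct, mulVec, Finset.mul_sum]
  rw [e, h2.fderiv]
  simp only [dotProduct, mulVec, Finset.mul_sum, _root_.sum_apply, ← Finset.sum_add_distrib]
  refine Finset.sum_congr rfl fun i _ => Finset.sum_congr rfl fun j _ => ?_
  simp [matDeriv_apply]
  ring

theorem matDeriv_linear {Y : Type*} [NormedAddCommGroup Y] [NormedSpace ℂ Y] {k l : Type*}
    {M : Y → Matrix k l ℂ} (L : X →L[ℂ] Y) (hM : MatAnalyticAt M (L x)) (d : X) :
    matDeriv (fun y => M (L y)) x d = matDeriv M (L x) (L d) := by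
  rw [matDeriv_comp (f := L) hM L.differentiableAt, L.fderiv]

end Quadratic

/-! ### The polarized defining function -/

section Polarized

variable {s m : ℕ}

abbrev zL (s m : ℕ) : Amb s m × Amb s m →L[ℂ] (Fin s → ℂ) :=
  (ContinuousLinearMap.fst ℂ (Fin s → ℂ) (Fin m → ℂ)).comp
    ((ContinuousLinearMap.snd ℂ ℂ ((Fin s → ℂ) × (Fin m → ℂ))).comp
      (ContinuousLinearMap.fst ℂ (Amb s m) (Amb s m)))

abbrev chiL (s m : ℕ) : Amb s m × Amb s m →L[ℂ] (Fin s → ℂ) :=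
  (ContinuousLinearMap.fst ℂ (Fin s → ℂ) (Fin m → ℂ)).comp
    ((ContinuousLinearMap.snd ℂ ℂ ((Fin s → ℂ) × (Fin m → ℂ))).comp
      (ContinuousLinearMap.snd ℂ (Amb s m) (Amb s m)))

/-- The pair `(ζ, η)` of a pair of points. -/
abbrev zetaPair (s m : ℕ) : Amb s m × Amb s m →L[ℂ] (Fin m → ℂ) × (Fin m → ℂ) :=
  ((ContinuousLinearMap.snd ℂ (Fin s → ℂ) (Fin m → ℂ)).comp
    ((ContinuousLinearMap.snd ℂ ℂ ((Fin s → ℂ) × (Fin m → ℂ))).comp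
      (ContinuousLinearMap.fst ℂ (Amb s m) (Amb s m)))).prod
  ((ContinuousLinearMap.snd ℂ (Fin s → ℂ) (Fin m → ℂ)).comp
    ((ContinuousLinearMap.snd ℂ ℂ ((Fin s → ℂ) × (Fin m → ℂ))).comp
      (ContinuousLinearMap.snd ℂ (Amb s m) (Amb s m))))

theorem zetaPair_apply (x : Amb s m × Amb s m) : zetaPair s m x = (x.1.2.2, x.2.2.2) := rfl

/-- `zᵀ H χ + ½ χᵀ S χ + ½ zᵀ S' z` -/
def polQuad (H S S' : (Fin m → ℂ) × (Fin m → ℂ) → Matrix (Fin s) (Fin s) ℂ)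
    (x : Amb s m × Amb s m) : ℂ :=
  x.1.2.1 ⬝ᵥ H (zetaPair s m x) *ᵥ x.2.2.1
    + (1 / 2) * (x.2.2.1 ⬝ᵥ S (zetaPair s m x) *ᵥ x.2.2.1)
    + (1 / 2) * (x.1.2.1 ⬝ᵥ S' (zetaPair s m x) *ᵥ x.1.2.1)

/-- `½ (w + τ) - (zᵀ H χ + ½ χᵀ S χ + ½ zᵀ S' z)` -/
def polFun (H S S' : (Fin m → ℂ) × (Fin m → ℂ) → Matrix (Fin s) (Fin s) ℂ)
    (x : Amb s m × Amb s m) : ℂ :=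
  (1 / 2) * (x.1.1 + x.2.1) - polQuad H S S' x

theorem dotProduct_conjM_star (A : Matrix (Fin s) (Fin s) ℂ) (z : Fin s → ℂ) :
    z ⬝ᵥ conjM A *ᵥ z = star (star z ⬝ᵥ A *ᵥ star z) := by
  simp only [dotProduct, mulVec, conjM, star_sum, star_mul', Matrix.map_apply, Pi.star_apply,
    star_star]

theorem IsHermitian_dotProduct {A : Matrix (Fin s) (Fin s) ℂ} (hA : A.IsHermitian)
    (z : Fin s → ℂ) : ((z ⬝ᵥ A *ᵥ star z).re : ℂ) = z ⬝ᵥ A *ᵥ star z := by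
  refine Complex.conj_eq_iff_re.1 ?_
  have h : ∀ i j, star (A i j) = A j i := fun i j => hA.apply j i
  change star _ = _
  simp only [dotProduct, mulVec, Finset.mul_sum, star_sum, star_mul', Pi.star_apply, star_star, h]
  rw [Finset.sum_comm]
  refine Finset.sum_congr rfl fun i _ => Finset.sum_congr rfl fun j _ => ?_
  ring

theorem defFun_eq_polFun {H S : (Fin m → ℂ) → Matrix (Fin s) (Fin s) ℂ}
    {Hc Sc Sd : (Fin m → ℂ) × (Fin m → ℂ) → Matrix (Fin s) (Fin s) ℂ} (q : Amb s m)
    (hherm : (H q.2.2).IsHermitian) (hH : Hc (q.2.2, star q.2.2) = H q.2.2)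
    (hS : Sc (q.2.2, star q.2.2) = S q.2.2) (hS' : Sd (q.2.2, star q.2.2) = conjM (S q.2.2)) :
    (defFun H S q : ℂ) = polFun Hc Sc Sd (q, star q) := by
  unfold defFun polFun polQuad
  rw [zetaPair_apply]
  simp only [Prod.fst_star, Prod.snd_star]
  rw [hH, hS, hS', dotProduct_conjM_star, ofReal_sub, ofReal_add, IsHermitian_dotProduct hherm]
  have h1 : ∀ c : ℂ, (c.re : ℂ) = 1 / 2 * c + 1 / 2 * star c := fun c => by
    rw [show (star c : ℂ) = (starRingEnd ℂ) c from rfl, ← mul_add, Complex.add_conj]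
    push_cast; ring
  rw [h1 q.1, h1 (star q.2.1 ⬝ᵥ S q.2.2 *ᵥ star q.2.1)]
  ring

variable {H S S' : (Fin m → ℂ) × (Fin m → ℂ) → Matrix (Fin s) (Fin s) ℂ} {x : Amb s m × Amb s m}

theorem analyticAt_polQuad (hH : MatAnalyticAt H (zetaPair s m x))
    (hS : MatAnalyticAt S (zetaPair s m x)) (hS' : MatAnalyticAt S' (zetaPair s m x)) :
    AnalyticAt ℂ (polQuad H S S') x := by
  have hz := (zL s m).analyticAt x
  have hc := (chiL s m).analyticAt x
  have hp := (zetaPair s m).analyticAt x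
  exact ((analyticAt_dot hz hc (hH.comp hp)).fun_add
    (analyticAt_const.fun_mul (analyticAt_dot hc hc (hS.comp hp)))).fun_add
    (analyticAt_const.fun_mul (analyticAt_dot hz hz (hS'.comp hp)))

theorem analyticAt_polFun (hH : MatAnalyticAt H (zetaPair s m x))
    (hS : MatAnalyticAt S (zetaPair s m x)) (hS' : MatAnalyticAt S' (zetaPair s m x)) :
    AnalyticAt ℂ (polFun H S S') x := by
  have h1 : AnalyticAt ℂ (fun y : Amb s m × Amb s m => y.1.1 + y.2.1) x :=
    ((ContinuousLinearMap.fst ℂ ℂ ((Fin s → ℂ) × (Fin m → ℂ))).comp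
      (ContinuousLinearMap.fst ℂ (Amb s m) (Amb s m))
        + (ContinuousLinearMap.fst ℂ ℂ ((Fin s → ℂ) × (Fin m → ℂ))).comp
      (ContinuousLinearMap.snd ℂ (Amb s m) (Amb s m))).analyticAt x
  exact (analyticAt_const.fun_mul h1).fun_sub (analyticAt_polQuad hH hS hS')

theorem fderiv_polFun (hH : MatAnalyticAt H (zetaPair s m x))
    (hS : MatAnalyticAt S (zetaPair s m x)) (hS' : MatAnalyticAt S' (zetaPair s m x))
    (d : Amb s m × Amb s m) :
    fderiv ℂ (polFun H S S') x d = (1 / 2) * (d.1.1 + d.2.1)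
      - (d.1.2.1 ⬝ᵥ H (zetaPair s m x) *ᵥ x.2.2.1
        + x.1.2.1 ⬝ᵥ matDeriv H (zetaPair s m x) (zetaPair s m d) *ᵥ x.2.2.1
        + x.1.2.1 ⬝ᵥ H (zetaPair s m x) *ᵥ d.2.2.1
        + (1 / 2) * (d.2.2.1 ⬝ᵥ S (zetaPair s m x) *ᵥ x.2.2.1
          + x.2.2.1 ⬝ᵥ matDeriv S (zetaPair s m x) (zetaPair s m d) *ᵥ x.2.2.1
          + x.2.2.1 ⬝ᵥ S (zetaPair s m x) *ᵥ d.2.2.1)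
        + (1 / 2) * (d.1.2.1 ⬝ᵥ S' (zetaPair s m x) *ᵥ x.1.2.1
          + x.1.2.1 ⬝ᵥ matDeriv S' (zetaPair s m x) (zetaPair s m d) *ᵥ x.1.2.1
          + x.1.2.1 ⬝ᵥ S' (zetaPair s m x) *ᵥ d.1.2.1)) := by
  have hz := (zL s m).analyticAt x
  have hc := (chiL s m).analyticAt x
  have hp := (zetaPair s m).analyticAt x
  have hz' : HasFDerivAt (fun y : Amb s m × Amb s m => y.1.2.1) (zL s m) x := (zL s m).hasFDerivAt
  have hc' : HasFDerivAt (fun y : Amb s m × Amb s m => y.2.2.1) (chiL s m) x :=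
    (chiL s m).hasFDerivAt
  have a1 := analyticAt_dot hz hc (hH.comp hp)
  have a2 := analyticAt_dot hc hc (hS.comp hp)
  have a3 := analyticAt_dot hz hz (hS'.comp hp)
  have e1 := fderiv_dot hz' hc' (hH.comp hp) d
  have e2 := fderiv_dot hc' hc' (hS.comp hp) d
  have e3 := fderiv_dot hz' hz' (hS'.comp hp) d
  rw [matDeriv_linear (zetaPair s m) hH] at e1
  rw [matDeriv_linear (zetaPair s m) hS] at e2
  rw [matDeriv_linear (zetaPair s m) hS'] at e3
  have hw : HasFDerivAt (fun y : Amb s m × Amb s m => (1 / 2 : ℂ) * (y.1.1 + y.2.1))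
      ((1 / 2 : ℂ) • ((ContinuousLinearMap.fst ℂ _ _).comp (ContinuousLinearMap.fst ℂ _ _)
        + (ContinuousLinearMap.fst ℂ _ _).comp (ContinuousLinearMap.snd ℂ _ _))) x :=
    ((1 / 2 : ℂ) • ((ContinuousLinearMap.fst ℂ ℂ ((Fin s → ℂ) × (Fin m → ℂ))).comp
      (ContinuousLinearMap.fst ℂ (Amb s m) (Amb s m))
        + (ContinuousLinearMap.fst ℂ ℂ ((Fin s → ℂ) × (Fin m → ℂ))).comp
      (ContinuousLinearMap.snd ℂ (Amb s m) (Amb s m)))).hasFDerivAt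
  have hall := hw.fun_sub ((a1.differentiableAt.hasFDerivAt.fun_add
    (a2.differentiableAt.hasFDerivAt.const_mul (1 / 2))).fun_add
    (a3.differentiableAt.hasFDerivAt.const_mul (1 / 2)))
  have : HasFDerivAt (polFun H S S') _ x := hall
  rw [this.fderiv]
  simp only [_root_.sub_apply, _root_.add_apply, _root_.smul_apply, smul_eq_mul]
  erw [e1, e2, e3]
  rfl

/-- The mixed second derivative of the polarized defining function. -/
theorem fderiv_fderiv_polFun (hH : MatAnalyticAt H (zetaPair s m x))
    (hS : MatAnalyticAt S (zetaPair s m x)) (hS' : MatAnalyticAt S' (zetaPair s m x))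
    (a b : Amb s m) :
    fderiv ℂ (fun y => fderiv ℂ (polFun H S S') y (0, b)) x (a, 0)
      = -(a.2.1 ⬝ᵥ matDeriv H (zetaPair s m x) (0, b.2.2) *ᵥ x.2.2.1
        + x.1.2.1 ⬝ᵥ matDeriv (fun y => matDeriv H y (0, b.2.2)) (zetaPair s m x) (a.2.2, 0)
            *ᵥ x.2.2.1
        + a.2.1 ⬝ᵥ H (zetaPair s m x) *ᵥ b.2.1
        + x.1.2.1 ⬝ᵥ matDeriv H (zetaPair s m x) (a.2.2, 0) *ᵥ b.2.1
        + (1 / 2) * (b.2.1 ⬝ᵥ matDeriv S (zetaPair s m x) (a.2.2, 0) *ᵥ x.2.2.1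
          + x.2.2.1 ⬝ᵥ matDeriv (fun y => matDeriv S y (0, b.2.2)) (zetaPair s m x) (a.2.2, 0)
            *ᵥ x.2.2.1
          + x.2.2.1 ⬝ᵥ matDeriv S (zetaPair s m x) (a.2.2, 0) *ᵥ b.2.1)
        + (1 / 2) * (a.2.1 ⬝ᵥ matDeriv S' (zetaPair s m x) (0, b.2.2) *ᵥ x.1.2.1
          + x.1.2.1 ⬝ᵥ matDeriv (fun y => matDeriv S' y (0, b.2.2)) (zetaPair s m x) (a.2.2, 0)
            *ᵥ x.1.2.1
          + x.1.2.1 ⬝ᵥ matDeriv S' (zetaPair s m x) (0, b.2.2) *ᵥ a.2.1)) := by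
  have hp := (zetaPair s m).analyticAt x
  have ev : ∀ {M : (Fin m → ℂ) × (Fin m → ℂ) → Matrix (Fin s) (Fin s) ℂ},
      MatAnalyticAt M (zetaPair s m x) → ∀ᶠ y in 𝓝 x, MatAnalyticAt M (zetaPair s m y) := by
    intro M hM
    refine (zetaPair s m).continuous.continuousAt.eventually ?_
    simp only [MatAnalyticAt, eventually_all]
    exact fun i j => (hM i j).eventually_analyticAt
  have hev : (fun y => fderiv ℂ (polFun H S S') y (0, b)) =ᶠ[𝓝 x] fun y => (1 / 2) * b.1
      - (y.1.2.1 ⬝ᵥ matDeriv H (zetaPair s m y) (0, b.2.2) *ᵥ y.2.2.1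
        + y.1.2.1 ⬝ᵥ H (zetaPair s m y) *ᵥ b.2.1
        + (1 / 2) * (b.2.1 ⬝ᵥ S (zetaPair s m y) *ᵥ y.2.2.1
          + y.2.2.1 ⬝ᵥ matDeriv S (zetaPair s m y) (0, b.2.2) *ᵥ y.2.2.1
          + y.2.2.1 ⬝ᵥ S (zetaPair s m y) *ᵥ b.2.1)
        + (1 / 2) * (y.1.2.1 ⬝ᵥ matDeriv S' (zetaPair s m y) (0, b.2.2) *ᵥ y.1.2.1)) := by
    filter_upwards [ev hH, ev hS, ev hS'] with y h1 h2 h3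
    rw [fderiv_polFun h1 h2 h3]
    simp
  rw [hev.fderiv_eq]
  have hz := (zL s m).analyticAt x
  have hc := (chiL s m).analyticAt x
  have hz' : HasFDerivAt (fun y : Amb s m × Amb s m => y.1.2.1) (zL s m) x := (zL s m).hasFDerivAt
  have hc' : HasFDerivAt (fun y : Amb s m × Amb s m => y.2.2.1) (chiL s m) x :=
    (chiL s m).hasFDerivAt
  have hb : AnalyticAt ℂ (fun _ : Amb s m × Amb s m => b.2.1) x := analyticAt_const
  have hb' : HasFDerivAt (fun _ : Amb s m × Amb s m => b.2.1)
    (0 : Amb s m × Amb s m →L[ℂ] (Fin s → ℂ)) x := hasFDerivAt_const _ _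
  have hHb := hH.matDeriv (0, b.2.2)
  have hSb := hS.matDeriv (0, b.2.2)
  have hSb' := hS'.matDeriv (0, b.2.2)
  have a1 := analyticAt_dot hz hc (hHb.comp hp)
  have a2 := analyticAt_dot hz hb (hH.comp hp)
  have a3 := analyticAt_dot hb hc (hS.comp hp)
  have a4 := analyticAt_dot hc hc (hSb.comp hp)
  have a5 := analyticAt_dot hc hb (hS.comp hp)
  have a6 := analyticAt_dot hz hz (hSb'.comp hp)
  have e1 := fderiv_dot hz' hc' (hHb.comp hp) (a, 0)
  have e2 := fderiv_dot hz' hb' (hH.comp hp) (a, 0)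
  have e3 := fderiv_dot hb' hc' (hS.comp hp) (a, 0)
  have e4 := fderiv_dot hc' hc' (hSb.comp hp) (a, 0)
  have e5 := fderiv_dot hc' hb' (hS.comp hp) (a, 0)
  have e6 := fderiv_dot hz' hz' (hSb'.comp hp) (a, 0)
  rw [matDeriv_linear (zetaPair s m) hHb] at e1
  rw [matDeriv_linear (zetaPair s m) hH] at e2
  rw [matDeriv_linear (zetaPair s m) hS] at e3 e5
  rw [matDeriv_linear (zetaPair s m) hSb] at e4
  rw [matDeriv_linear (zetaPair s m) hSb'] at e6
  have hall := (hasFDerivAt_const ((1 / 2) * b.1) x).fun_sub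
    (((a1.differentiableAt.hasFDerivAt.fun_add a2.differentiableAt.hasFDerivAt).fun_add
      (((a3.differentiableAt.hasFDerivAt.fun_add a4.differentiableAt.hasFDerivAt).fun_add
        a5.differentiableAt.hasFDerivAt).const_mul (1 / 2))).fun_add
      (a6.differentiableAt.hasFDerivAt.const_mul (1 / 2)))
  erw [hall.fderiv]
  simp only [_root_.sub_apply, _root_.add_apply, _root_.smul_apply, smul_eq_mul, _root_.zero_apply]
  erw [e1, e2, e3, e4, e5, e6]
  simp only [zetaPair_apply, ContinuousLinearMap.comp_apply, ContinuousLinearMap.coe_fst',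
    ContinuousLinearMap.coe_snd', Prod.fst_zero, Prod.snd_zero, _root_.zero_apply, mulVec_zero,
    dotProduct_zero, zero_dotProduct, add_zero, zero_add, zero_sub]
  ring

end Polarized

/-! ### Polarizations -/

section Polarization

variable {s m : ℕ}

/-- Complex polarization: the values on e_i + e_j and e_i + i e_j give the sum and the difference of
X i j and X j i. -/
theorem eq_zero_of_dotProduct_star {n : Type*} [Fintype n] {X : Matrix n n ℂ}
    (h : ∀ z : n → ℂ, z ⬝ᵥ X *ᵥ star z = 0) : X = 0 := by
  classical
  ext i j
  have h1 := h (Pi.single i 1)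
  have h2 := h (Pi.single j 1)
  have h3 := h (Pi.single i 1 + Pi.single j 1)
  have h4 := h (Pi.single i 1 + I • Pi.single j 1)
  have e : ∀ k : n, star (Pi.single k (1 : ℂ) : n → ℂ) = Pi.single k 1 := fun k => by
    rw [← Pi.single_star, star_one]
  have hI : star I = -I := by simp
  simp only [star_add, star_smul, e, hI, mulVec_add, mulVec_smul, dotProduct_add, add_dotProduct,
    smul_dotProduct, dotProduct_smul, smul_eq_mul, single_one_dotProduct, mulVec_single_one,
    Matrix.col_apply] at h1 h2 h3 h4
  rw [Matrix.zero_apply]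
  linear_combination (1 / 2 : ℂ) * h3 + (I / 2) * h4 - ((1 : ℂ) / 2 + I / 2) * h1
    - ((1 : ℂ) / 2 + I / 2) * h2 + (X i j / 2 - X j i / 2 + I / 2 * X j j) * I_mul_I

theorem add_transpose_eq_zero_of_dotProduct {n : Type*} [Fintype n] {X : Matrix n n ℂ}
    (h : ∀ z : n → ℂ, z ⬝ᵥ X *ᵥ z = 0) : X + Xᵀ = 0 := by
  classical
  ext i j
  have h1 := h (Pi.single i 1)
  have h2 := h (Pi.single j 1)
  have h3 := h (Pi.single i 1 + Pi.single j 1)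
  simp only [mulVec_add, dotProduct_add, add_dotProduct, single_one_dotProduct, mulVec_single_one,
    Matrix.col_apply] at h1 h2 h3
  rw [Matrix.zero_apply, Matrix.add_apply, Matrix.transpose_apply]
  linear_combination h3 - h1 - h2

/-- The coefficients of a real quadratic form in `z`, `conj z` are determined by its values. -/
theorem quadratic_coeff_eq_zero {n : Type*} [Fintype n] {X Y V : Matrix n n ℂ}
    (h : ∀ᶠ z : n → ℂ in 𝓝 0, z ⬝ᵥ X *ᵥ star z + star z ⬝ᵥ Y *ᵥ star z + z ⬝ᵥ V *ᵥ z = 0) :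
    X = 0 ∧ Y + Yᵀ = 0 ∧ V + Vᵀ = 0 := by
  have hsc : ∀ (c : ℂ) (z : n → ℂ), (c • z) ⬝ᵥ X *ᵥ star (c • z)
      + star (c • z) ⬝ᵥ Y *ᵥ star (c • z) + (c • z) ⬝ᵥ V *ᵥ (c • z)
      = c * star c * (z ⬝ᵥ X *ᵥ star z) + star c * star c * (star z ⬝ᵥ Y *ᵥ star z)
        + c * c * (z ⬝ᵥ V *ᵥ z) := by
    intro c z
    simp only [star_smul, mulVec_smul, dotProduct_smul, smul_dotProduct, smul_eq_mul]
    ring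
  -- By homogeneity of degree two under real scaling, vanishing near 0 is vanishing everywhere.
  have hall : ∀ z : n → ℂ, z ⬝ᵥ X *ᵥ star z + star z ⬝ᵥ Y *ᵥ star z + z ⬝ᵥ V *ᵥ z = 0 := by
    intro z
    have ht : Tendsto (fun t : ℝ => (t : ℂ) • z) (𝓝[>] 0) (𝓝 0) := by
      have : Continuous fun t : ℝ => (t : ℂ) • z := by fun_prop
      exact (this.tendsto' 0 0 (by simp)).mono_left nhdsWithin_le_nhds
    obtain ⟨t, ht1, ht2⟩ := ((ht.eventually h).and self_mem_nhdsWithin).exists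
    have ht0 : (t : ℂ) ≠ 0 := by exact_mod_cast (ne_of_gt ht2)
    rw [hsc] at ht1
    have hst : star (t : ℂ) = t := Complex.conj_ofReal t
    rw [hst, ← mul_add, ← mul_add] at ht1
    exact (mul_eq_zero.1 ht1).resolve_left (mul_ne_zero ht0 ht0)
  have hI : star I = -I := by simp
  -- Replacing z by iz keeps the mixed term and changes the sign of the two pure terms.
  have h1 : ∀ z : n → ℂ, z ⬝ᵥ X *ᵥ star z = 0 := fun z => by
    have a := hall z
    have b := hall (I • z)
    rw [hsc, hI] at b
    linear_combination (1 / 2 : ℂ) * a + (1 / 2 : ℂ) * b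
      + (1 / 2 : ℂ) * (z ⬝ᵥ X *ᵥ star z - star z ⬝ᵥ Y *ᵥ star z - z ⬝ᵥ V *ᵥ z) * I_mul_I
  -- Replacing z by (1 + i)z multiplies the pure terms by 2i and -2i, which separates them.
  have h2 : ∀ z : n → ℂ, z ⬝ᵥ V *ᵥ z = 0 ∧ star z ⬝ᵥ Y *ᵥ star z = 0 := fun z => by
    have a := hall z
    have b := hall ((1 + I) • z)
    have e : star (1 + I) = 1 - I := by rw [star_add, hI, star_one]; ring
    rw [hsc, e, h1] at b
    rw [h1] at a
    have c : I * (z ⬝ᵥ V *ᵥ z - star z ⬝ᵥ Y *ᵥ star z) = 0 := by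
      linear_combination (1 / 2 : ℂ) * b
        - (1 / 2 : ℂ) * (z ⬝ᵥ V *ᵥ z + star z ⬝ᵥ Y *ᵥ star z) * I_mul_I
    have c' := (mul_eq_zero.1 c).resolve_left I_ne_zero
    constructor
    · linear_combination (1 / 2 : ℂ) * a + (1 / 2 : ℂ) * c'
    · linear_combination (1 / 2 : ℂ) * a - (1 / 2 : ℂ) * c'
  refine ⟨eq_zero_of_dotProduct_star h1, add_transpose_eq_zero_of_dotProduct fun z => ?_,
    add_transpose_eq_zero_of_dotProduct fun z => (h2 z).1⟩
  simpa using (h2 (star z)).2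

/-- `Hc`, `Sc`, `Sd` are holomorphic functions of `(ζ, η)` whose restrictions to `η = conj ζ` are
`H`, `S` and `conj S`. -/
structure IsPolarization (H S : (Fin m → ℂ) → Matrix (Fin s) (Fin s) ℂ)
    (Hc Sc Sd : (Fin m → ℂ) × (Fin m → ℂ) → Matrix (Fin s) (Fin s) ℂ) (r : ℝ) : Prop where
  pos : 0 < r
  anH : ∀ x ∈ Metric.ball (0 : (Fin m → ℂ) × (Fin m → ℂ)) r, MatAnalyticAt Hc x
  anS : ∀ x ∈ Metric.ball (0 : (Fin m → ℂ) × (Fin m → ℂ)) r, MatAnalyticAt Sc x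
  anS' : ∀ x ∈ Metric.ball (0 : (Fin m → ℂ) × (Fin m → ℂ)) r, MatAnalyticAt Sd x
  unit : ∀ x ∈ Metric.ball (0 : (Fin m → ℂ) × (Fin m → ℂ)) r, IsUnit (Hc x).det
  eqH : ∀ᶠ ζ in 𝓝 0, Hc (ζ, star ζ) = H ζ
  eqS : ∀ᶠ ζ in 𝓝 0, Sc (ζ, star ζ) = S ζ
  eqS' : ∀ᶠ ζ in 𝓝 0, Sd (ζ, star ζ) = conjM (S ζ)
  herm : ∀ᶠ ζ in 𝓝 0, (H ζ).IsHermitian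
  symm : ∀ᶠ ζ in 𝓝 0, (S ζ).IsSymm

theorem eq_of_diagonal {r : ℝ} (hr : 0 < r)
    {A B : (Fin m → ℂ) × (Fin m → ℂ) → Matrix (Fin s) (Fin s) ℂ}
    (hA : ∀ x ∈ Metric.ball (0 : (Fin m → ℂ) × (Fin m → ℂ)) r, MatAnalyticAt A x)
    (hB : ∀ x ∈ Metric.ball (0 : (Fin m → ℂ) × (Fin m → ℂ)) r, MatAnalyticAt B x)
    (h : ∀ᶠ ζ in 𝓝 0, A (ζ, star ζ) = B (ζ, star ζ)) :
    ∀ x ∈ Metric.ball (0 : (Fin m → ℂ) × (Fin m → ℂ)) r, A x = B x := by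
  intro x hx
  ext i j
  refine sub_eq_zero.1 (eq_zero_of_diagonal (G := fun x => A x i j - B x i j) hr
    (fun y hy => (hA y hy i j).sub (hB y hy i j)) ?_ x hx)
  filter_upwards [h] with ζ hζ
  rw [hζ, sub_self]

/-- The reflection (ζ, η) ↦ (conj η, conj ζ) fixes the set η = conj ζ. Conjugating a holomorphic
function of the reflected point is again holomorphic, so relations between H, S and their conjugates
extend off that set. -/
theorem MatAnalyticAt.conjM_swap {A : (Fin m → ℂ) × (Fin m → ℂ) → Matrix (Fin s) (Fin s) ℂ}
    {x : (Fin m → ℂ) × (Fin m → ℂ)} (hA : MatAnalyticAt A (star x.2, star x.1)) :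
    MatAnalyticAt (fun y => conjM (A (star y.2, star y.1))) x := by
  intro i j
  let P := (ContinuousLinearMap.snd ℂ (Fin m → ℂ) (Fin m → ℂ)).prod
    (ContinuousLinearMap.fst ℂ (Fin m → ℂ) (Fin m → ℂ))
  refine AnalyticAt.star_comp_star (f := fun y => A (P y) i j) ?_
  exact (MatAnalyticAt.comp (M := A) (f := P) hA (P.analyticAt _)) i j

theorem star_swap_mem_ball {x : (Fin m → ℂ) × (Fin m → ℂ)} {r : ℝ} (hx : x ∈ Metric.ball 0 r) :
    (star x.2, star x.1) ∈ Metric.ball (0 : (Fin m → ℂ) × (Fin m → ℂ)) r := by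
  rw [mem_ball_zero_iff, Prod.norm_def] at hx ⊢
  simpa [max_comm] using hx

namespace IsPolarization

variable {H S : (Fin m → ℂ) → Matrix (Fin s) (Fin s) ℂ}
    {Hc Sc Sd : (Fin m → ℂ) × (Fin m → ℂ) → Matrix (Fin s) (Fin s) ℂ} {r : ℝ}

theorem symSc (h : IsPolarization H S Hc Sc Sd r) :
    ∀ x ∈ Metric.ball (0 : (Fin m → ℂ) × (Fin m → ℂ)) r, (Sc x)ᵀ = Sc x := by
  refine eq_of_diagonal h.pos (fun x hx => (h.anS x hx).transpose) h.anS ?_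
  filter_upwards [h.eqS, h.symm] with ζ h1 h2
  rw [h1, h2.eq]

theorem symSd (h : IsPolarization H S Hc Sc Sd r) :
    ∀ x ∈ Metric.ball (0 : (Fin m → ℂ) × (Fin m → ℂ)) r, (Sd x)ᵀ = Sd x := by
  refine eq_of_diagonal h.pos (fun x hx => (h.anS' x hx).transpose) h.anS' ?_
  filter_upwards [h.eqS', h.symm] with ζ h1 h2
  rw [h1, conjM, ← Matrix.transpose_map, h2.eq]

theorem Sd_eq (h : IsPolarization H S Hc Sc Sd r) :
    ∀ x ∈ Metric.ball (0 : (Fin m → ℂ) × (Fin m → ℂ)) r,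
      Sd x = conjM (Sc (star x.2, star x.1)) := by
  refine eq_of_diagonal h.pos h.anS'
    (fun x hx => (h.anS _ (star_swap_mem_ball hx)).conjM_swap) ?_
  filter_upwards [h.eqS, h.eqS'] with ζ h1 h2
  simp only [star_star]
  rw [h1, h2]

theorem Hc_eq (h : IsPolarization H S Hc Sc Sd r) :
    ∀ x ∈ Metric.ball (0 : (Fin m → ℂ) × (Fin m → ℂ)) r,
      Hc x = (conjM (Hc (star x.2, star x.1)))ᵀ := by
  refine eq_of_diagonal h.pos h.anH
    (fun x hx => (h.anH _ (star_swap_mem_ball hx)).conjM_swap.transpose) ?_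
  filter_upwards [h.eqH, h.herm] with ζ h1 h2
  simp only [star_star]
  rw [h1]
  exact h2.eq.symm

end IsPolarization

/-- Real analytic matrices `H` (Hermitian, invertible at `0`) and `S` (symmetric) have a
polarization. -/
theorem exists_isPolarization {H S : (Fin m → ℂ) → Matrix (Fin s) (Fin s) ℂ}
    (hH_an : ∀ j k, AnalyticAt ℝ (fun ζ => H ζ j k) 0)
    (hS_an : ∀ j k, AnalyticAt ℝ (fun ζ => S ζ j k) 0)
    (hH_herm : ∀ᶠ ζ in 𝓝 0, (H ζ).IsHermitian)
    (hS_symm : ∀ᶠ ζ in 𝓝 0, (S ζ).IsSymm)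
    (hH_nondeg : IsUnit (H 0).det) :
    ∃ Hc Sc Sd r, IsPolarization H S Hc Sc Sd r := by
  have hSc_an : ∀ j k, AnalyticAt ℝ (fun ζ => conjM (S ζ) j k) 0 := fun j k =>
    AnalyticAt.comp (f := fun ζ => S ζ j k)
      (Complex.conjCLE.toContinuousLinearMap.analyticAt (S 0 j k)) (hS_an j k)
  choose Hc hHc1 hHc2 using fun j k => exists_complexification (hH_an j k)
  choose Sc hSc1 hSc2 using fun j k => exists_complexification (hS_an j k)
  choose Sd hSd1 hSd2 using fun j k => exists_complexification (hSc_an j k)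
  have hHc : MatAnalyticAt (fun x => Matrix.of fun j k => Hc j k x) 0 := hHc1
  have hSc : MatAnalyticAt (fun x => Matrix.of fun j k => Sc j k x) 0 := hSc1
  have hSd : MatAnalyticAt (fun x => Matrix.of fun j k => Sd j k x) 0 := hSd1
  have ev : ∀ {M : (Fin m → ℂ) × (Fin m → ℂ) → Matrix (Fin s) (Fin s) ℂ},
      MatAnalyticAt M 0 → ∀ᶠ y in 𝓝 0, MatAnalyticAt M y := by
    intro M hM
    simp only [MatAnalyticAt, eventually_all]
    exact fun i j => (hM i j).eventually_analyticAt
  have eqH : ∀ᶠ ζ in 𝓝 0, (Matrix.of fun j k => Hc j k (ζ, star ζ)) = H ζ := by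
    filter_upwards [eventually_all.2 fun j => eventually_all.2 fun k => hHc2 j k] with ζ h
    ext j k; exact h j k
  have hu0 : IsUnit (Matrix.of fun j k => Hc j k 0).det := by
    have := eqH.self_of_nhds
    rw [star_zero, Prod.mk_zero_zero] at this
    rwa [this]
  obtain ⟨r, hr, hball⟩ := Metric.eventually_nhds_iff_ball.1
    ((ev hHc).and ((ev hSc).and ((ev hSd).and (hHc.eventually_isUnit_det hu0))))
  refine ⟨_, _, _, r, hr, fun x hx => (hball x hx).1, fun x hx => (hball x hx).2.1,
    fun x hx => (hball x hx).2.2.1, fun x hx => (hball x hx).2.2.2, eqH, ?_, ?_, hH_herm, hS_symm⟩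
  · filter_upwards [eventually_all.2 fun j => eventually_all.2 fun k => hSc2 j k] with ζ h
    ext j k; exact h j k
  · filter_upwards [eventually_all.2 fun j => eventually_all.2 fun k => hSd2 j k] with ζ h
    ext j k; exact h j k

end Polarization

/-! ### The Levi kernel of a hypersurface of the model form -/

section Levi

variable {s m : ℕ}

theorem dotProduct_mulVec_comm_of_symm {n : Type*} [Fintype n] {A : Matrix n n ℂ} (hA : Aᵀ = A)
    (u v : n → ℂ) : u ⬝ᵥ A *ᵥ v = v ⬝ᵥ A *ᵥ u := by
  rw [Matrix.dotProduct_mulVec, ← Matrix.mulVec_transpose, hA, dotProduct_comm]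

theorem dotProduct_transpose_mulVec {n : Type*} [Fintype n] (A : Matrix n n ℂ)
    (u v : n → ℂ) : u ⬝ᵥ A *ᵥ v = v ⬝ᵥ Aᵀ *ᵥ u := by
  rw [Matrix.dotProduct_mulVec, ← Matrix.mulVec_transpose, dotProduct_comm]

theorem mem_leviKernel {E : Type*} [NormedAddCommGroup E] [NormedSpace ℂ E] {ρ : E → ℝ} {p v : E} :
    v ∈ leviKernel ρ p ↔ v ∈ crSpace ρ p ∧ ∀ w ∈ crSpace ρ p, leviForm ρ p w v = 0 := by
  simp [leviKernel, Submodule.mem_iInf]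

theorem defFun_eq_re_add (H S : (Fin m → ℂ) → Matrix (Fin s) (Fin s) ℂ) (w : ℂ)
    (q : (Fin s → ℂ) × (Fin m → ℂ)) :
    defFun H S (w, q) = w.re + defFun H S (0, q) := by
  simp only [defFun, zero_re]
  ring

theorem polQuad_smul {H S S' : (Fin m → ℂ) × (Fin m → ℂ) → Matrix (Fin s) (Fin s) ℂ}
    (w τ t : ℂ) (z χ : Fin s → ℂ) (ζ η : Fin m → ℂ) :
    polQuad H S S' ((w, t • z, ζ), (τ, t • χ, η))
      = t * (t * polQuad H S S' ((w, z, ζ), (τ, χ, η))) := by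
  simp only [polQuad, zetaPair_apply, mulVec_smul, dotProduct_smul, smul_dotProduct, smul_eq_mul]
  ring

theorem matDeriv_zero_zero {X p q : Type*} [NormedAddCommGroup X] [NormedSpace ℂ X]
    (M : X × X → Matrix p q ℂ) (x : X × X) : matDeriv M x (0, 0) = 0 := by
  ext i j
  rw [matDeriv_apply, Prod.mk_zero_zero, map_zero]
  rfl

namespace IsPolarization

variable {H S : (Fin m → ℂ) → Matrix (Fin s) (Fin s) ℂ}
    {Hc Sc Sd : (Fin m → ℂ) × (Fin m → ℂ) → Matrix (Fin s) (Fin s) ℂ} {r : ℝ}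

theorem eventually_diag_mem (h : IsPolarization H S Hc Sc Sd r) :
    ∀ᶠ ζ : Fin m → ℂ in 𝓝 0, (ζ, star ζ) ∈ Metric.ball (0 : (Fin m → ℂ) × (Fin m → ℂ)) r := by
  filter_upwards [Metric.ball_mem_nhds (0 : Fin m → ℂ) h.pos] with ζ hζ
  rw [mem_ball_zero_iff] at hζ ⊢
  simpa [Prod.norm_def] using hζ

theorem eventually_defFun_eq (h : IsPolarization H S Hc Sc Sd r) :
    ∀ᶠ ζ in 𝓝 0, ∀ w z, (defFun H S (w, z, ζ) : ℂ)
      = polFun Hc Sc Sd ((w, z, ζ), star (w, z, ζ)) := by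
  filter_upwards [h.eqH, h.eqS, h.eqS', h.herm] with ζ h1 h2 h3 h4 w z
  exact defFun_eq_polFun (w, z, ζ) h4 h1 h2 h3

/-- The points `ζ` near which the polarization is valid. -/
def IsGood (_ : IsPolarization H S Hc Sc Sd r) (ζ : Fin m → ℂ) : Prop :=
  (ζ, star ζ) ∈ Metric.ball (0 : (Fin m → ℂ) × (Fin m → ℂ)) r ∧
  ∀ᶠ ζ' in 𝓝 ζ, ∀ w z, (defFun H S (w, z, ζ') : ℂ)
    = polFun Hc Sc Sd ((w, z, ζ'), star (w, z, ζ'))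

theorem eventually_isGood (h : IsPolarization H S Hc Sc Sd r) : ∀ᶠ ζ in 𝓝 0, h.IsGood ζ :=
  h.eventually_diag_mem.and h.eventually_defFun_eq.eventually_nhds

theorem IsGood.eventually {h : IsPolarization H S Hc Sc Sd r} {p : Amb s m} (hp : h.IsGood p.2.2) :
    ∀ᶠ q in 𝓝 p, (defFun H S q : ℂ) = polFun Hc Sc Sd (q, star q) := by
  have hc : ContinuousAt (fun q : Amb s m => q.2.2) p := by fun_prop
  filter_upwards [hc.eventually hp.2] with q hq
  exact hq q.1 q.2.1

theorem IsGood.zetaPair_mem {h : IsPolarization H S Hc Sc Sd r} {p : Amb s m}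
    (hp : h.IsGood p.2.2) : zetaPair s m (p, star p) ∈ Metric.ball 0 r := hp.1

theorem IsGood.analyticAt {h : IsPolarization H S Hc Sc Sd r} {p : Amb s m}
    (hp : h.IsGood p.2.2) : AnalyticAt ℂ (polFun Hc Sc Sd) (p, star p) :=
  analyticAt_polFun (h.anH _ hp.zetaPair_mem) (h.anS _ hp.zetaPair_mem)
    (h.anS' _ hp.zetaPair_mem)

theorem IsGood.mem_crSpace {h : IsPolarization H S Hc Sc Sd r} {p : Amb s m}
    (hp : h.IsGood p.2.2) (v : Amb s m) : v ∈ crSpace (defFun H S) p ↔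
      v.1 = 2 * (v.2.1 ⬝ᵥ Hc (p.2.2, star p.2.2) *ᵥ star p.2.1
        + p.2.1 ⬝ᵥ matDeriv Hc (p.2.2, star p.2.2) (v.2.2, 0) *ᵥ star p.2.1)
        + star p.2.1 ⬝ᵥ matDeriv Sc (p.2.2, star p.2.2) (v.2.2, 0) *ᵥ star p.2.1
        + (v.2.1 ⬝ᵥ Sd (p.2.2, star p.2.2) *ᵥ p.2.1
          + p.2.1 ⬝ᵥ matDeriv Sd (p.2.2, star p.2.2) (v.2.2, 0) *ᵥ p.2.1
          + p.2.1 ⬝ᵥ Sd (p.2.2, star p.2.2) *ᵥ v.2.1) := by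
  rw [crSpace, LinearMap.mem_ker, dHol_eq_fderiv_fst hp.analyticAt.differentiableAt hp.eventually,
    fderiv_polFun (h.anH _ hp.zetaPair_mem) (h.anS _ hp.zetaPair_mem)
      (h.anS' _ hp.zetaPair_mem)]
  simp only [zetaPair_apply, Prod.fst_star, Prod.snd_star, Prod.fst_zero, Prod.snd_zero,
    mulVec_zero, dotProduct_zero, zero_dotProduct, add_zero, zero_add]
  constructor
  · intro h; linear_combination 2 * h
  · intro h; linear_combination (1 / 2 : ℂ) * h

theorem IsGood.leviForm_eq {h : IsPolarization H S Hc Sc Sd r} {p : Amb s m}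
    (hp : h.IsGood p.2.2) (w v : Amb s m) :
    leviForm (defFun H S) p w v =
      -(v.2.1 ⬝ᵥ matDeriv Hc (p.2.2, star p.2.2) (0, star w.2.2) *ᵥ star p.2.1
        + p.2.1 ⬝ᵥ matDeriv (fun y => matDeriv Hc y (0, star w.2.2)) (p.2.2, star p.2.2) (v.2.2, 0)
            *ᵥ star p.2.1
        + (1 / 2) * (star p.2.1 ⬝ᵥ matDeriv (fun y => matDeriv Sc y (0, star w.2.2))
            (p.2.2, star p.2.2) (v.2.2, 0) *ᵥ star p.2.1)
        + v.2.1 ⬝ᵥ matDeriv Sd (p.2.2, star p.2.2) (0, star w.2.2) *ᵥ p.2.1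
        + (1 / 2) * (p.2.1 ⬝ᵥ matDeriv (fun y => matDeriv Sd y (0, star w.2.2))
            (p.2.2, star p.2.2) (v.2.2, 0) *ᵥ p.2.1)
        + (v.2.1 ⬝ᵥ Hc (p.2.2, star p.2.2) *ᵥ star w.2.1
          + p.2.1 ⬝ᵥ matDeriv Hc (p.2.2, star p.2.2) (v.2.2, 0) *ᵥ star w.2.1
          + star p.2.1 ⬝ᵥ matDeriv Sc (p.2.2, star p.2.2) (v.2.2, 0) *ᵥ star w.2.1)) := by
  rw [leviForm_eq_fderiv hp.analyticAt hp.eventually,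
    fderiv_fderiv_polFun (h.anH _ hp.zetaPair_mem) (h.anS _ hp.zetaPair_mem)
      (h.anS' _ hp.zetaPair_mem)]
  simp only [zetaPair_apply, Prod.fst_star, Prod.snd_star]
  rw [dotProduct_mulVec_comm_of_symm (matDeriv_transpose_of_symm h.symSc hp.1 _)
      (star w.2.1) (star p.2.1),
    dotProduct_mulVec_comm_of_symm (matDeriv_transpose_of_symm h.symSd hp.1 _) p.2.1 v.2.1]
  ring

theorem IsGood.exists_mem_crSpace {h : IsPolarization H S Hc Sc Sd r} {p : Amb s m}
    (hp : h.IsGood p.2.2) (u : (Fin s → ℂ) × (Fin m → ℂ)) :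
    ∃ w, (w, u) ∈ crSpace (defFun H S) p :=
  ⟨2 * (u.1 ⬝ᵥ Hc (p.2.2, star p.2.2) *ᵥ star p.2.1
        + p.2.1 ⬝ᵥ matDeriv Hc (p.2.2, star p.2.2) (u.2, 0) *ᵥ star p.2.1)
        + star p.2.1 ⬝ᵥ matDeriv Sc (p.2.2, star p.2.2) (u.2, 0) *ᵥ star p.2.1
        + (u.1 ⬝ᵥ Sd (p.2.2, star p.2.2) *ᵥ p.2.1
          + p.2.1 ⬝ᵥ matDeriv Sd (p.2.2, star p.2.2) (u.2, 0) *ᵥ p.2.1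
          + p.2.1 ⬝ᵥ Sd (p.2.2, star p.2.2) *ᵥ u.1), (hp.mem_crSpace (_, u)).2 rfl⟩

/-- The equations of the Levi kernel. -/
theorem IsGood.leviKernel_eqs {h : IsPolarization H S Hc Sc Sd r} {p : Amb s m}
    (hp : h.IsGood p.2.2) {v : Amb s m} (hv : v ∈ leviKernel (defFun H S) p) :
    (∀ u, v.2.1 ⬝ᵥ Hc (p.2.2, star p.2.2) *ᵥ u
          + p.2.1 ⬝ᵥ matDeriv Hc (p.2.2, star p.2.2) (v.2.2, 0) *ᵥ u
          + star p.2.1 ⬝ᵥ matDeriv Sc (p.2.2, star p.2.2) (v.2.2, 0) *ᵥ u = 0) ∧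
    ∀ b, v.2.1 ⬝ᵥ matDeriv Hc (p.2.2, star p.2.2) (0, b) *ᵥ star p.2.1
        + p.2.1 ⬝ᵥ matDeriv (fun y => matDeriv Hc y (0, b)) (p.2.2, star p.2.2) (v.2.2, 0)
            *ᵥ star p.2.1
        + (1 / 2) * (star p.2.1 ⬝ᵥ matDeriv (fun y => matDeriv Sc y (0, b))
            (p.2.2, star p.2.2) (v.2.2, 0) *ᵥ star p.2.1)
        + v.2.1 ⬝ᵥ matDeriv Sd (p.2.2, star p.2.2) (0, b) *ᵥ p.2.1
        + (1 / 2) * (p.2.1 ⬝ᵥ matDeriv (fun y => matDeriv Sd y (0, b))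
            (p.2.2, star p.2.2) (v.2.2, 0) *ᵥ p.2.1) = 0 := by
  have hv' := (mem_leviKernel.1 hv).2
  constructor
  · intro u
    obtain ⟨w, hw⟩ := hp.exists_mem_crSpace (star u, 0)
    have e := hv' _ hw
    rw [hp.leviForm_eq] at e
    simp only [star_zero, star_star, matDeriv_zero_zero, matDeriv_const, zero_mulVec, dotProduct_zero, mul_zero, add_zero,
      zero_add, neg_eq_zero] at e
    exact e
  · intro b
    obtain ⟨w, hw⟩ := hp.exists_mem_crSpace (0, star b)
    have e := hv' _ hw
    rw [hp.leviForm_eq] at e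
    simpa only [star_zero, star_star, mulVec_zero, dotProduct_zero, add_zero, neg_eq_zero] using e

/-- Since H is invertible, the first kernel equation can be solved for the z-part: a vector of the
Levi kernel has its z-part determined by its ζ-part. -/
theorem IsGood.leviKernel_dot {h : IsPolarization H S Hc Sc Sd r} {p : Amb s m}
    (hp : h.IsGood p.2.2) {v : Amb s m} (hv : v ∈ leviKernel (defFun H S) p) (x : Fin s → ℂ) :
    v.2.1 ⬝ᵥ x = -(p.2.1 ⬝ᵥ (matDeriv Hc (p.2.2, star p.2.2) (v.2.2, 0)
        * (Hc (p.2.2, star p.2.2))⁻¹) *ᵥ x)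
      - star p.2.1 ⬝ᵥ (matDeriv Sc (p.2.2, star p.2.2) (v.2.2, 0)
        * (Hc (p.2.2, star p.2.2))⁻¹) *ᵥ x := by
  have e := (hp.leviKernel_eqs hv).1 ((Hc (p.2.2, star p.2.2))⁻¹ *ᵥ x)
  rw [mulVec_mulVec, Matrix.mul_nonsing_inv _ (h.unit _ hp.1), one_mulVec, mulVec_mulVec,
    mulVec_mulVec] at e
  linear_combination e

theorem finrank_amb : Module.finrank ℂ (Amb s m) = 1 + (s + m) := by
  simp [Amb, Module.finrank_prod]

theorem IsGood.finrank_crSpace {h : IsPolarization H S Hc Sc Sd r} {p : Amb s m}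
    (hp : h.IsGood p.2.2) : Module.finrank ℂ (crSpace (defFun H S) p) = s + m := by
  have h1 := LinearMap.finrank_range_add_finrank_ker
    (dHol (fun q => ((defFun H S q : ℝ) : ℂ)) p)
  have h2 : LinearMap.range (dHol (fun q => ((defFun H S q : ℝ) : ℂ)) p) = ⊤ := by
    refine LinearMap.range_eq_top.2 fun c => ?_
    have hne : dHol (fun q => ((defFun H S q : ℝ) : ℂ)) p (1, 0, 0) ≠ 0 := by
      intro h0
      have := (hp.mem_crSpace (1, 0, 0)).1 h0
      simp [matDeriv_zero_zero] at this
    refine ⟨(c / dHol (fun q => ((defFun H S q : ℝ) : ℂ)) p (1, 0, 0)) • (1, 0, 0), ?_⟩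
    rw [map_smul, smul_eq_mul, div_mul_cancel₀ _ hne]
  rw [h2, finrank_top, finrank_amb, Module.finrank_self] at h1
  exact Nat.add_left_cancel h1

/-- If the Levi form has rank `s`, every `ζ`-direction lifts to the Levi kernel. -/
theorem IsGood.exists_mem_leviKernel {h : IsPolarization H S Hc Sc Sd r} {p : Amb s m}
    (hp : h.IsGood p.2.2) (hrank : Module.finrank ℂ (crSpace (defFun H S) p)
      = Module.finrank ℂ (leviKernel (defFun H S) p) + s) (a : Fin m → ℂ) :
    ∃ v ∈ leviKernel (defFun H S) p, v.2.2 = a := by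
  let π : leviKernel (defFun H S) p →ₗ[ℂ] (Fin m → ℂ) :=
    (LinearMap.snd ℂ (Fin s → ℂ) (Fin m → ℂ)).comp
      ((LinearMap.snd ℂ ℂ ((Fin s → ℂ) × (Fin m → ℂ))).comp (Submodule.subtype _))
  -- The ζ-part determines the z-part by the kernel equation and then the w-part by tangency. The
  -- rank condition gives the kernel dimension m, so the injective projection is onto.
  have hinj : Function.Injective π := by
    refine (injective_iff_map_eq_zero π).2 fun v hv => ?_
    have hv0 : (v : Amb s m).2.2 = 0 := hv
    have hvz : (v : Amb s m).2.1 = 0 := by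
      refine dotProduct_eq_zero _ fun x => ?_
      rw [hp.leviKernel_dot v.2, hv0, matDeriv_zero_zero, matDeriv_zero_zero]
      simp
    have hvw := (hp.mem_crSpace v).1 (mem_leviKernel.1 v.2).1
    rw [hv0, hvz, matDeriv_zero_zero, matDeriv_zero_zero, matDeriv_zero_zero] at hvw
    refine Subtype.ext (Prod.ext ?_ (Prod.ext hvz hv0))
    simpa using hvw
  have hfin : Module.finrank ℂ (leviKernel (defFun H S) p) = Module.finrank ℂ (Fin m → ℂ) := by
    rw [hp.finrank_crSpace, add_comm] at hrank
    rw [Module.finrank_fin_fun]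
    exact (Nat.add_right_cancel hrank).symm
  obtain ⟨v, hv⟩ := (LinearMap.injective_iff_surjective_of_finrank_eq_finrank hfin).1 hinj a
  exact ⟨v, v.2, hv⟩

end IsPolarization

end Levi

/-! ### Levi rank s as a system of differential equations -/

section MinimalRank

variable {s m : ℕ}

theorem continuous_defFun_zero (H S : (Fin m → ℂ) → Matrix (Fin s) (Fin s) ℂ) (ζ : Fin m → ℂ) :
    Continuous fun z : Fin s → ℂ => defFun H S (0, z, ζ) := by
  unfold defFun
  simp only [dotProduct, mulVec]
  fun_prop

theorem defFun_zero_zero (H S : (Fin m → ℂ) → Matrix (Fin s) (Fin s) ℂ) (ζ : Fin m → ℂ) :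
    defFun H S (0, 0, ζ) = 0 := by
  simp [defFun]

namespace IsPolarization

variable {H S : (Fin m → ℂ) → Matrix (Fin s) (Fin s) ℂ}
    {Hc Sc Sd : (Fin m → ℂ) × (Fin m → ℂ) → Matrix (Fin s) (Fin s) ℂ} {r : ℝ}

/-- At the point of the hypersurface over (z, ζ) with w real, lift the direction a to the Levi
kernel and insert its z-part in the second family of kernel equations. What remains is a quadratic
form in z and conj z that vanishes for all small z; the three equations are its coefficients, the
pure ones symmetrized. -/
theorem IsGood.minimalRank_eqs {h : IsPolarization H S Hc Sc Sd r} {ζ : Fin m → ℂ}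
    (hg : h.IsGood ζ) (hrank : ∀ᶠ p in 𝓝 ((0, 0, ζ) : Amb s m), defFun H S p = 0 →
      Module.finrank ℂ (crSpace (defFun H S) p)
        = Module.finrank ℂ (leviKernel (defFun H S) p) + s) (a b : Fin m → ℂ) :
    matDeriv (fun y => matDeriv Hc y (0, b)) (ζ, star ζ) (a, 0)
      = matDeriv Hc (ζ, star ζ) (a, 0) * (Hc (ζ, star ζ))⁻¹ * matDeriv Hc (ζ, star ζ) (0, b)
        + matDeriv Sd (ζ, star ζ) (0, b) * ((Hc (ζ, star ζ))⁻¹)ᵀ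
          * matDeriv Sc (ζ, star ζ) (a, 0) ∧
    matDeriv (fun y => matDeriv Sc y (0, b)) (ζ, star ζ) (a, 0)
      = matDeriv Sc (ζ, star ζ) (a, 0) * (Hc (ζ, star ζ))⁻¹ * matDeriv Hc (ζ, star ζ) (0, b)
        + (matDeriv Hc (ζ, star ζ) (0, b))ᵀ * ((Hc (ζ, star ζ))⁻¹)ᵀ
          * matDeriv Sc (ζ, star ζ) (a, 0) ∧
    matDeriv (fun y => matDeriv Sd y (0, b)) (ζ, star ζ) (a, 0)
      = matDeriv Sd (ζ, star ζ) (0, b) * ((Hc (ζ, star ζ))⁻¹)ᵀ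
          * (matDeriv Hc (ζ, star ζ) (a, 0))ᵀ
        + matDeriv Hc (ζ, star ζ) (a, 0) * (Hc (ζ, star ζ))⁻¹
          * matDeriv Sd (ζ, star ζ) (0, b) := by
  have hcont : Continuous fun z : Fin s → ℂ =>
      (((((-defFun H S (0, z, ζ) : ℝ)) : ℂ), z, ζ) : Amb s m) := by
    have := continuous_defFun_zero H S ζ
    fun_prop
  have ht : Tendsto (fun z : Fin s → ℂ =>
      (((((-defFun H S (0, z, ζ) : ℝ)) : ℂ), z, ζ) : Amb s m)) (𝓝 0) (𝓝 (0, 0, ζ)) :=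
    hcont.tendsto' 0 _ (by simp [defFun_zero_zero])
  have key : ∀ᶠ z : Fin s → ℂ in 𝓝 0,
      z ⬝ᵥ (matDeriv (fun y => matDeriv Hc y (0, b)) (ζ, star ζ) (a, 0)
        - matDeriv Hc (ζ, star ζ) (a, 0) * (Hc (ζ, star ζ))⁻¹ * matDeriv Hc (ζ, star ζ) (0, b)
        - (matDeriv Sc (ζ, star ζ) (a, 0) * (Hc (ζ, star ζ))⁻¹
          * matDeriv Sd (ζ, star ζ) (0, b))ᵀ) *ᵥ star z
      + star z ⬝ᵥ ((1 / 2 : ℂ) • matDeriv (fun y => matDeriv Sc y (0, b)) (ζ, star ζ) (a, 0)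
        - matDeriv Sc (ζ, star ζ) (a, 0) * (Hc (ζ, star ζ))⁻¹ * matDeriv Hc (ζ, star ζ) (0, b))
          *ᵥ star z
      + z ⬝ᵥ ((1 / 2 : ℂ) • matDeriv (fun y => matDeriv Sd y (0, b)) (ζ, star ζ) (a, 0)
        - matDeriv Hc (ζ, star ζ) (a, 0) * (Hc (ζ, star ζ))⁻¹ * matDeriv Sd (ζ, star ζ) (0, b))
          *ᵥ z = 0 := by
    filter_upwards [ht.eventually hrank] with z hz
    have hz' := hz (by rw [defFun_eq_re_add, ofReal_re, neg_add_cancel])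
    have hgp : h.IsGood ((((((-defFun H S (0, z, ζ) : ℝ)) : ℂ), z, ζ) : Amb s m)).2.2 := hg
    obtain ⟨v, hv, hva⟩ := hgp.exists_mem_leviKernel hz' a
    have e := (hgp.leviKernel_eqs hv).2 b
    rw [hgp.leviKernel_dot hv, hgp.leviKernel_dot hv, hva] at e
    simp only [mulVec_mulVec] at e
    simp only [sub_mulVec, dotProduct_sub, smul_mulVec, dotProduct_smul, smul_eq_mul]
    rw [← dotProduct_transpose_mulVec _ (star z) z]
    linear_combination e
  obtain ⟨k1, k2, k3⟩ := quadratic_coeff_eq_zero key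
  have hB := hg.1
  have sS := matDeriv_transpose_of_symm h.symSc hB (a, 0)
  have sS' := matDeriv_transpose_of_symm h.symSd hB (0, b)
  have sSS := matDeriv_transpose_of_symm
    (fun x hx => matDeriv_transpose_of_symm h.symSc hx (0, b)) hB (a, 0)
  have sSS' := matDeriv_transpose_of_symm
    (fun x hx => matDeriv_transpose_of_symm h.symSd hx (0, b)) hB (a, 0)
  simp only [transpose_mul, transpose_sub, transpose_smul, sS, sS', sSS, sSS'] at k1 k2 k3
  refine ⟨?_, ?_, ?_⟩
  · rw [sub_sub, sub_eq_zero] at k1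
    rw [k1, mul_assoc (matDeriv Sd (ζ, star ζ) (0, b))]
  · rw [← sub_eq_zero, ← k2]
    simp only [mul_assoc]
    module
  · rw [← sub_eq_zero, ← k3]
    simp only [mul_assoc]
    module

/-- The equations hold for η = conj ζ, and both sides are holomorphic in (ζ, η). -/
theorem isMinimalRank (h : IsPolarization H S Hc Sc Sd r)
    (hrank : ∀ᶠ p in 𝓝 (0 : Amb s m), defFun H S p = 0 →
      Module.finrank ℂ (crSpace (defFun H S) p)
        = Module.finrank ℂ (leviKernel (defFun H S) p) + s) : IsMinimalRank Hc Sc Sd r := by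
  have hc : ContinuousAt (fun ζ : Fin m → ℂ => ((0, 0, ζ) : Amb s m)) 0 := by fun_prop
  have hev : ∀ᶠ ζ in 𝓝 0, h.IsGood ζ ∧ ∀ᶠ p in 𝓝 ((0, 0, ζ) : Amb s m), defFun H S p = 0 →
      Module.finrank ℂ (crSpace (defFun H S) p)
        = Module.finrank ℂ (leviKernel (defFun H S) p) + s :=
    h.eventually_isGood.and (hc.eventually hrank.eventually_nhds)
  have hI : ∀ x ∈ Metric.ball (0 : (Fin m → ℂ) × (Fin m → ℂ)) r,
      MatAnalyticAt (fun y => (Hc y)⁻¹) x := fun x hx => (h.anH x hx).inv (h.unit x hx)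
  refine ⟨h.anH, h.anS, h.anS', h.symSc, h.symSd, h.unit, fun x hx a b => ?_, fun x hx a b => ?_,
    fun x hx a b => ?_⟩
  · refine eq_of_diagonal h.pos (fun y hy => ((h.anH y hy).matDeriv _).matDeriv _)
      (fun y hy => ((((h.anH y hy).matDeriv _).mul (hI y hy)).mul ((h.anH y hy).matDeriv _)).add
        ((((h.anS' y hy).matDeriv _).mul (hI y hy).transpose).mul ((h.anS y hy).matDeriv _)))
      ?_ x hx
    filter_upwards [hev] with ζ hζ
    exact (hζ.1.minimalRank_eqs hζ.2 a b).1
  · refine eq_of_diagonal h.pos (fun y hy => ((h.anS y hy).matDeriv _).matDeriv _)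
      (fun y hy => ((((h.anS y hy).matDeriv _).mul (hI y hy)).mul ((h.anH y hy).matDeriv _)).add
        ((((h.anH y hy).matDeriv _).transpose.mul (hI y hy).transpose).mul
          ((h.anS y hy).matDeriv _)))
      ?_ x hx
    filter_upwards [hev] with ζ hζ
    exact (hζ.1.minimalRank_eqs hζ.2 a b).2.1
  · refine eq_of_diagonal h.pos (fun y hy => ((h.anS' y hy).matDeriv _).matDeriv _)
      (fun y hy => ((((h.anS' y hy).matDeriv _).mul (hI y hy).transpose).mul
        ((h.anH y hy).matDeriv _).transpose).add
        ((((h.anH y hy).matDeriv _).mul (hI y hy)).mul ((h.anS' y hy).matDeriv _)))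
      ?_ x hx
    filter_upwards [hev] with ζ hζ
    exact (hζ.1.minimalRank_eqs hζ.2 a b).2.2

end IsPolarization

end MinimalRank

/-! ### 2-nondegeneracy and linear independence of the symbol matrices -/

section SecondKernel

variable {s m : ℕ}

/-- Continuity of k at 0 suffices, because the difference quotient at 0 is k itself. Curves and
sections with an explicit factor t are differentiated in this way below. -/
theorem hasDerivAt_smul_of_continuousAt {𝕜 V : Type*} [NontriviallyNormedField 𝕜]
    [NormedAddCommGroup V] [NormedSpace 𝕜 V] {k : 𝕜 → V} (hk : ContinuousAt k 0) :
    HasDerivAt (fun t : 𝕜 => t • k t) (k 0) 0 := by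
  rw [hasDerivAt_iff_tendsto_slope]
  refine (hk.tendsto.mono_left nhdsWithin_le_nhds).congr' ?_
  filter_upwards [self_mem_nhdsWithin] with t ht
  rw [slope_def_module, zero_smul, sub_zero, sub_zero, smul_smul, inv_mul_cancel₀ ht, one_smul]

theorem continuousAt_dot {T : Type*} [TopologicalSpace T] {p q : Type*} [Fintype p] [Fintype q]
    {u : T → p → ℂ} {v : T → q → ℂ} {M : T → Matrix p q ℂ} {t : T} (hu : ContinuousAt u t)
    (hM : ContinuousAt M t) (hv : ContinuousAt v t) :
    ContinuousAt (fun t => u t ⬝ᵥ M t *ᵥ v t) t := by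
  have h : Continuous fun x : (p → ℂ) × Matrix p q ℂ × (q → ℂ) => x.1 ⬝ᵥ x.2.1 *ᵥ x.2.2 := by
    fun_prop
  exact ContinuousAt.comp (f := fun t => (u t, M t, v t)) h.continuousAt (hu.prodMk (hM.prodMk hv))

theorem MatAnalyticAt.continuousAt {X p q : Type*} [NormedAddCommGroup X] [NormedSpace ℂ X]
    {M : X → Matrix p q ℂ} {x : X} (hM : MatAnalyticAt M x) : ContinuousAt M x :=
  continuousAt_pi.2 fun i => continuousAt_pi.2 fun j => (hM i j).continuousAt

theorem MatAnalyticAt.continuousAt_matDeriv {T X p q : Type*} [TopologicalSpace T]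
    [NormedAddCommGroup X] [NormedSpace ℂ X] [CompleteSpace X]
    {M : X → Matrix p q ℂ} {f g : T → X} {t : T} (hM : MatAnalyticAt M (f t))
    (hf : ContinuousAt f t) (hg : ContinuousAt g t) :
    ContinuousAt (fun t => CRModel.matDeriv M (f t) (g t)) t := by
  refine continuousAt_pi.2 fun i => continuousAt_pi.2 fun j => ?_
  have h1 : ContinuousAt (fderiv ℂ fun y => M y i j) (f t) := (hM i j).fderiv.continuousAt
  exact (h1.comp (f := f) hf).clm_apply hg

namespace IsPolarization

variable {H S : (Fin m → ℂ) → Matrix (Fin s) (Fin s) ℂ}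
    {Hc Sc Sd : (Fin m → ℂ) × (Fin m → ℂ) → Matrix (Fin s) (Fin s) ℂ} {r : ℝ}

/-- A curve in the hypersurface. -/
def curve (H S : (Fin m → ℂ) → Matrix (Fin s) (Fin s) ℂ) (u : (Fin s → ℂ) × (Fin m → ℂ)) (t : ℝ) :
    Amb s m :=
  (((-defFun H S (0, (t : ℂ) • u) : ℝ) : ℂ), (t : ℂ) • u)

theorem defFun_curve (u : (Fin s → ℂ) × (Fin m → ℂ)) (t : ℝ) : defFun H S (curve H S u t) = 0 := by
  rw [curve, defFun_eq_re_add, ofReal_re, neg_add_cancel]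

theorem curve_zero (u : (Fin s → ℂ) × (Fin m → ℂ)) : curve H S u 0 = 0 := by
  refine Prod.ext ?_ (by simp [curve])
  have : defFun H S (0, (0 : (Fin s → ℂ) × (Fin m → ℂ))) = 0 := defFun_zero_zero H S 0
  simp [curve, this]

theorem hasDerivAt_curve (h : IsPolarization H S Hc Sc Sd r) (u : (Fin s → ℂ) × (Fin m → ℂ)) :
    HasDerivAt (curve H S u) (0, u) 0 := by
  have h0 : (0 : (Fin m → ℂ) × (Fin m → ℂ)) ∈ Metric.ball 0 r := Metric.mem_ball_self h.pos
  -- By homogeneity in (z, χ) the w-coordinate of the curve is t²κ(t), so it contributes nothing to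
  -- the velocity at 0.
  let κ : ℝ → ℂ := fun t =>
    polQuad Hc Sc Sd ((0, u.1, (t : ℂ) • u.2), (0, star u.1, (t : ℂ) • star u.2))
  have hκ : ContinuousAt κ 0 := by
    have e : zetaPair s m ((0, u.1, ((0 : ℝ) : ℂ) • u.2), (0, star u.1, ((0 : ℝ) : ℂ) • star u.2))
        = 0 := by simp
    have ha : AnalyticAt ℂ (polQuad Hc Sc Sd)
        ((0, u.1, ((0 : ℝ) : ℂ) • u.2), (0, star u.1, ((0 : ℝ) : ℂ) • star u.2)) :=
      analyticAt_polQuad (by rw [e]; exact h.anH 0 h0) (by rw [e]; exact h.anS 0 h0)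
        (by rw [e]; exact h.anS' 0 h0)
    have hc : Continuous fun t : ℝ => (((0, u.1, (t : ℂ) • u.2), (0, star u.1, (t : ℂ) • star u.2)) :
        Amb s m × Amb s m) := by fun_prop
    exact ContinuousAt.comp (g := polQuad Hc Sc Sd) ha.continuousAt hc.continuousAt
  have hlin : HasDerivAt (fun t : ℝ => (t : ℂ) • u) u 0 := by
    have := hasDerivAt_smul_of_continuousAt (𝕜 := ℝ) (k := fun _ : ℝ => u) continuousAt_const
    simpa using this
  have hfst : HasDerivAt (fun t : ℝ => (((-defFun H S (0, (t : ℂ) • u) : ℝ)) : ℂ)) 0 0 := by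
    have h1 : HasDerivAt (fun t : ℝ => t • (t • κ t)) ((0 : ℝ) • κ 0) 0 :=
      hasDerivAt_smul_of_continuousAt (k := fun t => t • κ t) (continuousAt_id.smul hκ)
    rw [zero_smul] at h1
    refine h1.congr_of_eventuallyEq ?_
    have hc : ContinuousAt (fun t : ℝ => (t : ℂ) • u.2) 0 := by fun_prop
    have hc' := hc.eventually (by simpa using h.eventually_defFun_eq)
    filter_upwards [hc'] with t ht
    have e := ht 0 ((t : ℂ) • u.1)
    have e2 : star (((0 : ℂ), (t : ℂ) • u.1, (t : ℂ) • u.2) : Amb s m)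
        = (0, (t : ℂ) • star u.1, (t : ℂ) • star u.2) := by
      have hst : star (t : ℂ) = t := Complex.conj_ofReal t
      refine Prod.ext (star_zero _) (Prod.ext ?_ ?_)
      · change star ((t : ℂ) • u.1) = _
        rw [star_smul, hst]
      · change star ((t : ℂ) • u.2) = _
        rw [star_smul, hst]
    rw [e2] at e
    have e3 : ((0 : ℂ), (t : ℂ) • u) = (((0 : ℂ), (t : ℂ) • u.1, (t : ℂ) • u.2) : Amb s m) := rfl
    rw [e3, ofReal_neg, e, polFun, polQuad_smul]
    simp [κ]
  exact hfst.prodMk hlin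

/-- Along the curve t ↦ tu, tangency and `leviKernel_dot` write the w-part and the z-part of X as t
times a continuous function, whose value at t = 0 is the derivative. The z-part of the derivative
splits into a complex linear term in u, coming from H_ζ, and an antilinear one, coming from S_ζ.
Only the second is seen by ∂̄X. -/
theorem derivative_section (h : IsPolarization H S Hc Sc Sd r) {X : Amb s m → Amb s m}
    {c : Fin m → ℂ} (hX : DifferentiableAt ℝ X 0) (hX0 : X 0 = (0, 0, c))
    (hK : ∀ᶠ q in 𝓝 0, defFun H S q = 0 → X q ∈ leviKernel (defFun H S) q)
    (u : (Fin s → ℂ) × (Fin m → ℂ)) :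
    (fderiv ℝ X 0 (0, u)).1 = 0 ∧ ∀ x, (fderiv ℝ X 0 (0, u)).2.1 ⬝ᵥ x
      = -(u.1 ⬝ᵥ (matDeriv Hc 0 (c, 0) * (Hc 0)⁻¹) *ᵥ x)
        - star u.1 ⬝ᵥ (matDeriv Sc 0 (c, 0) * (Hc 0)⁻¹) *ᵥ x := by
  have h0 : (0 : (Fin m → ℂ) × (Fin m → ℂ)) ∈ Metric.ball 0 r := Metric.mem_ball_self h.pos
  let N : ℝ → Amb s m := fun t => X (curve H S u t)
  have hN0 : N 0 = (0, 0, c) := by simp only [N, curve_zero, hX0]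
  have hN : HasDerivAt N (fderiv ℝ X 0 (0, u)) 0 := by
    have h1 : HasFDerivAt X (fderiv ℝ X 0) (curve H S u 0) := by
      rw [curve_zero]; exact hX.hasFDerivAt
    exact h1.comp_hasDerivAt 0 (h.hasDerivAt_curve u)
  have hNc : ContinuousAt N 0 := hN.continuousAt
  let ξ : ℝ → (Fin m → ℂ) × (Fin m → ℂ) := fun t => ((t : ℂ) • u.2, star ((t : ℂ) • u.2))
  have hξ : ContinuousAt ξ 0 := by
    have : Continuous ξ := by fun_prop
    exact this.continuousAt
  have hξ0 : ξ 0 = 0 := by simp [ξ]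
  have hd : ContinuousAt (fun t => (((N t).2.2, (0 : Fin m → ℂ)))) 0 := by fun_prop
  have hcM : ∀ {M : (Fin m → ℂ) × (Fin m → ℂ) → Matrix (Fin s) (Fin s) ℂ}, MatAnalyticAt M 0 →
      ContinuousAt (fun t => M (ξ t)) 0 := fun {M} hM =>
    ContinuousAt.comp (g := M) (by rw [hξ0]; exact hM.continuousAt) hξ
  have hcD : ∀ {M : (Fin m → ℂ) × (Fin m → ℂ) → Matrix (Fin s) (Fin s) ℂ}, MatAnalyticAt M 0 →
      ContinuousAt (fun t => matDeriv M (ξ t) ((N t).2.2, 0)) 0 := fun {M} hM =>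
    MatAnalyticAt.continuousAt_matDeriv (by rw [hξ0]; exact hM) hξ hd
  have hst : ∀ t : ℝ, star (t : ℂ) = t := Complex.conj_ofReal
  have hcurve : ContinuousAt (curve H S u) 0 := (h.hasDerivAt_curve u).continuousAt
  have hgood : ∀ᶠ t : ℝ in 𝓝 0, h.IsGood (curve H S u t).2.2 ∧
      N t ∈ leviKernel (defFun H S) (curve H S u t) := by
    have h1 : ContinuousAt (fun t => (curve H S u t).2.2) 0 := by fun_prop
    have h2 := h1.eventually (p := h.IsGood)
      (by simp only [curve_zero]; exact h.eventually_isGood)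
    have h3 := hcurve.eventually (p := fun q => defFun H S q = 0 → X q ∈ leviKernel (defFun H S) q)
      (by rw [curve_zero]; exact hK)
    filter_upwards [h2, h3] with t ht ht'
    exact ⟨ht, ht' (defFun_curve u t)⟩
  have hz1 : ContinuousAt (fun t => (N t).2.1) 0 := by fun_prop
  have hu1 : ContinuousAt (fun _ : ℝ => u.1) 0 := continuousAt_const
  have hu2 : ContinuousAt (fun _ : ℝ => star u.1) 0 := continuousAt_const
  have ht : ContinuousAt (fun t : ℝ => (t : ℂ)) 0 := by fun_prop
  constructor
  · let k : ℝ → ℂ := fun t => 2 * ((N t).2.1 ⬝ᵥ Hc (ξ t) *ᵥ star u.1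
        + (t : ℂ) * (u.1 ⬝ᵥ matDeriv Hc (ξ t) ((N t).2.2, 0) *ᵥ star u.1))
        + (t : ℂ) * (star u.1 ⬝ᵥ matDeriv Sc (ξ t) ((N t).2.2, 0) *ᵥ star u.1)
        + ((N t).2.1 ⬝ᵥ Sd (ξ t) *ᵥ u.1
          + (t : ℂ) * (u.1 ⬝ᵥ matDeriv Sd (ξ t) ((N t).2.2, 0) *ᵥ u.1)
          + u.1 ⬝ᵥ Sd (ξ t) *ᵥ (N t).2.1)
    have hk : ContinuousAt k 0 :=
      ((continuousAt_const.mul ((continuousAt_dot hz1 (hcM (h.anH 0 h0)) hu2).add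
        (ht.mul (continuousAt_dot hu1 (hcD (h.anH 0 h0)) hu2)))).add
        (ht.mul (continuousAt_dot hu2 (hcD (h.anS 0 h0)) hu2))).add
        (((continuousAt_dot hz1 (hcM (h.anS' 0 h0)) hu1).add
        (ht.mul (continuousAt_dot hu1 (hcD (h.anS' 0 h0)) hu1))).add
        (continuousAt_dot hu1 (hcM (h.anS' 0 h0)) hz1))
    have hk0 : k 0 = 0 := by simp [k, hN0]
    have h1 : HasDerivAt (fun t => (N t).1) (fderiv ℝ X 0 (0, u)).1 0 :=
      (ContinuousLinearMap.fst ℝ ℂ ((Fin s → ℂ) × (Fin m → ℂ))).hasFDerivAt.comp_hasDerivAt 0 hN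
    have h2 := hasDerivAt_smul_of_continuousAt hk
    rw [hk0] at h2
    refine h1.unique (h2.congr_of_eventuallyEq ?_)
    filter_upwards [hgood] with t hgt
    have e := (hgt.1.mem_crSpace (N t)).1 (mem_leviKernel.1 hgt.2).1
    rw [e]
    simp only [curve, Prod.smul_fst, Prod.smul_snd, star_smul, hst, mulVec_smul, smul_dotProduct,
      dotProduct_smul, smul_eq_mul, k, ξ, Complex.real_smul]
    ring
  · intro x
    let k : ℝ → ℂ := fun t =>
      -(u.1 ⬝ᵥ (matDeriv Hc (ξ t) ((N t).2.2, 0) * (Hc (ξ t))⁻¹) *ᵥ x)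
        - star u.1 ⬝ᵥ (matDeriv Sc (ξ t) ((N t).2.2, 0) * (Hc (ξ t))⁻¹) *ᵥ x
    have hI := hcM ((h.anH 0 h0).inv (h.unit 0 h0))
    have hcm : ∀ {A B : ℝ → Matrix (Fin s) (Fin s) ℂ}, ContinuousAt A 0 → ContinuousAt B 0 →
        ContinuousAt (fun t => A t * B t) 0 := fun hA hB => hA.mul hB
    have hk : ContinuousAt k 0 :=
      (continuousAt_dot hu1 (hcm (hcD (h.anH 0 h0)) hI) continuousAt_const).neg.sub
        (continuousAt_dot hu2 (hcm (hcD (h.anS 0 h0)) hI) continuousAt_const)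
    have h1 : HasDerivAt (fun t => (N t).2.1 ⬝ᵥ x) ((fderiv ℝ X 0 (0, u)).2.1 ⬝ᵥ x) 0 := by
      let ℓ : Amb s m →ₗ[ℝ] ℂ :=
        { toFun := fun q => q.2.1 ⬝ᵥ x
          map_add' := fun a b => by simp [add_dotProduct]
          map_smul' := fun a b => by simp [smul_dotProduct] }
      exact (LinearMap.toContinuousLinearMap ℓ).hasFDerivAt.comp_hasDerivAt 0 hN
    have h2 := hasDerivAt_smul_of_continuousAt hk
    have hk0 : k 0 = -(u.1 ⬝ᵥ (matDeriv Hc 0 (c, 0) * (Hc 0)⁻¹) *ᵥ x)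
        - star u.1 ⬝ᵥ (matDeriv Sc 0 (c, 0) * (Hc 0)⁻¹) *ᵥ x := by
      simp only [k, hξ0, hN0]
    rw [← hk0]
    refine h1.unique (h2.congr_of_eventuallyEq ?_)
    filter_upwards [hgood] with t hgt
    rw [hgt.1.leviKernel_dot hgt.2]
    simp only [curve, Prod.smul_fst, Prod.smul_snd, star_smul, hst, smul_dotProduct,
      smul_eq_mul, k, ξ, Complex.real_smul]
    ring

theorem partialAt_eq (h : IsPolarization H S Hc Sc Sd r) (α : Fin m) :
    partialAt S α = matDeriv Sc 0 (Pi.single α 1, 0) := by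
  have h0 : (0 : (Fin m → ℂ) × (Fin m → ℂ)) ∈ Metric.ball 0 r := Metric.mem_ball_self h.pos
  ext j k
  have e : ((0 : Fin m → ℂ), star (0 : Fin m → ℂ)) = 0 := by simp
  have := dHol_eq_fderiv_fst (F := fun x => Sc x j k) (f := fun ζ => S ζ j k) (p := 0)
    (by rw [e]; exact (h.anS 0 h0 j k).differentiableAt)
    (h.eqS.mono fun ζ hζ => by rw [hζ]) (Pi.single α 1)
  rw [e] at this
  exact this

theorem matDeriv_fst_eq_sum {p q : Type*} (M : (Fin m → ℂ) × (Fin m → ℂ) → Matrix p q ℂ)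
    (x : (Fin m → ℂ) × (Fin m → ℂ)) (c : Fin m → ℂ) :
    matDeriv M x (c, 0) = ∑ α, c α • matDeriv M x (Pi.single α 1, 0) := by
  ext i j
  have e : ((c, 0) : (Fin m → ℂ) × (Fin m → ℂ)) = ∑ α, c α • (Pi.single α 1, 0) := by
    refine Prod.ext ?_ ?_
    · rw [Prod.fst_sum]
      simp only [Prod.smul_mk]
      conv_lhs => rw [← Finset.univ_sum_single c]
      refine Finset.sum_congr rfl fun α _ => ?_
      rw [← Pi.single_smul, smul_eq_mul, mul_one]
    · rw [Prod.snd_sum]; simp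
  rw [matDeriv_apply, e, map_sum, Matrix.sum_apply]
  exact Finset.sum_congr rfl fun α _ => by rw [map_smul]; rfl

/-- `2`-nondegeneracy at `0` makes the matrices `S^{0,2}_α` linearly independent. -/
theorem linearIndependent_symbolMatrix (h : IsPolarization H S Hc Sc Sd r)
    (hH : IsUnit (H 0).det) (h3 : ∀ v ∈ secondLeviKernel (defFun H S) 0, v = 0) :
    LinearIndependent ℂ (symbolMatrix H S) := by
  have h0 : (0 : (Fin m → ℂ) × (Fin m → ℂ)) ∈ Metric.ball 0 r := Metric.mem_ball_self h.pos
  have hHt : IsUnit ((H 0)ᵀ).det := by rwa [Matrix.det_transpose]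
  refine Fintype.linearIndependent_iff.2 fun c hc => ?_
  -- A linear relation c among the symbol matrices says that S_ζ(0) vanishes in the direction c.
  have hS : matDeriv Sc 0 (c, 0) = 0 := by
    rw [matDeriv_fst_eq_sum]
    have e : (H 0)ᵀ * (∑ α, c α • symbolMatrix H S α) * H 0 = ∑ α, c α • partialAt S α := by
      rw [Matrix.mul_sum, Matrix.sum_mul]
      refine Finset.sum_congr rfl fun α _ => ?_
      rw [symbolMatrix, Matrix.mul_smul, Matrix.smul_mul, ← mul_assoc,
        ← mul_assoc, Matrix.mul_nonsing_inv _ hHt, one_mul, mul_assoc,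
        Matrix.nonsing_inv_mul _ hH, mul_one]
    rw [hc, mul_zero, zero_mul] at e
    rw [e]
    exact Finset.sum_congr rfl fun α _ => by rw [h.partialAt_eq]
  have hg : h.IsGood (0 : Amb s m).2.2 := h.eventually_isGood.self_of_nhds
  have hcr : ∀ v : Amb s m, v ∈ crSpace (defFun H S) 0 ↔ v.1 = 0 := fun v => by
    rw [hg.mem_crSpace]
    simp
  have hker : ∀ u : Fin m → ℂ, ((0, 0, u) : Amb s m) ∈ leviKernel (defFun H S) 0 := fun u => by
    refine mem_leviKernel.2 ⟨(hcr _).2 rfl, fun w _ => ?_⟩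
    rw [hg.leviForm_eq]
    simp
  -- With S_ζ(0)c = 0 the z-derivative of every section X through (0, 0, c) is complex linear. So
  -- ∂̄X at 0 has only a ζ-part, and at the origin all ζ-directions lie in the Levi kernel. Hence
  -- (0, 0, c) lies in 𝒦₃ = 0.
  have hv : ((0, 0, c) : Amb s m) ∈ secondLeviKernel (defFun H S) 0 := by
    refine ⟨hker c, fun X hX hXK hX0 y hy => ?_⟩
    have hXd : DifferentiableAt ℝ X 0 := hX.differentiableAt (by simp)
    have hy0 : y.1 = 0 := (hcr y).1 hy
    obtain ⟨a1, a2⟩ := h.derivative_section hXd hX0 hXK y.2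
    obtain ⟨b1, b2⟩ := h.derivative_section hXd hX0 hXK (I • y.2)
    have ey : y = (0, y.2) := Prod.ext hy0 rfl
    have eIy : I • y = (0, I • y.2) := Prod.ext (by simp [hy0]) rfl
    have e : dAnti X 0 y = (0, 0, (dAnti X 0 y).2.2) := by
      refine Prod.ext ?_ (Prod.ext (dotProduct_eq_zero _ fun x => ?_) rfl)
      · simp only [dAnti, Prod.smul_fst, Prod.fst_add]
        rw [eIy, b1, ey, a1]
        simp
      · simp only [dAnti, Prod.smul_snd, Prod.snd_add, Prod.smul_fst, Prod.fst_add]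
        rw [eIy, ey, smul_dotProduct, add_dotProduct, smul_dotProduct, a2, b2, hS]
        simp only [zero_mul, zero_mulVec, dotProduct_zero, sub_zero, Prod.smul_fst,
          smul_dotProduct, smul_eq_mul]
        linear_combination (-(1 / 2 : ℂ) * (y.2.1 ⬝ᵥ (matDeriv Hc 0 (c, 0) * (Hc 0)⁻¹) *ᵥ x))
          * I_mul_I
    rw [e]
    exact hker _
  have := h3 _ hv
  intro α
  exact congrFun (congrArg (fun q : Amb s m => q.2.2) this) α

end IsPolarization

end SecondKernel

/-! ### The models -/

section Model

variable {s m : ℕ}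

/-- The push-through identity, from (1 - AB)A = A(1 - BA). No invertibility is assumed: the
determinants of 1 - AB and 1 - BA agree. -/
theorem inv_one_sub_mul_comm {n : Type*} [Fintype n] [DecidableEq n] (A B : Matrix n n ℂ) :
    (1 - A * B)⁻¹ * A = A * (1 - B * A)⁻¹ := by
  have hdet : (1 - A * B).det = (1 - B * A).det := Matrix.det_one_sub_mul_comm A B
  by_cases h : IsUnit (1 - A * B).det
  · have h' : IsUnit (1 - B * A).det := by rwa [← hdet]
    have e : (1 - A * B) * A = A * (1 - B * A) := by
      rw [sub_mul, mul_sub, one_mul, mul_one, mul_assoc]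
    calc (1 - A * B)⁻¹ * A = (1 - A * B)⁻¹ * (A * (1 - B * A)) * (1 - B * A)⁻¹ := by
          rw [mul_assoc, mul_assoc, Matrix.mul_nonsing_inv _ h', mul_one]
      _ = A * (1 - B * A)⁻¹ := by
          rw [← e, ← mul_assoc, Matrix.nonsing_inv_mul _ h, one_mul]
  -- In the singular case both inverses have the default value 0.
  · have h' : ¬ IsUnit (1 - B * A).det := by rwa [← hdet]
    rw [Matrix.nonsing_inv_apply_not_isUnit _ h, Matrix.nonsing_inv_apply_not_isUnit _ h',
      zero_mul, mul_zero]

theorem conjM_eq (A : Matrix (Fin s) (Fin s) ℂ) : conjM A = (Aᴴ)ᵀ := rfl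

theorem conjM_mul (A B : Matrix (Fin s) (Fin s) ℂ) : conjM (A * B) = conjM A * conjM B := by
  simp only [conjM_eq, conjTranspose_mul, transpose_mul]

theorem conjM_sub (A B : Matrix (Fin s) (Fin s) ℂ) : conjM (A - B) = conjM A - conjM B := by
  simp only [conjM_eq, conjTranspose_sub, transpose_sub]

theorem conjM_one : conjM (1 : Matrix (Fin s) (Fin s) ℂ) = 1 := by
  simp only [conjM_eq, conjTranspose_one, transpose_one]

theorem conjM_zero : conjM (0 : Matrix (Fin s) (Fin s) ℂ) = 0 := by
  simp only [conjM_eq, conjTranspose_zero, transpose_zero]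

theorem conjM_conjM (A : Matrix (Fin s) (Fin s) ℂ) : conjM (conjM A) = A := by
  ext i j; simp [conjM]

theorem conjM_inv (A : Matrix (Fin s) (Fin s) ℂ) : conjM A⁻¹ = (conjM A)⁻¹ := by
  simp only [conjM_eq, conjTranspose_nonsing_inv, transpose_nonsing_inv]

theorem conjM_transpose (A : Matrix (Fin s) (Fin s) ℂ) : conjM Aᵀ = (conjM A)ᵀ := rfl

theorem conjM_smul (c : ℂ) (A : Matrix (Fin s) (Fin s) ℂ) : conjM (c • A) = star c • conjM A := by
  ext i j; simp [conjM]

theorem conjM_of_isHermitian {A : Matrix (Fin s) (Fin s) ℂ} (hA : A.IsHermitian) :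
    conjM A = Aᵀ := by
  rw [conjM_eq, hA.eq]

theorem conjM_mulVec (A : Matrix (Fin s) (Fin s) ℂ) (z : Fin s → ℂ) :
    conjM A *ᵥ star z = star (A *ᵥ z) := by
  ext i
  simp [mulVec, dotProduct, conjM]

variable {H₀ : Matrix (Fin s) (Fin s) ℂ} {T : (Fin m → ℂ) → Matrix (Fin s) (Fin s) ℂ}

/-- The two summands in the definition coincide by the push-through identity; the average only makes
the Hermitian symmetry visible. -/
theorem modelH_eq (H₀ : Matrix (Fin s) (Fin s) ℂ) (T : (Fin m → ℂ) → Matrix (Fin s) (Fin s) ℂ)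
    (ζ : Fin m → ℂ) :
    modelH H₀ T ζ = (1 - H₀ * (conjM (T ζ) * H₀ᵀ * T ζ))⁻¹ * H₀ := by
  rw [modelH, ← inv_one_sub_mul_comm]
  simp only [← mul_assoc]
  rw [← two_smul ℂ, smul_smul]
  norm_num

theorem modelS_eq (H₀ : Matrix (Fin s) (Fin s) ℂ) (T : (Fin m → ℂ) → Matrix (Fin s) (Fin s) ℂ)
    (ζ : Fin m → ℂ) :
    modelS H₀ T ζ = H₀ᵀ * (T ζ * (1 - H₀ * conjM (T ζ) * H₀ᵀ * T ζ)⁻¹) * H₀ := by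
  have h := inv_one_sub_mul_comm (T ζ) (H₀ * conjM (T ζ) * H₀ᵀ)
  simp only [← mul_assoc] at h
  rw [modelS, mul_assoc H₀ᵀ, h]

/-- Polarization of `modelH`. -/
def polModelH (H₀ : Matrix (Fin s) (Fin s) ℂ) (T : (Fin m → ℂ) → Matrix (Fin s) (Fin s) ℂ)
    (x : (Fin m → ℂ) × (Fin m → ℂ)) : Matrix (Fin s) (Fin s) ℂ :=
  (1 - H₀ * (conjM (T (star x.2)) * H₀ᵀ * T x.1))⁻¹ * H₀

/-- Polarization of `modelS`. -/
def polModelS (H₀ : Matrix (Fin s) (Fin s) ℂ) (T : (Fin m → ℂ) → Matrix (Fin s) (Fin s) ℂ)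
    (x : (Fin m → ℂ) × (Fin m → ℂ)) : Matrix (Fin s) (Fin s) ℂ :=
  H₀ᵀ * (1 - T x.1 * (H₀ * conjM (T (star x.2)) * H₀ᵀ))⁻¹ * T x.1 * H₀

/-- Polarization of the conjugate of `modelS`. -/
def polModelSd (H₀ : Matrix (Fin s) (Fin s) ℂ) (T : (Fin m → ℂ) → Matrix (Fin s) (Fin s) ℂ)
    (x : (Fin m → ℂ) × (Fin m → ℂ)) : Matrix (Fin s) (Fin s) ℂ :=
  H₀ * (1 - conjM (T (star x.2)) * (H₀ᵀ * T x.1 * H₀))⁻¹ * conjM (T (star x.2)) * H₀ᵀ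

theorem modelH_isHermitian (hH : H₀.IsHermitian) {ζ : Fin m → ℂ} (hT : (T ζ).IsSymm) :
    (modelH H₀ T ζ).IsHermitian := by
  have h1 : (T ζ)ᴴ = conjM (T ζ) := by
    ext i j
    simp [conjM, hT.apply]
  have h2 : (conjM (T ζ))ᴴ = T ζ := by rw [← h1, conjTranspose_conjTranspose]
  have h3 : (H₀ᵀ)ᴴ = H₀ᵀ := by
    ext i j
    exact hH.apply j i
  rw [Matrix.IsHermitian, modelH_eq, conjTranspose_mul, conjTranspose_nonsing_inv,
    conjTranspose_sub, conjTranspose_one, conjTranspose_mul, conjTranspose_mul, conjTranspose_mul,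
    h1, h2, h3, hH.eq, inv_one_sub_mul_comm]
  simp only [mul_assoc]

theorem modelS_isSymm {ζ : Fin m → ℂ} (hT : (T ζ).IsSymm) :
    (modelS H₀ T ζ).IsSymm := by
  have h2 : (conjM (T ζ))ᵀ = conjM (T ζ) := by rw [← conjM_transpose, hT.eq]
  rw [Matrix.IsSymm, modelS_eq]
  simp only [transpose_mul, transpose_nonsing_inv, transpose_sub, transpose_one,
    transpose_transpose, h2, hT.eq]
  rw [← mul_assoc, ← inv_one_sub_mul_comm]
  simp only [mul_assoc]

/-- For a model the polarization is taken explicit, with conj 𝐒(ζ) replaced by the holomorphic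
function η ↦ conj(𝐒(conj η)), because its restrictions to η = 0 and to ζ = 0 have to be computed. -/
theorem exists_isPolarization_model (hH : H₀.IsHermitian) (hu : IsUnit H₀.det)
    (hT : MatAnalyticAt T 0) (hTs : ∀ᶠ ζ in 𝓝 0, (T ζ).IsSymm) (hT0 : T 0 = 0) :
    ∃ r, IsPolarization (modelH H₀ T) (modelS H₀ T) (polModelH H₀ T) (polModelS H₀ T)
      (polModelSd H₀ T) r := by
  have ev : ∀ {M : (Fin m → ℂ) × (Fin m → ℂ) → Matrix (Fin s) (Fin s) ℂ},
      MatAnalyticAt M 0 → ∀ᶠ y in 𝓝 0, MatAnalyticAt M y := by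
    intro M hM
    simp only [MatAnalyticAt, eventually_all]
    exact fun i j => (hM i j).eventually_analyticAt
  let x₀ : (Fin m → ℂ) × (Fin m → ℂ) := 0
  have h1 : MatAnalyticAt (fun x : (Fin m → ℂ) × (Fin m → ℂ) => T x.1) x₀ :=
    MatAnalyticAt.comp (f := Prod.fst) hT analyticAt_fst
  have h2' : MatAnalyticAt (fun x : (Fin m → ℂ) => conjM (T (star x))) 0 := fun i j =>
    AnalyticAt.star_comp_star (f := fun y => T y i j) (by rw [star_zero]; exact hT i j)
  have h2 : MatAnalyticAt (fun x : (Fin m → ℂ) × (Fin m → ℂ) => conjM (T (star x.2))) x₀ :=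
    MatAnalyticAt.comp (M := fun y => conjM (T (star y))) (f := Prod.snd) h2' analyticAt_snd
  have hc : ∀ A, MatAnalyticAt (fun _ : (Fin m → ℂ) × (Fin m → ℂ) => A) x₀ := fun A =>
    MatAnalyticAt.const (A : Matrix (Fin s) (Fin s) ℂ)
  have hT0' : conjM (T (star x₀.2)) = 0 := by
    simp only [x₀, Prod.snd_zero, star_zero, hT0, conjM_zero]
  have hT0'' : T x₀.1 = 0 := hT0
  have i1 := ((hc 1).sub ((hc H₀).mul ((h2.mul (hc H₀ᵀ)).mul h1))).inv
    (by simp [hT0''])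
  have i2 := ((hc 1).sub (h1.mul (((hc H₀).mul h2).mul (hc H₀ᵀ)))).inv
    (by simp [hT0''])
  have i3 := ((hc 1).sub (h2.mul (((hc H₀ᵀ).mul h1).mul (hc H₀)))).inv
    (by simp [hT0''])
  have a1 : MatAnalyticAt (polModelH H₀ T) 0 := i1.mul (hc H₀)
  have a2 : MatAnalyticAt (polModelS H₀ T) 0 := (((hc H₀ᵀ).mul i2).mul h1).mul (hc H₀)
  have a3 : MatAnalyticAt (polModelSd H₀ T) 0 := (((hc H₀).mul i3).mul h2).mul (hc H₀ᵀ)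
  have hu0 : IsUnit (polModelH H₀ T 0).det := by
    simpa [polModelH, hT0] using hu
  obtain ⟨r, hr, hball⟩ := Metric.eventually_nhds_iff_ball.1
    ((ev a1).and ((ev a2).and ((ev a3).and (a1.eventually_isUnit_det hu0))))
  refine ⟨r, hr, fun x hx => (hball x hx).1, fun x hx => (hball x hx).2.1,
    fun x hx => (hball x hx).2.2.1, fun x hx => (hball x hx).2.2.2,
    Eventually.of_forall fun ζ => ?_, Eventually.of_forall fun ζ => ?_,
    Eventually.of_forall fun ζ => ?_, hTs.mono fun ζ h => modelH_isHermitian hH h,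
    hTs.mono fun ζ h => modelS_isSymm h⟩
  · rw [modelH_eq, polModelH, star_star]
  · rw [modelS, polModelS, star_star]
    simp only [mul_assoc]
  · have e : conjM H₀ᵀ = H₀ := by
      rw [conjM_transpose, conjM_of_isHermitian hH, transpose_transpose]
    rw [modelS, polModelSd, star_star]
    simp only [conjM_mul, conjM_inv, conjM_sub, conjM_one, conjM_conjM, e,
      conjM_of_isHermitian hH, mul_assoc]

/-- As 𝐒(0) = 0, setting η = 0 or ζ = 0 removes the inverse factors. Constancy of H on both axes and
vanishing of S' for η = 0 distinguish the models among all hypersurfaces of this form. -/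
theorem polModelH_fst (hT0 : T 0 = 0) (ζ : Fin m → ℂ) : polModelH H₀ T (ζ, 0) = H₀ := by
  simp [polModelH, hT0, conjM_zero]

theorem polModelH_snd (hT0 : T 0 = 0) (η : Fin m → ℂ) : polModelH H₀ T (0, η) = H₀ := by
  simp [polModelH, hT0]

theorem polModelS_fst (hT0 : T 0 = 0) (ζ : Fin m → ℂ) :
    polModelS H₀ T (ζ, 0) = H₀ᵀ * T ζ * H₀ := by
  simp [polModelS, hT0, conjM_zero]

theorem polModelSd_fst (hT0 : T 0 = 0) (ζ : Fin m → ℂ) : polModelSd H₀ T (ζ, 0) = 0 := by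
  simp [polModelSd, hT0, conjM_zero]

end Model

/-! ### Normalization of the coordinates `ζ` -/

section Positions

variable {s m : ℕ}

theorem SeparatingPositions.eq_zero {B : Fin m → Matrix (Fin s) (Fin s) ℂ}
    {p : Fin m → Fin s × Fin s} (hp : SeparatingPositions B p) {A : Matrix (Fin s) (Fin s) ℂ}
    (hA : A ∈ Submodule.span ℂ (Set.range B)) (h : ∀ β, A (p β).1 (p β).2 = 0) : A = 0 := by
  obtain ⟨c, rfl⟩ := (Submodule.mem_span_range_iff_exists_fun ℂ).1 hA
  have hc : c = 0 := by
    refine hp ?_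
    funext β
    have := h β
    simp only [Matrix.sum_apply, Matrix.smul_apply, smul_eq_mul] at this
    simpa [mul_comm] using this
  simp [hc]

/-- Row rank equals column rank: m independent matrices form an m × s² array of rank m, so m of its
columns, which are indexed by positions, form a basis of ℂ^m. A ζ orthogonal to a basis is zero. -/
theorem exists_separatingPositions {B : Fin m → Matrix (Fin s) (Fin s) ℂ}
    (hB : LinearIndependent ℂ B) : ∃ p, SeparatingPositions B p := by
  let R : Fin s × Fin s → Fin m → ℂ := fun q α => B α q.1 q.2
  have hrank : Module.finrank ℂ (Submodule.span ℂ (Set.range R)) = m := by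
    let M : Matrix (Fin m) (Fin s × Fin s) ℂ := fun α q => B α q.1 q.2
    have hM : LinearIndependent ℂ M.row := by
      let e : Matrix (Fin s) (Fin s) ℂ →ₗ[ℂ] (Fin s × Fin s → ℂ) :=
        { toFun := fun A q => A q.1 q.2
          map_add' := fun _ _ => rfl
          map_smul' := fun _ _ => rfl }
      have he : LinearMap.ker e = ⊥ := LinearMap.ker_eq_bot.2 fun A C h => by
        ext i j
        exact congrFun h (i, j)
      exact hB.map' e he
    have h1 := hM.rank_matrix
    rw [← Matrix.rank_transpose, Matrix.rank_eq_finrank_span_row, Fintype.card_fin] at h1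
    exact h1
  obtain ⟨κ, a, -, hspan, hli⟩ := exists_linearIndependent' ℂ R
  have htop : Submodule.span ℂ (Set.range R) = ⊤ :=
    Submodule.eq_top_of_finrank_eq (by rw [hrank, Module.finrank_fin_fun])
  rw [htop] at hspan
  let b : Module.Basis κ ℂ (Fin m → ℂ) := Module.Basis.mk hli hspan.ge
  have : Fintype κ := FiniteDimensional.fintypeBasisIndex b
  have hcard : Fintype.card κ = m := by
    rw [← Module.finrank_eq_card_basis b, Module.finrank_fin_fun]
  let e : Fin m ≃ κ := (Fintype.equivFinOfCardEq hcard).symm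
  refine ⟨fun β => a (e β), fun ζ ζ' h => ?_⟩
  have h1 : ∀ i, (ζ - ζ') ⬝ᵥ b i = 0 := fun i => by
    have h2 := congrFun h (e.symm i)
    simp only [Equiv.apply_symm_apply] at h2
    rw [Module.Basis.mk_apply, dotProduct_comm, dotProduct_sub, sub_eq_zero]
    exact h2
  have h2 : ∀ v, (ζ - ζ') ⬝ᵥ v = 0 := fun v => by
    rw [← b.sum_repr v, dotProduct_sum]
    exact Finset.sum_eq_zero fun i _ => by rw [dotProduct_smul, h1, smul_zero]
  exact sub_eq_zero.1 (dotProduct_eq_zero _ h2)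

theorem exists_isFirstPositions {B : Fin m → Matrix (Fin s) (Fin s) ℂ}
    (hB : LinearIndependent ℂ B) : ∃ p, IsFirstPositions B p := by
  obtain ⟨p, hp, hmin⟩ := Set.exists_min_image {p | SeparatingPositions B p}
    (fun p => toLex (fun α => posKey (p α))) (Set.toFinite _) (exists_separatingPositions hB)
  exact ⟨p, hp, hmin⟩

theorem dHol_eq_fderiv {E : Type*} [NormedAddCommGroup E] [NormedSpace ℂ E] {f : E → ℂ} {p : E}
    (hf : DifferentiableAt ℂ f p) (v : E) : dHol f p v = fderiv ℂ f p v := by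
  change (1 / 2 : ℂ) • (fderiv ℝ f p v - I • fderiv ℝ f p (I • v)) = _
  rw [(hf.hasFDerivAt.restrictScalars ℝ).fderiv]
  simp only [ContinuousLinearMap.coe_restrictScalars', map_smul, smul_eq_mul]
  linear_combination (-(1 / 2 : ℂ) * fderiv ℂ f p v) * I_mul_I

/-- The differential at `0` of a matrix valued function. -/
def matDerivL (T : (Fin m → ℂ) → Matrix (Fin s) (Fin s) ℂ) :
    (Fin m → ℂ) →ₗ[ℂ] Matrix (Fin s) (Fin s) ℂ where
  toFun v := matDeriv T 0 v
  map_add' v w := by ext i j; simp [matDeriv_apply]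
  map_smul' c v := by ext i j; simp [matDeriv_apply]

variable {T : (Fin m → ℂ) → Matrix (Fin s) (Fin s) ℂ}

theorem matDerivL_eq (hT : MatAnalyticAt T 0) :
    matDerivL T = Fintype.linearCombination ℂ (partialAt T) := by
  refine LinearMap.pi_ext' fun α => LinearMap.ext_ring ?_
  ext i j
  simp only [LinearMap.comp_apply, LinearMap.single_apply, Fintype.linearCombination_apply_single,
    one_smul]
  exact (dHol_eq_fderiv (hT.differentiableAt i j) _).symm

theorem linearIndependent_partialAt_iff (hT : MatAnalyticAt T 0) :
    LinearIndependent ℂ (partialAt T) ↔ Function.Injective (matDerivL T) := by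
  rw [matDerivL_eq hT]
  exact linearIndependent_iff_injective_fintypeLinearCombination

theorem span_partialAt (hT : MatAnalyticAt T 0) :
    Submodule.span ℂ (Set.range (partialAt T)) = LinearMap.range (matDerivL T) := by
  rw [matDerivL_eq hT, Fintype.range_linearCombination]

theorem bijective_of_injective_fderiv {E : Type*} [NormedAddCommGroup E] [NormedSpace ℂ E]
    [FiniteDimensional ℂ E] (L : E →L[ℂ] E) (h : ∀ v, L v = 0 → v = 0) : Function.Bijective L := by
  have hinj : Function.Injective (L : E →ₗ[ℂ] E) := (injective_iff_map_eq_zero _).2 h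
  exact ⟨hinj, LinearMap.injective_iff_surjective.1 hinj⟩

/-- The entries of `T` at the positions `p`. -/
def entriesAt (p : Fin m → Fin s × Fin s) (T : (Fin m → ℂ) → Matrix (Fin s) (Fin s) ℂ)
    (ζ : Fin m → ℂ) : Fin m → ℂ :=
  fun β => T ζ (p β).1 (p β).2

variable {W : Submodule ℂ (Matrix (Fin s) (Fin s) ℂ)} {p : Fin m → Fin s × Fin s}

theorem analyticAt_entriesAt (hT : MatAnalyticAt T 0) : AnalyticAt ℂ (entriesAt p T) 0 :=
  analyticAt_pi_iff.2 fun β => hT (p β).1 (p β).2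

/-- The differential reads off entries of the derivative of T, which lies in W; an element of W is
detected by its entries at p, and the derivative of T is injective. -/
theorem bijective_fderiv_entriesAt
    (hW : ∀ A ∈ W, (∀ β, A (p β).1 (p β).2 = 0) → A = 0) (hT : MatAnalyticAt T 0)
    (hind : LinearIndependent ℂ (partialAt T))
    (hspan : Submodule.span ℂ (Set.range (partialAt T)) = W) :
    Function.Bijective (fderiv ℂ (entriesAt p T) 0) := by
  have h1 := (linearIndependent_partialAt_iff hT).1 hind
  refine bijective_of_injective_fderiv _ fun v hv => ?_
  have h2 : matDerivL T v = 0 := by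
    refine hW _ ?_ fun β => ?_
    · rw [← hspan, span_partialAt hT]
      exact LinearMap.mem_range_self _ _
    · have e : fderiv ℂ (entriesAt p T) 0 v β = matDerivL T v (p β).1 (p β).2 := by
        have hd : HasFDerivAt (entriesAt p T)
            (ContinuousLinearMap.pi fun β => fderiv ℂ (fun ζ => T ζ (p β).1 (p β).2) 0) 0 :=
          hasFDerivAt_pi.2 fun β => (hT.differentiableAt _ _).hasFDerivAt
        rw [hd.fderiv]
        rfl
      rw [← e, hv]
      rfl
  exact h1 (h2.trans (map_zero _).symm)

/-- A reparametrization of `ζ` makes the entries at the positions `p` equal to `ζ`. -/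
theorem exists_isNormalized_comp
    (hW : ∀ A ∈ W, (∀ β, A (p β).1 (p β).2 = 0) → A = 0) (hT : MatAnalyticAt T 0)
    (hsymm : ∀ᶠ ζ in 𝓝 0, (T ζ).IsSymm) (h0 : T 0 = 0)
    (hind : LinearIndependent ℂ (partialAt T))
    (hspan : Submodule.span ℂ (Set.range (partialAt T)) = W) :
    ∃ T', IsNormalized W p T' ∧ ∀ᶠ ζ in 𝓝 0, T' (entriesAt p T ζ) = T ζ := by
  have hf0 : entriesAt p T 0 = 0 := by funext β; simp [entriesAt, h0]
  -- Composing T with the local inverse g of ζ ↦ (entries of T at p) turns these entries into ζ. The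
  -- span is unchanged, since the differential of g is onto.
  obtain ⟨g, hg, hg0, hgf, hfg, hgb⟩ := exists_analytic_inverse (analyticAt_entriesAt hT) hf0
    (bijective_fderiv_entriesAt hW hT hind hspan)
  have hTg : MatAnalyticAt (fun ζ => T (g ζ)) 0 :=
    MatAnalyticAt.comp (f := g) (by rwa [hg0]) hg
  have hL : matDerivL (fun ζ => T (g ζ)) = (matDerivL T).comp (fderiv ℂ g 0).toLinearMap := by
    refine LinearMap.ext fun v => ?_
    have := matDeriv_comp (f := g) (M := T) (x := 0) (by rwa [hg0]) hg.differentiableAt v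
    rw [hg0] at this
    exact this
  refine ⟨fun ζ => T (g ζ), ⟨hTg, ?_, ?_, ?_, ?_, ?_⟩, hgf.mono fun ζ h => congrArg T h⟩
  · have := hg.continuousAt.eventually (by rw [hg0]; exact hsymm)
    exact this
  · simp only [hg0, h0]
  · rw [linearIndependent_partialAt_iff hTg, hL]
    exact ((linearIndependent_partialAt_iff hT).1 hind).comp hgb.1
  · filter_upwards [hfg] with ζ h α
    exact congrFun h α
  · rw [span_partialAt hTg, hL, LinearMap.range_comp_of_range_eq_top, ← span_partialAt hT, hspan]
    exact LinearMap.range_eq_top.2 hgb.2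

end Positions

/-! ### Existence of the normal form -/

section Existence

theorem matDeriv_sub_const {X p q : Type*} [NormedAddCommGroup X] [NormedSpace ℂ X]
    (M : X → Matrix p q ℂ) (A : Matrix p q ℂ) (x v : X) :
    matDeriv (fun y => M y - A) x v = matDeriv M x v := by
  ext i j
  simp only [matDeriv_apply, Matrix.sub_apply, fderiv_sub_const]

/-- The system contains S and S' only through derivatives. This permits the normalization S(0) =
S'(0) = 0 required by `inv_transpose_eq`. -/
theorem IsMinimalRank.sub_const {E n : Type*} [NormedAddCommGroup E] [NormedSpace ℂ E]
    [Fintype n] [DecidableEq n] {H S S' : E × E → Matrix n n ℂ} {r : ℝ}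
    (h : IsMinimalRank H S S' r) {A A' : Matrix n n ℂ} (hA : Aᵀ = A) (hA' : A'ᵀ = A') :
    IsMinimalRank H (fun x => S x - A) (fun x => S' x - A') r where
  anH := h.anH
  anS x hx := (h.anS x hx).sub (.const A)
  anS' x hx := (h.anS' x hx).sub (.const A')
  symS x hx := by rw [transpose_sub, h.symS x hx, hA]
  symS' x hx := by rw [transpose_sub, h.symS' x hx, hA']
  unit := h.unit
  eqH x hx a b := by simpa only [matDeriv_sub_const] using h.eqH x hx a b
  eqS x hx a b := by simpa only [matDeriv_sub_const] using h.eqS x hx a b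
  eqS' x hx a b := by simpa only [matDeriv_sub_const] using h.eqS' x hx a b

variable {s m : ℕ}

theorem mulVec_dotProduct_eq {p q : Type*} [Fintype p] [Fintype q] (A : Matrix p q ℂ)
    (z : q → ℂ) (x : p → ℂ) : (A *ᵥ z) ⬝ᵥ x = z ⬝ᵥ Aᵀ *ᵥ x := by
  rw [← vecMul_transpose, ← dotProduct_mulVec]

/-- The factorizations of `H` and `S - conj C` through the explicit model. -/
theorem model_factorization {H₀ P A C X Y G T : Matrix (Fin s) (Fin s) ℂ}
    (hH : H₀.IsHermitian) (hu : IsUnit H₀.det) (hX : IsUnit X.det) (hT : Tᵀ = T)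
    (hP : P = Gᵀ * H₀) (hA : A = H₀ᵀ * T * H₀) (hPu : IsUnit P.det)
    (h1 : (X⁻¹)ᵀ = (P⁻¹)ᵀ * (H₀ᵀ - A * H₀⁻¹ * conjM A) * (((conjM P)ᵀ)⁻¹)ᵀ)
    (h2 : Y * (X⁻¹)ᵀ = C * (X⁻¹)ᵀ + P * H₀⁻¹ * conjM A * (((conjM P)ᵀ)⁻¹)ᵀ) :
    X = Gᵀ * ((1 - H₀ * (conjM T * H₀ᵀ * T))⁻¹ * H₀) * conjM G ∧
    conjM Y = conjM C + (conjM G)ᵀ * (H₀ᵀ * (T * (1 - H₀ * conjM T * H₀ᵀ * T)⁻¹) * H₀)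
      * conjM G := by
  -- In the application P, A and C are H(ζ,0), S(ζ,0) - S(0,0) and S'(ζ,0), while X and Y are the
  -- values of H and S' at (ζ, conj ζ). Then (conj P)ᵀ is H(0, conj ζ).
  have hc : conjM H₀ = H₀ᵀ := conjM_of_isHermitian hH
  have hct : conjM H₀ᵀ = H₀ := by rw [conjM_transpose, hc, transpose_transpose]
  have hTc : (conjM T)ᵀ = conjM T := by rw [← conjM_transpose, hT]
  have hut : IsUnit (H₀ᵀ).det := by rwa [det_transpose]
  set D := 1 - H₀ * (conjM T * H₀ᵀ * T) with hD
  have hQ : (conjM P)ᵀ = H₀ * conjM G := by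
    rw [hP, conjM_mul, hc, transpose_mul, transpose_transpose, conjM_transpose,
      transpose_transpose]
  have hAc : conjM A = H₀ * conjM T * H₀ᵀ := by rw [hA, conjM_mul, conjM_mul, hc, hct]
  -- The middle factor is (D H₀)ᵀ. Inverting the product, with P = GᵀH₀ and (conj P)ᵀ = H₀ conj G,
  -- gives X = Gᵀ D⁻¹ H₀ conj G.
  have hmid : H₀ᵀ - A * H₀⁻¹ * conjM A = (D * H₀)ᵀ := by
    rw [hAc, hA, hD, sub_mul, transpose_sub, one_mul]
    congr 1
    rw [mul_assoc _ H₀ H₀⁻¹, mul_nonsing_inv _ hu, mul_one]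
    simp only [transpose_mul, transpose_transpose, hT, hTc, mul_assoc]
  have hPr : P * H₀⁻¹ = Gᵀ := by rw [hP, mul_assoc, mul_nonsing_inv _ hu, mul_one]
  have e1 : X⁻¹ = ((conjM P)ᵀ)⁻¹ * (D * H₀) * P⁻¹ := by
    rw [← transpose_inj, h1, hmid]
    simp only [transpose_mul, mul_assoc]
  have hQu : IsUnit ((conjM P)ᵀ).det := by
    have : (conjM P)ᵀ = Pᴴ := rfl
    rw [this, det_conjTranspose]
    exact hPu.star
  have e2 : X = Gᵀ * (D⁻¹ * H₀) * conjM G := by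
    have := congrArg (·⁻¹) e1
    simp only [nonsing_inv_nonsing_inv _ hX, Matrix.mul_inv_rev,
      nonsing_inv_nonsing_inv _ hPu, nonsing_inv_nonsing_inv _ hQu] at this
    rw [this, ← mul_assoc, ← mul_assoc, hPr, hQ]
    simp only [mul_assoc]
  refine ⟨e2, ?_⟩
  have e3 : Y = C + P * H₀⁻¹ * conjM A * (((conjM P)ᵀ)⁻¹)ᵀ * Xᵀ := by
    have hXt : (X⁻¹)ᵀ * Xᵀ = 1 := by rw [← transpose_mul, mul_nonsing_inv _ hX, transpose_one]
    calc Y = Y * (X⁻¹)ᵀ * Xᵀ := by rw [mul_assoc, hXt, mul_one]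
      _ = _ := by rw [h2, add_mul, mul_assoc C, hXt, mul_one]
  have e4 : (((conjM P)ᵀ)⁻¹)ᵀ * Xᵀ = (D⁻¹)ᵀ * G := by
    rw [← transpose_mul, e2]
    have : Gᵀ * (D⁻¹ * H₀) * conjM G * ((conjM P)ᵀ)⁻¹ = Gᵀ * D⁻¹ := by
      rw [mul_assoc, mul_assoc, mul_assoc, ← mul_assoc H₀, ← hQ, mul_nonsing_inv _ hQu, mul_one]
    rw [this, transpose_mul, transpose_transpose]
  have e5 : (D⁻¹)ᵀ = (1 - T * (H₀ * conjM T * H₀ᵀ))⁻¹ := by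
    rw [transpose_nonsing_inv, hD]
    simp only [transpose_sub, transpose_one, transpose_mul, transpose_transpose, hT, hTc, mul_assoc]
  rw [e3, mul_assoc _ _ Xᵀ, e4, hPr, hAc, e5]
  have hcD : conjM (H₀ * conjM T * H₀ᵀ * (1 - T * (H₀ * conjM T * H₀ᵀ))⁻¹)
      = H₀ᵀ * (T * (1 - H₀ * conjM T * H₀ᵀ * T)⁻¹) * H₀ := by
    have e7 := inv_one_sub_mul_comm H₀ (conjM T * H₀ᵀ * T)
    simp only [conjM_mul, conjM_inv, conjM_sub, conjM_one, conjM_conjM, hc, hct]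
    simp only [mul_assoc] at e7 ⊢
    rw [e7]
  have hG : conjM Gᵀ = (conjM G)ᵀ := conjM_transpose G
  have hadd : ∀ M N : Matrix (Fin s) (Fin s) ℂ, conjM (M + N) = conjM M + conjM N := fun M N => by
    ext i j
    simp [conjM]
  rw [← hcD, ← hG, ← conjM_mul, ← conjM_mul, ← hadd]
  simp only [mul_assoc]

variable {H S : (Fin m → ℂ) → Matrix (Fin s) (Fin s) ℂ}
    {Hc Sc Sd : (Fin m → ℂ) × (Fin m → ℂ) → Matrix (Fin s) (Fin s) ℂ} {r : ℝ}

/-- The differential at `0` of `(w, z, ζ) ↦ (w - zᵀ C(ζ) z, G(ζ) z, f(ζ))` with `G(0) = 1`. -/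
theorem fderiv_changeOfCoordinates {C G : (Fin m → ℂ) → Matrix (Fin s) (Fin s) ℂ}
    {f : (Fin m → ℂ) → (Fin m → ℂ)} (hC : MatAnalyticAt C 0) (hG : MatAnalyticAt G 0)
    (hG1 : G 0 = 1) (hf : AnalyticAt ℂ f 0) :
    AnalyticAt ℂ (fun q : Amb s m =>
      ((q.1 - q.2.1 ⬝ᵥ C q.2.2 *ᵥ q.2.1, G q.2.2 *ᵥ q.2.1, f q.2.2) : Amb s m)) 0 ∧
    ∀ v, fderiv ℂ (fun q : Amb s m =>
      ((q.1 - q.2.1 ⬝ᵥ C q.2.2 *ᵥ q.2.1, G q.2.2 *ᵥ q.2.1, f q.2.2) : Amb s m)) 0 v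
        = (v.1, v.2.1, fderiv ℂ f 0 v.2.2) := by
  set φ : Amb s m → Amb s m := fun q =>
      ((q.1 - q.2.1 ⬝ᵥ C q.2.2 *ᵥ q.2.1, G q.2.2 *ᵥ q.2.1, f q.2.2) : Amb s m) with hφ
  have hζ : AnalyticAt ℂ (fun q : Amb s m => q.2.2) 0 :=
    ((ContinuousLinearMap.snd ℂ (Fin s → ℂ) (Fin m → ℂ)).comp
      (ContinuousLinearMap.snd ℂ ℂ ((Fin s → ℂ) × (Fin m → ℂ)))).analyticAt 0
  have hz : ∀ i, AnalyticAt ℂ (fun q : Amb s m => q.2.1 i) 0 := fun i =>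
    ((ContinuousLinearMap.proj (R := ℂ) (φ := fun _ : Fin s => ℂ) i).comp
      ((ContinuousLinearMap.fst ℂ (Fin s → ℂ) (Fin m → ℂ)).comp
        (ContinuousLinearMap.snd ℂ ℂ ((Fin s → ℂ) × (Fin m → ℂ))))).analyticAt 0
  have hC' : ∀ i j, AnalyticAt ℂ (fun q : Amb s m => C q.2.2 i j) 0 := fun i j =>
    AnalyticAt.comp (g := fun ζ => C ζ i j) (f := fun q : Amb s m => q.2.2) (hC i j) hζ
  have hG' : ∀ i j, AnalyticAt ℂ (fun q : Amb s m => G q.2.2 i j) 0 := fun i j =>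
    AnalyticAt.comp (g := fun ζ => G ζ i j) (f := fun q : Amb s m => q.2.2) (hG i j) hζ
  have hf' : AnalyticAt ℂ (fun q : Amb s m => f q.2.2) 0 :=
    AnalyticAt.comp (g := f) (f := fun q : Amb s m => q.2.2) hf hζ
  have hmul : ∀ (M : (Fin m → ℂ) → Matrix (Fin s) (Fin s) ℂ),
      (∀ i j, AnalyticAt ℂ (fun q : Amb s m => M q.2.2 i j) 0) →
      ∀ i, AnalyticAt ℂ (fun q : Amb s m => (M q.2.2 *ᵥ q.2.1) i) 0 := fun M hM i => by
    simp only [mulVec, dotProduct]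
    exact Finset.analyticAt_fun_sum _ fun j _ => (hM i j).mul (hz j)
  have han : AnalyticAt ℂ φ 0 := by
    refine AnalyticAt.prod (analyticAt_fst.sub ?_)
      (AnalyticAt.prod (analyticAt_pi_iff.2 (hmul G hG')) hf')
    simp only [dotProduct]
    exact Finset.analyticAt_fun_sum _ fun j _ => (hz j).mul (hmul C hC' j)
  refine ⟨han, fun v => ?_⟩
  -- The differential is computed along the lines t ↦ tv, on which each (w, z)-component is t times
  -- a continuous function and zᵀC z contributes only order t².
  have h1 : HasDerivAt (fun t : ℂ => φ (t • v)) (fderiv ℂ φ 0 v) 0 := by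
    have h2 : HasDerivAt (fun t : ℂ => t • v) v 0 := by
      simpa using (hasDerivAt_id (0 : ℂ)).smul_const v
    have h3 : HasFDerivAt φ (fderiv ℂ φ 0) ((0 : ℂ) • v) := by
      rw [zero_smul]
      exact han.differentiableAt.hasFDerivAt
    exact h3.comp_hasDerivAt (0 : ℂ) h2
  have hline : ContinuousAt (fun t : ℂ => t • v.2.2) 0 := by fun_prop
  have hcont : ∀ {M : (Fin m → ℂ) → Matrix (Fin s) (Fin s) ℂ}, MatAnalyticAt M 0 →
      ContinuousAt (fun t : ℂ => M (t • v.2.2)) 0 := fun {M} hM =>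
    ContinuousAt.comp (g := M) (f := fun t : ℂ => t • v.2.2)
      (by simpa only [zero_smul] using hM.continuousAt) hline
  have d1 : HasDerivAt (fun t : ℂ => (φ (t • v)).1) v.1 0 := by
    have hk : ContinuousAt (fun t : ℂ =>
        v.1 - t * (v.2.1 ⬝ᵥ C (t • v.2.2) *ᵥ v.2.1)) 0 :=
      continuousAt_const.sub (continuousAt_id.mul
        (continuousAt_dot continuousAt_const (hcont hC) continuousAt_const))
    have := hasDerivAt_smul_of_continuousAt hk
    simp only [zero_mul, sub_zero] at this
    refine this.congr_of_eventuallyEq (Eventually.of_forall fun t => ?_)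
    simp only [hφ, Prod.smul_fst, Prod.smul_snd, mulVec_smul, dotProduct_smul, smul_dotProduct,
      smul_eq_mul]
    ring
  have d2 : HasDerivAt (fun t : ℂ => (φ (t • v)).2.1) v.2.1 0 := by
    have hk : ContinuousAt (fun t : ℂ => G (t • v.2.2) *ᵥ v.2.1) 0 := by
      have h : Continuous fun M : Matrix (Fin s) (Fin s) ℂ => M *ᵥ v.2.1 := by fun_prop
      exact h.continuousAt.comp (f := fun t : ℂ => G (t • v.2.2)) (hcont hG)
    have := hasDerivAt_smul_of_continuousAt hk
    simp only [zero_smul, hG1, one_mulVec] at this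
    refine this.congr_of_eventuallyEq (Eventually.of_forall fun t => ?_)
    simp only [hφ, Prod.smul_snd, Prod.smul_fst, mulVec_smul]
  have d3 : HasDerivAt (fun t : ℂ => (φ (t • v)).2.2) (fderiv ℂ f 0 v.2.2) 0 := by
    have h2 : HasDerivAt (fun t : ℂ => t • v.2.2) v.2.2 0 := by
      simpa using (hasDerivAt_id (0 : ℂ)).smul_const v.2.2
    have h3 : HasFDerivAt f (fderiv ℂ f 0) ((0 : ℂ) • v.2.2) := by
      rw [zero_smul]
      exact hf.differentiableAt.hasFDerivAt
    exact h3.comp_hasDerivAt (0 : ℂ) h2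
  exact h1.unique (d1.prodMk (d2.prodMk d3))

/-- The coordinate change is (w, z, ζ) ↦ (w - zᵀC(ζ)z, G(ζ)z, entries of T(ζ) at p). Here C removes
S'(ζ,0), G makes H(ζ,0) constant, and T is what is left of S(ζ,0). The derivatives of T at 0 are
exactly the symbol matrices, so independence and the span carry over. -/
theorem exists_normalForm {p : Fin m → Fin s × Fin s} (h : IsPolarization H S Hc Sc Sd r)
    (hmin : IsMinimalRank Hc Sc Sd r) (hu : IsUnit (H 0).det)
    (hind : LinearIndependent ℂ (symbolMatrix H S))
    (hp : SeparatingPositions (symbolMatrix H S) p) :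
    ∃ T φ, IsNormalized (symbolSpan H S) p T ∧
      IsLocalEquiv φ (defFun H S) (modelFun (H 0) T) ∧ PreservesSides φ := by
  have b0 : (0 : (Fin m → ℂ) × (Fin m → ℂ)) ∈ Metric.ball 0 r := Metric.mem_ball_self h.pos
  have hH0 : Hc 0 = H 0 := by
    have := h.eqH.self_of_nhds
    rwa [star_zero] at this
  have hherm : (H 0).IsHermitian := h.herm.self_of_nhds
  have hut : IsUnit ((H 0)ᵀ).det := by rwa [det_transpose]
  have hSd0 : Sd 0 = conjM (Sc 0) := by
    have := h.Sd_eq 0 b0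
    simp only [Prod.fst_zero, Prod.snd_zero, star_zero] at this
    exact this
  have hfst : ∀ {M : (Fin m → ℂ) × (Fin m → ℂ) → Matrix (Fin s) (Fin s) ℂ}, MatAnalyticAt M 0 →
      MatAnalyticAt (fun ζ : Fin m → ℂ => M (ζ, 0)) 0 := fun {M} hM =>
    MatAnalyticAt.comp (M := M) (f := fun ζ : Fin m → ℂ => (ζ, (0 : Fin m → ℂ))) hM
      ((ContinuousLinearMap.inl ℂ (Fin m → ℂ) (Fin m → ℂ)).analyticAt 0)
  let C : (Fin m → ℂ) → Matrix (Fin s) (Fin s) ℂ := fun ζ => Sd (ζ, 0)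
  let G : (Fin m → ℂ) → Matrix (Fin s) (Fin s) ℂ := fun ζ => ((H 0)ᵀ)⁻¹ * (Hc (ζ, 0))ᵀ
  let T : (Fin m → ℂ) → Matrix (Fin s) (Fin s) ℂ := fun ζ =>
    ((H 0)ᵀ)⁻¹ * (Sc (ζ, 0) - Sc 0) * (H 0)⁻¹
  have hC : MatAnalyticAt C 0 := hfst (h.anS' 0 b0)
  have hG : MatAnalyticAt G 0 := (MatAnalyticAt.const _).mul (hfst (h.anH 0 b0)).transpose
  have hT : MatAnalyticAt T 0 :=
    ((MatAnalyticAt.const _).mul ((hfst (h.anS 0 b0)).sub (.const _))).mul (.const _)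
  have hG1 : G 0 = 1 := by
    change ((H 0)ᵀ)⁻¹ * (Hc 0)ᵀ = 1
    rw [hH0, nonsing_inv_mul _ hut]
  have hT0 : T 0 = 0 := by
    change ((H 0)ᵀ)⁻¹ * (Sc 0 - Sc 0) * (H 0)⁻¹ = 0
    simp
  have hmem : ∀ᶠ ζ : Fin m → ℂ in 𝓝 0, (ζ, (0 : Fin m → ℂ)) ∈ Metric.ball 0 r := by
    filter_upwards [h.eventually_diag_mem] with ζ hζ
    exact mem_ball_fst hζ
  have hsymm : ∀ᶠ ζ in 𝓝 0, (T ζ).IsSymm := by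
    filter_upwards [hmem] with ζ hζ
    simp only [T, Matrix.IsSymm, transpose_mul, transpose_sub, transpose_nonsing_inv,
      transpose_transpose, h.symSc _ hζ, h.symSc 0 b0, mul_assoc]
  have hpart : partialAt T = symbolMatrix H S := by
    funext α
    have e1 : partialAt T α = matDeriv T 0 (Pi.single α 1) := by
      ext i j
      exact dHol_eq_fderiv (hT.differentiableAt i j) _
    have e2 : matDeriv (fun ζ : Fin m → ℂ => Sc (ζ, 0) - Sc 0) 0 (Pi.single α 1)
        = matDeriv Sc 0 (Pi.single α 1, 0) := by
      rw [matDeriv_sub_const]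
      have := matDeriv_comp (M := Sc) (f := fun ζ : Fin m → ℂ => (ζ, (0 : Fin m → ℂ))) (x := 0)
        (h.anS 0 b0) (ContinuousLinearMap.inl ℂ (Fin m → ℂ) (Fin m → ℂ)).differentiableAt
        (Pi.single α 1)
      have e := (ContinuousLinearMap.inl ℂ (Fin m → ℂ) (Fin m → ℂ)).fderiv (x := 0)
      rw [this]
      change matDeriv Sc 0 (fderiv ℂ (ContinuousLinearMap.inl ℂ (Fin m → ℂ) (Fin m → ℂ)) 0 _) = _
      rw [e]
      rfl
    rw [e1, symbolMatrix, h.partialAt_eq, ← e2]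
    have a1 : MatAnalyticAt (fun ζ : Fin m → ℂ => Sc (ζ, 0) - Sc 0) 0 :=
      (hfst (h.anS 0 b0)).sub (.const _)
    change matDeriv (fun ζ => ((H 0)ᵀ)⁻¹ * (Sc (ζ, 0) - Sc 0) * (H 0)⁻¹) 0 _ = _
    rw [matDeriv_mul ((MatAnalyticAt.const _).mul a1) (.const _), matDeriv_mul (.const _) a1]
    simp only [matDeriv_const, Matrix.zero_mul, Matrix.mul_zero, zero_add, add_zero]
  have hW : ∀ A ∈ symbolSpan H S, (∀ β, A (p β).1 (p β).2 = 0) → A = 0 := fun A hA hz =>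
    hp.eq_zero hA hz
  have hind' : LinearIndependent ℂ (partialAt T) := by rwa [hpart]
  have hspan' : Submodule.span ℂ (Set.range (partialAt T)) = symbolSpan H S := by
    rw [hpart, symbolSpan]
  obtain ⟨T', hT', hTT'⟩ := exists_isNormalized_comp hW hT hsymm hT0 hind' hspan'
  have hf := analyticAt_entriesAt (p := p) hT
  have hfb := bijective_fderiv_entriesAt hW hT hind' hspan'
  obtain ⟨hφ, hφ'⟩ := fderiv_changeOfCoordinates hC hG hG1 hf
  refine ⟨T', _, hT', ⟨hφ, ?_, ?_, ?_⟩, ?_⟩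
  · have : entriesAt p T 0 = 0 := by funext β; simp [entriesAt, hT0]
    simp [this]
  · refine bijective_of_injective_fderiv _ fun v hv => ?_
    rw [hφ'] at hv
    obtain ⟨h1, h2⟩ := Prod.mk.inj hv
    obtain ⟨h2, h3⟩ := Prod.mk.inj h2
    exact Prod.ext h1 (Prod.ext h2 (hfb.1 (h3.trans (map_zero _).symm)))
  · have hζ : ContinuousAt (fun q : Amb s m => q.2.2) 0 := by fun_prop
    filter_upwards [hζ.eventually hTT', hζ.eventually h.eventually_diag_mem,
      hζ.eventually hsymm, hζ.eventually h.eqH, hζ.eventually h.eqS, hζ.eventually h.eqS']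
      with q e1 e2 e3 e4 e5 e6
    obtain ⟨w, z, ζ⟩ := q
    dsimp only at e1 e2 e3 e4 e5 e6 ⊢
    -- Not only the zero sets but the defining functions themselves correspond.
    suffices hs : modelFun (H 0) T' (w - z ⬝ᵥ C ζ *ᵥ z, G ζ *ᵥ z, entriesAt p T ζ)
        = defFun H S (w, z, ζ) by rw [hs]
    have hfac := (hmin.sub_const (h.symSc 0 b0) (h.symSd 0 b0)).inv_transpose_eq
      (sub_self _) (sub_self _) e2
    have hPc : Hc (0, star ζ) = (conjM (Hc (ζ, 0)))ᵀ := by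
      have := h.Hc_eq _ (mem_ball_snd e2)
      simpa only [star_star, star_zero] using this
    have hAc : Sd (0, star ζ) - Sd 0 = conjM (Sc (ζ, 0) - Sc 0) := by
      have := h.Sd_eq _ (mem_ball_snd e2)
      simp only [star_star, star_zero] at this
      rw [this, hSd0, conjM_sub]
    dsimp only at hfac
    rw [hPc, hAc, hH0] at hfac
    obtain ⟨hfac1, hfac2⟩ := hfac
    -- The constant S'(0,0) subtracted on both sides cancels, so that the full S'(ζ,0) plays the
    -- role of C.
    rw [sub_mul, sub_mul (Sd (ζ, 0)), sub_add_eq_add_sub, sub_left_inj] at hfac2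
    have hP : Hc (ζ, 0) = (G ζ)ᵀ * H 0 := by
      simp only [G, transpose_mul, transpose_transpose, transpose_nonsing_inv, mul_assoc]
      rw [nonsing_inv_mul _ hu, mul_one]
    have hA : Sc (ζ, 0) - Sc 0 = (H 0)ᵀ * T ζ * H 0 := by
      simp only [T, mul_assoc]
      rw [nonsing_inv_mul _ hu, mul_one, ← mul_assoc, mul_nonsing_inv _ hut, one_mul]
    obtain ⟨f1, f2⟩ := model_factorization hherm hu (h.unit _ e2) e3.eq hP hA
      (h.unit _ (mem_ball_fst e2)) hfac1 hfac2
    have hcc : ∀ M : Matrix (Fin s) (Fin s) ℂ, conjM (conjM M) = M := conjM_conjM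
    rw [e4, ← e1, ← modelH_eq] at f1
    rw [e6, hcc, ← e1, ← modelS_eq] at f2
    have hstar : star (G ζ *ᵥ z) = conjM (G ζ) *ᵥ star z := (conjM_mulVec _ _).symm
    have t1 : (G ζ *ᵥ z) ⬝ᵥ modelH (H 0) T' (entriesAt p T ζ) *ᵥ star (G ζ *ᵥ z)
        = z ⬝ᵥ H ζ *ᵥ star z := by
      rw [f1, hstar, mulVec_dotProduct_eq]
      simp only [mulVec_mulVec, mul_assoc]
    have t2 : star (G ζ *ᵥ z) ⬝ᵥ modelS (H 0) T' (entriesAt p T ζ) *ᵥ star (G ζ *ᵥ z)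
        = star z ⬝ᵥ S ζ *ᵥ star z - star (z ⬝ᵥ C ζ *ᵥ z) := by
      have : star (z ⬝ᵥ C ζ *ᵥ z) = star z ⬝ᵥ conjM (C ζ) *ᵥ star z := by
        have := dotProduct_conjM_star (conjM (C ζ)) z
        rw [hcc] at this
        rw [this, star_star]
      rw [this, f2, hstar, mulVec_dotProduct_eq, add_mulVec, dotProduct_add]
      simp only [mulVec_mulVec, mul_assoc, C, add_sub_cancel_left]
    simp only [modelFun, defFun]
    rw [t1, t2, sub_re, sub_re]
    -- The leftover pure term is compensated by the change of w, as only real parts matter.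
    have : (star (z ⬝ᵥ C ζ *ᵥ z)).re = (z ⬝ᵥ C ζ *ᵥ z).re := Complex.conj_re _
    rw [this]
    ring
  · rw [PreservesSides, hφ']
    simp

end Existence

/-! ### Polarization of a local equivalence -/

section Equivalence

/-- `x ↦ conj (f (conj x))` -/
def conjMap {E F : Type*} [Star E] [Star F] (f : E → F) (x : E) : F := star (f (star x))

/-- Along real lines conjugation commutes with differentiation, and such lines determine the complex
differential. -/
theorem fderiv_conjMap {E F : Type*} [NormedAddCommGroup E] [NormedSpace ℂ E] [StarAddMonoid E]
    [NormedStarGroup E] [StarModule ℂ E] [NormedAddCommGroup F] [NormedSpace ℂ F] [StarAddMonoid F]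
    [NormedStarGroup F] [StarModule ℂ F] {f : E → F} (hf : AnalyticAt ℂ f 0) (v : E) :
    fderiv ℂ (conjMap f) 0 v = star (fderiv ℂ f 0 (star v)) := by
  have hc : AnalyticAt ℂ (conjMap f) 0 := AnalyticAt.star_comp_star (by rwa [star_zero])
  have line : ∀ {g : E → F}, AnalyticAt ℂ g 0 → ∀ u : E,
      HasDerivAt (fun t : ℝ => g (t • u)) (fderiv ℂ g 0 u) 0 := fun {g} hg u => by
    have h2 : HasDerivAt (fun t : ℝ => t • u) u 0 := by
      simpa using (hasDerivAt_id (0 : ℝ)).smul_const u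
    have h3 : HasFDerivAt g ((fderiv ℂ g 0).restrictScalars ℝ) ((0 : ℝ) • u) := by
      rw [zero_smul]
      exact hg.differentiableAt.hasFDerivAt.restrictScalars ℝ
    exact h3.comp_hasDerivAt (0 : ℝ) h2
  refine (line hc v).unique ?_
  have := (line hf (star v)).star
  refine this.congr_of_eventuallyEq (Eventually.of_forall fun t => ?_)
  simp only [conjMap, star_smul, star_trivial]

variable {s m : ℕ} {H S H' S' : (Fin m → ℂ) → Matrix (Fin s) (Fin s) ℂ}
    {Hc Sc Sd Hc' Sc' Sd' : (Fin m → ℂ) × (Fin m → ℂ) → Matrix (Fin s) (Fin s) ℂ} {r r' : ℝ}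
    {ψ : Amb s m → Amb s m}

theorem analyticAt_conjMap (hψ : AnalyticAt ℂ ψ 0) : AnalyticAt ℂ (conjMap ψ) 0 :=
  AnalyticAt.star_comp_star (by rwa [star_zero])

theorem conjMap_zero (h0 : ψ 0 = 0) : conjMap ψ 0 = 0 := by
  rw [conjMap, star_zero, h0, star_zero]

theorem IsPolarization.analyticAt_polFun (h : IsPolarization H S Hc Sc Sd r)
    {x : Amb s m × Amb s m} (hx : zetaPair s m x ∈ Metric.ball 0 r) :
    AnalyticAt ℂ (polFun Hc Sc Sd) x :=
  CRModel.analyticAt_polFun (h.anH _ hx) (h.anS _ hx) (h.anS' _ hx)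

theorem IsPolarization.analyticAt_polQuad (h : IsPolarization H S Hc Sc Sd r)
    {x : Amb s m × Amb s m} (hx : zetaPair s m x ∈ Metric.ball 0 r) :
    AnalyticAt ℂ (polQuad Hc Sc Sd) x :=
  CRModel.analyticAt_polQuad (h.anH _ hx) (h.anS _ hx) (h.anS' _ hx)

/-- A map between two hypersurfaces maps the complexified hypersurfaces to each other. -/
theorem IsPolarization.eventually_polFun_eq_zero (h : IsPolarization H S Hc Sc Sd r)
    (h' : IsPolarization H' S' Hc' Sc' Sd' r') (hψ : AnalyticAt ℂ ψ 0) (h0 : ψ 0 = 0)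
    (hg : ∀ᶠ q in 𝓝 0, defFun H S q = 0 → defFun H' S' (ψ q) = 0) :
    ∀ᶠ x in 𝓝 (0 : Amb s m × Amb s m), polFun Hc Sc Sd x = 0 →
      polFun Hc' Sc' Sd' (ψ x.1, conjMap ψ x.2) = 0 := by
  let Q : Amb s m × Amb s m → ℂ := polQuad Hc Sc Sd
  have b0 : zetaPair s m (0 : Amb s m × Amb s m) ∈ Metric.ball 0 r := by
    rw [map_zero]; exact Metric.mem_ball_self h.pos
  have b0' : zetaPair s m (0 : Amb s m × Amb s m) ∈ Metric.ball 0 r' := by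
    rw [map_zero]; exact Metric.mem_ball_self h'.pos
  have hQ : AnalyticAt ℂ Q 0 := h.analyticAt_polQuad b0
  have hQ0 : Q 0 = 0 := by simp [Q, polQuad]
  -- A holomorphic retraction onto the complexified hypersurface ½(w + τ) = Q: it keeps w - τ and
  -- the other coordinates and corrects w + τ. This is possible because Q does not involve w and τ.
  let E : Amb s m × Amb s m → Amb s m × Amb s m := fun x =>
    ((Q x + (1 / 2) * (x.1.1 - x.2.1), x.1.2), (Q x - (1 / 2) * (x.1.1 - x.2.1), x.2.2))
  have hE0 : E 0 = 0 := by
    simp only [E, hQ0]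
    simp
  have hE : AnalyticAt ℂ E 0 := by
    have hw : AnalyticAt ℂ (fun x : Amb s m × Amb s m => (1 / 2 : ℂ) * (x.1.1 - x.2.1)) 0 :=
      analyticAt_const.fun_mul
      (((ContinuousLinearMap.fst ℂ ℂ ((Fin s → ℂ) × (Fin m → ℂ))).comp
        (ContinuousLinearMap.fst ℂ (Amb s m) (Amb s m))
          - (ContinuousLinearMap.fst ℂ ℂ ((Fin s → ℂ) × (Fin m → ℂ))).comp
        (ContinuousLinearMap.snd ℂ (Amb s m) (Amb s m))).analyticAt 0)
    exact ((hQ.fun_add hw).prod (((ContinuousLinearMap.snd ℂ ℂ ((Fin s → ℂ) × (Fin m → ℂ))).comp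
        (ContinuousLinearMap.fst ℂ (Amb s m) (Amb s m))).analyticAt 0)).prod
      ((hQ.fun_sub hw).prod (((ContinuousLinearMap.snd ℂ ℂ ((Fin s → ℂ) × (Fin m → ℂ))).comp
        (ContinuousLinearMap.snd ℂ (Amb s m) (Amb s m))).analyticAt 0))
  let Ψ : Amb s m × Amb s m → Amb s m × Amb s m := fun x => (ψ x.1, conjMap ψ x.2)
  have hΨ : AnalyticAt ℂ Ψ 0 := by
    refine AnalyticAt.prod ?_ ?_
    · exact AnalyticAt.comp (g := ψ) (f := Prod.fst) (by exact hψ) analyticAt_fst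
    · exact AnalyticAt.comp (g := conjMap ψ) (f := Prod.snd) (by exact analyticAt_conjMap hψ)
        analyticAt_snd
  have hΨ0 : Ψ 0 = 0 := Prod.ext h0 (conjMap_zero h0)
  have hF : AnalyticAt ℂ (fun x => polFun Hc' Sc' Sd' (Ψ (E x))) 0 := by
    refine AnalyticAt.comp (g := polFun Hc' Sc' Sd') (f := fun x => Ψ (E x)) ?_
      (AnalyticAt.comp (g := Ψ) (f := E) (by rwa [hE0]) hE)
    rw [hE0, hΨ0]
    exact h'.analyticAt_polFun b0'
  obtain ⟨ρ, hρ, hball⟩ := Metric.eventually_nhds_iff_ball.1 hF.eventually_analyticAt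
  -- For τ, χ, η conjugate to w, z, ζ the value of Q is real, so E maps such a pair to a point of
  -- the real hypersurface together with its conjugate. There the hypothesis on ψ applies.
  have hdiag : ∀ᶠ q in 𝓝 (0 : Amb s m), polFun Hc' Sc' Sd' (Ψ (E (q, star q))) = 0 := by
    have hcont : ContinuousAt (fun q : Amb s m => (E (q, star q)).1) 0 := by
      have h1 : ContinuousAt (fun q : Amb s m => (q, star q)) 0 := by fun_prop
      have h2 : ContinuousAt (fun x => (E x).1) ((0 : Amb s m), star (0 : Amb s m)) := by
        rw [star_zero]
        exact continuousAt_fst.comp hE.continuousAt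
      exact h2.comp (f := fun q : Amb s m => (q, star q)) h1
    have ht : Tendsto (fun q : Amb s m => (E (q, star q)).1) (𝓝 0) (𝓝 0) := by
      have := hcont.tendsto
      rwa [star_zero, show ((0 : Amb s m), (0 : Amb s m)) = 0 from rfl, hE0] at this
    have hζ : Tendsto (fun q : Amb s m => q.2.2) (𝓝 0) (𝓝 0) :=
      (continuous_snd.comp continuous_snd).tendsto' _ _ rfl
    filter_upwards [ht.eventually hg, hζ.eventually h.eventually_defFun_eq,
      ht.eventually ((hζ.comp (by
        have := hψ.continuousAt.tendsto; rw [h0] at this; exact this)).eventually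
          h'.eventually_defFun_eq)] with q q1 q2 q4
    obtain ⟨w, z, ζ⟩ := q
    have hreal : star (Q ((w, z, ζ), star (w, z, ζ))) = Q ((w, z, ζ), star (w, z, ζ)) := by
      have e := q2 w z
      have e2 : Q ((w, z, ζ), star (w, z, ζ))
          = ((w.re - defFun H S (w, z, ζ) : ℝ) : ℂ) := by
        have : polFun Hc Sc Sd ((w, z, ζ), star (w, z, ζ))
            = (1 / 2) * (w + star w) - Q ((w, z, ζ), star (w, z, ζ)) := rfl
        rw [this] at e
        have hw : (w + star w : ℂ) = ((2 * w.re : ℝ) : ℂ) := Complex.add_conj w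
        rw [hw] at e
        push_cast at e ⊢
        linear_combination e
      rw [e2]
      exact Complex.conj_ofReal _
    have hst : star (E ((w, z, ζ), star (w, z, ζ))).1 = (E ((w, z, ζ), star (w, z, ζ))).2 := by
      refine Prod.ext ?_ rfl
      change star (Q _ + (1 / 2) * (w - star w)) = Q _ - (1 / 2) * (w - star w)
      rw [star_add, hreal, star_mul', star_sub, star_star]
      have : star (1 / 2 : ℂ) = 1 / 2 := by simp
      rw [this]
      ring
    have hz : defFun H S (E ((w, z, ζ), star (w, z, ζ))).1 = 0 := by
      have e := q2 (E ((w, z, ζ), star (w, z, ζ))).1.1 z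
      rw [← Complex.ofReal_eq_zero]
      have e3 : ((E ((w, z, ζ), star (w, z, ζ))).1.1, z, ζ) = (E ((w, z, ζ), star (w, z, ζ))).1 :=
        rfl
      rw [e3, hst] at e
      rw [e]
      change (1 / 2) * ((Q _ + (1 / 2) * (w - star w)) + (Q _ - (1 / 2) * (w - star w)))
        - Q ((w, z, ζ), star (w, z, ζ)) = 0
      ring
    have e5 : Ψ (E ((w, z, ζ), star (w, z, ζ))) = (ψ (E ((w, z, ζ), star (w, z, ζ))).1,
        star (ψ (E ((w, z, ζ), star (w, z, ζ))).1)) := by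
      refine Prod.ext rfl ?_
      change star (ψ (star (E ((w, z, ζ), star (w, z, ζ))).2)) = _
      rw [← hst, star_star]
    rw [e5]
    have e6 := q4 (ψ (E ((w, z, ζ), star (w, z, ζ))).1).1 (ψ (E ((w, z, ζ), star (w, z, ζ))).1).2.1
    have e7 : defFun H' S' (ψ (E ((w, z, ζ), star (w, z, ζ))).1) = 0 := q1 hz
    refine e6.symm.trans ?_
    rw [Complex.ofReal_eq_zero]
    exact e7
  have hzero := eq_zero_of_diagonal hρ (fun x hx => hball x hx) hdiag
  filter_upwards [Metric.ball_mem_nhds _ hρ] with x hx hx0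
  -- On the complexified hypersurface E is the identity, so the composite that vanishes identically
  -- is the desired expression.
  have hEx : E x = x := by
    have : Q x = (1 / 2) * (x.1.1 + x.2.1) := by
      have e : (1 / 2) * (x.1.1 + x.2.1) - Q x = 0 := hx0
      linear_combination -e
    refine Prod.ext (Prod.ext ?_ rfl) (Prod.ext ?_ rfl)
    · change Q x + (1 / 2) * (x.1.1 - x.2.1) = x.1.1
      rw [this]; ring
    · change Q x - (1 / 2) * (x.1.1 - x.2.1) = x.2.1
      rw [this]; ring
  have := hzero x hx
  rw [hEx] at this
  exact this

/-- Differentiation along a curve in the complexified hypersurface. -/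
theorem fderiv_polFun_comp_eq_zero {x : ℂ → Amb s m × Amb s m} {x' : Amb s m × Amb s m}
    (hx : HasDerivAt x x' 0) (hψ : DifferentiableAt ℂ ψ (x 0).1)
    (hψc : DifferentiableAt ℂ (conjMap ψ) (x 0).2)
    (hF : DifferentiableAt ℂ (polFun Hc' Sc' Sd') (ψ (x 0).1, conjMap ψ (x 0).2))
    (hz : ∀ᶠ t in 𝓝 0, polFun Hc' Sc' Sd' (ψ (x t).1, conjMap ψ (x t).2) = 0) :
    fderiv ℂ (polFun Hc' Sc' Sd') (ψ (x 0).1, conjMap ψ (x 0).2)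
      (fderiv ℂ ψ (x 0).1 x'.1, fderiv ℂ (conjMap ψ) (x 0).2 x'.2) = 0 := by
  have x1 : HasDerivAt (fun t => (x t).1) x'.1 0 :=
    (ContinuousLinearMap.fst ℂ (Amb s m) (Amb s m)).hasFDerivAt.comp_hasDerivAt (0 : ℂ) hx
  have x2 : HasDerivAt (fun t => (x t).2) x'.2 0 :=
    (ContinuousLinearMap.snd ℂ (Amb s m) (Amb s m)).hasFDerivAt.comp_hasDerivAt (0 : ℂ) hx
  have h1 : HasDerivAt (fun t => ψ (x t).1) (fderiv ℂ ψ (x 0).1 x'.1) 0 :=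
    hψ.hasFDerivAt.comp_hasDerivAt (0 : ℂ) x1
  have h2 : HasDerivAt (fun t => conjMap ψ (x t).2) (fderiv ℂ (conjMap ψ) (x 0).2 x'.2) 0 :=
    HasFDerivAt.comp_hasDerivAt (l := conjMap ψ) (f := fun t => (x t).2) (0 : ℂ)
      hψc.hasFDerivAt x2
  have h3 := hF.hasFDerivAt.comp_hasDerivAt (0 : ℂ) (h1.prodMk h2)
  exact h3.unique ((hasDerivAt_const (0 : ℂ) (0 : ℂ)).congr_of_eventuallyEq hz)

end Equivalence

/-! ### Equivalences of models -/

section Uniqueness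

variable {s m : ℕ} {H S H' S' : (Fin m → ℂ) → Matrix (Fin s) (Fin s) ℂ}
    {Hc Sc Sd Hc' Sc' Sd' : (Fin m → ℂ) × (Fin m → ℂ) → Matrix (Fin s) (Fin s) ℂ} {r r' : ℝ}
    {ψ : Amb s m → Amb s m}

/-- A curve in the complexified hypersurface with prescribed `(z, ζ)`-velocity. -/
theorem IsPolarization.exists_curve (h : IsPolarization H S Hc Sc Sd r)
    (z : Fin s → ℂ) (κ η : Fin m → ℂ)
    (hη : ((0 : Fin m → ℂ), η) ∈ Metric.ball (0 : (Fin m → ℂ) × (Fin m → ℂ)) r) :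
    ∃ x : ℂ → Amb s m × Amb s m, HasDerivAt x ((0, z, κ), 0) 0 ∧ x 0 = (0, (0, 0, η)) ∧
      ∀ t, polFun Hc Sc Sd (x t) = 0 := by
  -- With τ = 0 and χ = 0 the equation reads ½w = Q, and Q is t² times a continuous function by
  -- homogeneity; this dictates the w-coordinate.
  let k : ℂ → Amb s m := fun t =>
    (2 * (t * polQuad Hc Sc Sd ((0, z, t • κ), (0, 0, η))), z, κ)
  have hk : ContinuousAt k 0 := by
    have e : zetaPair s m ((0, z, (0 : ℂ) • κ), (0, 0, η)) = (0, η) := by simp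
    have ha : AnalyticAt ℂ (polQuad Hc Sc Sd) ((0, z, (0 : ℂ) • κ), (0, 0, η)) :=
      h.analyticAt_polQuad (by rwa [e])
    have hc : ContinuousAt (fun t : ℂ => polQuad Hc Sc Sd ((0, z, t • κ), (0, 0, η))) 0 := by
      refine ContinuousAt.comp (g := polQuad Hc Sc Sd)
        (f := fun t : ℂ => (((0, z, t • κ), (0, 0, η)) : Amb s m × Amb s m)) ha.continuousAt ?_
      fun_prop
    exact (continuousAt_const.mul (continuousAt_id.mul hc)).prodMk continuousAt_const
  have hk0 : k 0 = (0, z, κ) := by simp [k]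
  refine ⟨fun t => (t • k t, (0, 0, η)), ?_, by simp, fun t => ?_⟩
  · have := (hasDerivAt_smul_of_continuousAt hk).prodMk
      (hasDerivAt_const (0 : ℂ) ((0, 0, η) : Amb s m))
    rwa [hk0] at this
  · have := polQuad_smul (H := Hc) (S := Sc) (S' := Sd) (t * (2 * (t * polQuad Hc Sc Sd
      ((0, z, t • κ), (0, 0, η))))) 0 t z 0 (t • κ) η
    rw [smul_zero] at this
    change (1 / 2) * (t * (2 * (t * polQuad Hc Sc Sd ((0, z, t • κ), (0, 0, η)))) + 0)
      - polQuad Hc Sc Sd ((t * (2 * (t * polQuad Hc Sc Sd ((0, z, t • κ), (0, 0, η)))), t • z,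
        t • κ), (0, 0, η)) = 0
    rw [this]
    change _ - t * (t * polQuad Hc Sc Sd ((0, z, t • κ), (0, 0, η))) = 0
    ring

/-- The differential of an equivalence of hypersurfaces is real in the normal direction. -/
theorem IsPolarization.exists_fderiv_fst_eq (h : IsPolarization H S Hc Sc Sd r)
    (h' : IsPolarization H' S' Hc' Sc' Sd' r') (hψ : AnalyticAt ℂ ψ 0) (h0 : ψ 0 = 0)
    (hg : ∀ᶠ q in 𝓝 0, defFun H S q = 0 → defFun H' S' (ψ q) = 0) :
    ∃ b : ℝ, ∀ v, (fderiv ℂ ψ 0 v).1 = b * v.1 := by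
  have hP := h.eventually_polFun_eq_zero h' hψ h0 hg
  have b0 : ((0 : Fin m → ℂ), (0 : Fin m → ℂ)) ∈ Metric.ball (0 : (Fin m → ℂ) × (Fin m → ℂ)) r :=
    Metric.mem_ball_self h.pos
  have b0' : zetaPair s m (0 : Amb s m × Amb s m) ∈ Metric.ball 0 r' := by
    rw [map_zero]; exact Metric.mem_ball_self h'.pos
  have hψc := analyticAt_conjMap hψ
  have hψc0 := conjMap_zero h0
  have hF : ∀ d, fderiv ℂ (polFun Hc' Sc' Sd') 0 d = (1 / 2) * (d.1.1 + d.2.1) := fun d => by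
    rw [fderiv_polFun (h'.anH _ b0') (h'.anS _ b0') (h'.anS' _ b0')]
    simp
  have key : ∀ {x : ℂ → Amb s m × Amb s m} {x' : Amb s m × Amb s m}, HasDerivAt x x' 0 →
      x 0 = 0 → (∀ t, polFun Hc Sc Sd (x t) = 0) →
      (fderiv ℂ ψ 0 x'.1).1 + (fderiv ℂ (conjMap ψ) 0 x'.2).1 = 0 := by
    intro x x' hx hx0 hxz
    have e : ∀ᶠ t in 𝓝 0, polFun Hc' Sc' Sd' (ψ (x t).1, conjMap ψ (x t).2) = 0 := by
      have ht : Tendsto x (𝓝 0) (𝓝 0) := by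
        have := hx.continuousAt.tendsto
        rwa [hx0] at this
      filter_upwards [ht.eventually hP] with t ht
      exact ht (hxz t)
    have e00 : (ψ (x 0).1, conjMap ψ (x 0).2) = 0 := by
      rw [hx0]
      exact Prod.ext h0 hψc0
    have e1 : (x 0).1 = 0 := by rw [hx0]; rfl
    have e2 : (x 0).2 = 0 := by rw [hx0]; rfl
    have := fderiv_polFun_comp_eq_zero hx (by rw [e1]; exact hψ.differentiableAt)
      (by rw [e2]; exact hψc.differentiableAt)
      (by rw [e00]; exact (h'.analyticAt_polFun b0').differentiableAt) e
    rw [e00, hF, e1, e2] at this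
    simpa using this
  have k1 : ∀ z κ, (fderiv ℂ ψ 0 (0, z, κ)).1 = 0 := fun z κ => by
    obtain ⟨x, hx, hx0, hxz⟩ := h.exists_curve z κ 0 b0
    have := key hx hx0 hxz
    rw [map_zero] at this
    simpa using this
  -- The line through ((1,0,0), (-1,0,0)) lies in the complexified hypersurface and forces
  -- ∂ψ_w/∂w(0) to equal its conjugate.
  have k2 : (fderiv ℂ ψ 0 (1, 0, 0)).1 = star (fderiv ℂ ψ 0 (1, 0, 0)).1 := by
    have hx : HasDerivAt (fun t : ℂ => t • (((1, 0, 0), (-1, 0, 0)) : Amb s m × Amb s m))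
        ((1, 0, 0), (-1, 0, 0)) 0 := by
      simpa using (hasDerivAt_id (0 : ℂ)).smul_const (((1, 0, 0), (-1, 0, 0)) : Amb s m × Amb s m)
    have := key hx (zero_smul _ _) fun t => by simp [polFun, polQuad]
    rw [fderiv_conjMap hψ] at this
    have e : star ((-1, 0, 0) : Amb s m) = -(1, 0, 0) := by
      refine Prod.ext ?_ (Prod.ext ?_ ?_) <;> simp
    rw [e, map_neg, star_neg] at this
    exact add_neg_eq_zero.1 this
  refine ⟨((fderiv ℂ ψ 0 (1, 0, 0)).1).re, fun v => ?_⟩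
  have e : v = v.1 • ((1, 0, 0) : Amb s m) + (0, v.2.1, v.2.2) := by
    refine Prod.ext ?_ (Prod.ext ?_ ?_) <;> simp
  rw [Complex.conj_eq_iff_re.1 k2.symm]
  conv_lhs => rw [e]
  rw [map_add, map_smul, Prod.fst_add, k1, add_zero, Prod.smul_fst, smul_eq_mul, mul_comm]

variable {H₀ : Matrix (Fin s) (Fin s) ℂ} {T T' : (Fin m → ℂ) → Matrix (Fin s) (Fin s) ℂ}

/-- `T` is a germ at `0` of a holomorphic symmetric matrix vanishing at `0`. -/
structure IsSymmGerm (T : (Fin m → ℂ) → Matrix (Fin s) (Fin s) ℂ) : Prop where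
  holomorphic : MatAnalyticAt T 0
  symmetric : ∀ᶠ ζ in 𝓝 0, (T ζ).IsSymm
  map_zero : T 0 = 0

theorem IsNormalized.isSymmGerm {W : Submodule ℂ (Matrix (Fin s) (Fin s) ℂ)}
    {p : Fin m → Fin s × Fin s} (h : IsNormalized W p T) : IsSymmGerm T :=
  ⟨h.holomorphic, h.symmetric, h.map_zero⟩

theorem IsSymmGerm.exists_isPolarization (hT : IsSymmGerm T) (hH : H₀.IsHermitian)
    (hu : IsUnit H₀.det) : ∃ r, IsPolarization (modelH H₀ T) (modelS H₀ T) (polModelH H₀ T)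
      (polModelS H₀ T) (polModelSd H₀ T) r :=
  exists_isPolarization_model hH hu hT.holomorphic hT.symmetric hT.map_zero

theorem IsSymmGerm.exists_fderiv_fst_eq (hT' : IsSymmGerm T') (hH : H₀.IsHermitian)
    (hu : IsUnit H₀.det) (h : IsPolarization H S Hc Sc Sd r)
    (hψ : IsLocalEquiv ψ (defFun H S) (modelFun H₀ T')) :
    ∃ b : ℝ, b ≠ 0 ∧ ∀ v, (fderiv ℂ ψ 0 v).1 = b * v.1 := by
  obtain ⟨r', h'⟩ := hT'.exists_isPolarization hH hu
  obtain ⟨b, hb⟩ := h.exists_fderiv_fst_eq h' hψ.holomorphic hψ.map_zero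
    (hψ.germ.mono fun q hq => hq.1)
  refine ⟨b, fun hb0 => ?_, hb⟩
  obtain ⟨v, hv⟩ := hψ.bijective.2 (1, 0, 0)
  have := hb v
  rw [hv, hb0] at this
  simp at this

theorem IsSymmGerm.eventually_polFun_eq_zero (hT : IsSymmGerm T) (hT' : IsSymmGerm T')
    (hH : H₀.IsHermitian) (hu : IsUnit H₀.det)
    (hψ : IsLocalEquiv ψ (modelFun H₀ T) (modelFun H₀ T')) :
    ∀ᶠ x in 𝓝 (0 : Amb s m × Amb s m),
      polFun (polModelH H₀ T) (polModelS H₀ T) (polModelSd H₀ T) x = 0 →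
      polFun (polModelH H₀ T') (polModelS H₀ T') (polModelSd H₀ T') (ψ x.1, conjMap ψ x.2) = 0 := by
  obtain ⟨r, h⟩ := hT.exists_isPolarization hH hu
  obtain ⟨r', h'⟩ := hT'.exists_isPolarization hH hu
  exact h.eventually_polFun_eq_zero h' hψ.holomorphic hψ.map_zero
    (hψ.germ.mono fun q hq => hq.1)

/-- The rigidity of the models rests on this formula: for η = 0 there is no pure term in z, and 𝐒
occurs linearly. -/
theorem polQuad_model_zeta_zero (hT : IsSymmGerm T) (w τ : ℂ) (z χ : Fin s → ℂ) (ζ : Fin m → ℂ) :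
    polQuad (polModelH H₀ T) (polModelS H₀ T) (polModelSd H₀ T) ((w, z, ζ), (τ, χ, 0))
      = z ⬝ᵥ H₀ *ᵥ χ + (1 / 2) * (χ ⬝ᵥ (H₀ᵀ * T ζ * H₀) *ᵥ χ) := by
  simp only [polQuad, zetaPair_apply, polModelH_fst hT.map_zero, polModelS_fst hT.map_zero,
    polModelSd_fst hT.map_zero, Matrix.zero_mulVec, dotProduct_zero, mul_zero, add_zero]

/-- {w = 0} is the Segre variety of the origin: by `polQuad_model_zeta_zero` with χ = 0, the pair
(q, 0) lies on the complexified model iff the w-coordinate of q is zero. Since ψ fixes 0, it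
preserves this set. -/
theorem IsSymmGerm.eventually_fst_eq_zero (hT : IsSymmGerm T) (hT' : IsSymmGerm T')
    (hH : H₀.IsHermitian) (hu : IsUnit H₀.det)
    (hψ : IsLocalEquiv ψ (modelFun H₀ T) (modelFun H₀ T')) :
    ∀ᶠ q in 𝓝 (0 : (Fin s → ℂ) × (Fin m → ℂ)), (ψ (0, q)).1 = 0 := by
  have ht : Tendsto (fun q : (Fin s → ℂ) × (Fin m → ℂ) => (((0, q), 0) : Amb s m × Amb s m))
      (𝓝 0) (𝓝 0) := Continuous.tendsto' (by fun_prop) _ _ rfl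
  filter_upwards [ht.eventually (hT.eventually_polFun_eq_zero hT' hH hu hψ)] with q hq
  have e1 : polFun (polModelH H₀ T) (polModelS H₀ T) (polModelSd H₀ T) ((0, q), 0) = 0 := by
    have := polQuad_model_zeta_zero (H₀ := H₀) hT 0 0 q.1 0 q.2
    change (1 / 2) * ((0 : ℂ) + 0) - polQuad _ _ _ ((0, q.1, q.2), (0, 0, 0)) = 0
    rw [this]
    simp
  have e2 := hq e1
  have := polQuad_model_zeta_zero (H₀ := H₀) hT' (ψ (0, q)).1 0 (ψ (0, q)).2.1 0 (ψ (0, q)).2.2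
  rw [conjMap_zero hψ.map_zero] at e2
  change (1 / 2) * ((ψ (0, q)).1 + 0) - polQuad _ _ _ (((ψ (0, q)).1, (ψ (0, q)).2.1,
    (ψ (0, q)).2.2), (0, 0, 0)) = 0 at e2
  rw [this] at e2
  simpa using e2

/-- An equivalence of models maps the `ζ`-space to itself. -/
theorem IsSymmGerm.eventually_snd_fst_eq_zero (hT : IsSymmGerm T) (hT' : IsSymmGerm T')
    (hH : H₀.IsHermitian) (hu : IsUnit H₀.det)
    (hψ : IsLocalEquiv ψ (modelFun H₀ T) (modelFun H₀ T')) :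
    ∀ᶠ ζ in 𝓝 (0 : Fin m → ℂ), (ψ (0, 0, ζ)).2.1 = 0 := by
  obtain ⟨r, h⟩ := hT.exists_isPolarization hH hu
  obtain ⟨r', h'⟩ := hT'.exists_isPolarization hH hu
  obtain ⟨b, hb0, hb⟩ := hT'.exists_fderiv_fst_eq hH hu h hψ
  have hψc := analyticAt_conjMap hψ.holomorphic
  suffices hs : ∀ᶠ η in 𝓝 (0 : Fin m → ℂ), (conjMap ψ (0, 0, η)).2.1 = 0 by
    have ht : Tendsto (fun ζ : Fin m → ℂ => star ζ) (𝓝 0) (𝓝 0) :=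
      Continuous.tendsto' (by fun_prop) _ _ (star_zero _)
    filter_upwards [ht.eventually hs] with ζ hζ
    have e : star ((0, 0, star ζ) : Amb s m) = (0, 0, ζ) := by
      refine Prod.ext ?_ (Prod.ext ?_ ?_) <;> simp
    have : star (ψ (star ((0, 0, star ζ) : Amb s m))).2.1 = 0 := hζ
    rw [e] at this
    exact star_eq_zero.1 this
  have t1 : Tendsto (fun η : Fin m → ℂ => ((0, 0, η) : Amb s m)) (𝓝 0) (𝓝 0) :=
    Continuous.tendsto' (by fun_prop) _ _ rfl
  have t2 : Tendsto (fun η : Fin m → ℂ => ((0, (0, 0, η)) : Amb s m × Amb s m)) (𝓝 0) (𝓝 0) :=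
    Continuous.tendsto' (by fun_prop) _ _ rfl
  have t3 : Tendsto (fun η : Fin m → ℂ => ((0, η) : (Fin m → ℂ) × (Fin m → ℂ))) (𝓝 0) (𝓝 0) :=
    Continuous.tendsto' (by fun_prop) _ _ rfl
  have t4 : Tendsto (fun η : Fin m → ℂ => (conjMap ψ (0, 0, η)).2.2) (𝓝 0) (𝓝 0) := by
    have h1 := hψc.continuousAt.tendsto.comp t1
    rw [conjMap_zero hψ.map_zero] at h1
    exact ((continuous_snd.comp continuous_snd).tendsto' (0 : Amb s m) 0 rfl).comp h1
  filter_upwards [t1.eventually hψc.eventually_analyticAt,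
    t2.eventually (hT.eventually_polFun_eq_zero hT' hH hu hψ).eventually_nhds,
    t3.eventually (Metric.ball_mem_nhds 0 h.pos),
    (t3.comp t4).eventually (Metric.ball_mem_nhds 0 h'.pos)] with η a1 a2 a3 a4
  have hx0 : zetaPair s m ((0, conjMap ψ (0, 0, η)) : Amb s m × Amb s m) ∈ Metric.ball 0 r' := a4
  -- Differentiate the polarized equation at (0, (0, 0, η)) in a direction u whose image under the
  -- differential of ψ at 0 is (0, v, 0). Since the first point is mapped to 0, where H(0, ·) = 𝐇,
  -- only vᵀ𝐇χ' survives, with χ' the z-component of the image of (0, 0, η).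
  have key : ∀ v, v ⬝ᵥ (H₀ *ᵥ (conjMap ψ (0, 0, η)).2.1) = 0 := fun v => by
    obtain ⟨u, hu'⟩ := hψ.bijective.2 (0, v, 0)
    have hu1 : u.1 = 0 := by
      have := hb u
      rw [hu'] at this
      simpa [hb0] using this.symm
    obtain ⟨x, hx, hx0', hxz⟩ := h.exists_curve u.2.1 u.2.2 η a3
    have e : ∀ᶠ t in 𝓝 0, polFun (polModelH H₀ T') (polModelS H₀ T') (polModelSd H₀ T')
        (ψ (x t).1, conjMap ψ (x t).2) = 0 := by
      have ht := hx.continuousAt.tendsto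
      rw [hx0'] at ht
      filter_upwards [ht.eventually a2] with t ht
      exact ht (hxz t)
    have e1 : (x 0).1 = 0 := by rw [hx0']
    have e2 : (x 0).2 = (0, 0, η) := by rw [hx0']
    have e3 : (ψ (x 0).1, conjMap ψ (x 0).2) = (0, conjMap ψ (0, 0, η)) := by
      rw [e1, e2, hψ.map_zero]
    have := fderiv_polFun_comp_eq_zero hx (by rw [e1]; exact hψ.holomorphic.differentiableAt)
      (by rw [e2]; exact a1.differentiableAt)
      (by rw [e3]; exact (h'.analyticAt_polFun hx0).differentiableAt) e
    have hue : ((0, u.2.1, u.2.2) : Amb s m) = u := Prod.ext hu1.symm rfl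
    rw [e3, fderiv_polFun (h'.anH _ hx0) (h'.anS _ hx0) (h'.anS' _ hx0), e1, e2, hue, hu',
      _root_.map_zero] at this
    have hz : zetaPair s m ((0, v, 0), 0) = 0 := rfl
    have hz2 : zetaPair s m ((0, conjMap ψ (0, 0, η)) : Amb s m × Amb s m)
      = (0, (conjMap ψ (0, 0, η)).2.2) := rfl
    have hm : ∀ x, matDeriv (polModelS H₀ T') x 0 = 0 := fun x => matDeriv_zero_zero _ _
    rw [hz, hm, hz2, polModelH_snd hT'.map_zero] at this
    simpa using this
  have h3 : H₀ *ᵥ (conjMap ψ (0, 0, η)).2.1 = 0 := by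
    refine dotProduct_eq_zero _ fun w => ?_
    rw [dotProduct_comm]
    exact key w
  have := congrArg (fun y => H₀⁻¹ *ᵥ y) h3
  simpa [mulVec_mulVec, nonsing_inv_mul _ hu] using this

end Uniqueness

/-! ### The second order part of an equivalence of models -/

section SymbolAction

variable {s m : ℕ} {ψ : Amb s m → Amb s m} {H₀ : Matrix (Fin s) (Fin s) ℂ}
  {T T' : (Fin m → ℂ) → Matrix (Fin s) (Fin s) ℂ}

theorem tendsto_inv_smul {V : Type*} [NormedAddCommGroup V] [NormedSpace ℂ V] {f : ℂ → V} {f' : V}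
    (hf : HasDerivAt f f' 0) (h0 : f 0 = 0) : Tendsto (fun t => t⁻¹ • f t) (𝓝[≠] 0) (𝓝 f') := by
  refine (hasDerivAt_iff_tendsto_slope.1 hf).congr fun t => ?_
  rw [slope_def_module, h0, sub_zero, sub_zero]

/-- If `f(0, y) = 0`, then `f(t² c, t y) / t²` tends to `c ∂f/∂w (0)`. -/
theorem tendsto_div_sq {V : Type*} [NormedAddCommGroup V] [NormedSpace ℂ V] {f : ℂ × V → ℂ}
    (hf : AnalyticAt ℂ f 0) (h0 : ∀ᶠ y in 𝓝 (0 : V), f (0, y) = 0) (c : ℂ) (y : V) :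
    Tendsto (fun t : ℂ => (t * t)⁻¹ * f (t * t * c, t • y)) (𝓝[≠] 0)
      (𝓝 (c * fderiv ℂ f 0 (1, 0))) := by
  -- Strict differentiability compares (t²c, ty) with (0, ty), where f vanishes. They differ by
  -- t²(c, 0), so the error is o(t²); plain differentiability would only give o(t).
  have hs := hf.hasStrictFDerivAt.isLittleO
  have ht : Tendsto (fun t : ℂ => (((t * t * c, t • y), (0, t • y)) : (ℂ × V) × (ℂ × V)))
      (𝓝[≠] 0) (𝓝 (0, 0)) :=
    (Continuous.tendsto' (by fun_prop) _ _ (by simp)).mono_left nhdsWithin_le_nhds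
  have h1 := hs.comp_tendsto ht
  have hy : Tendsto (fun t : ℂ => t • y) (𝓝[≠] 0) (𝓝 0) :=
    (Continuous.tendsto' (by fun_prop) _ _ (by simp)).mono_left nhdsWithin_le_nhds
  have h2 : (fun t : ℂ => f (t * t * c, t • y) - t * t * (c * fderiv ℂ f 0 (1, 0)))
      =o[𝓝[≠] 0] fun t : ℂ => t * t := by
    refine (h1.congr' ?_ (EventuallyEq.refl _ _)).trans_isBigO ?_
    · filter_upwards [hy.eventually h0] with t h0t
      have e : (((t * t * c, t • y), (0, t • y)) : (ℂ × V) × (ℂ × V)).1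
          - (((t * t * c, t • y), (0, t • y)) : (ℂ × V) × (ℂ × V)).2
          = (t * t * c) • ((1, 0) : ℂ × V) := by
        refine Prod.ext ?_ ?_ <;> simp
      simp only [Function.comp_apply, e, map_smul, h0t, sub_zero, smul_eq_mul]
      ring
    · refine Asymptotics.IsBigO.of_bound (‖c‖) (Eventually.of_forall fun t => ?_)
      simp only [Function.comp_apply, Prod.mk_sub_mk, sub_self, sub_zero, Prod.norm_mk, norm_zero,
        norm_mul]
      rw [max_eq_left (by positivity), mul_comm]
  have h3 := h2.tendsto_div_nhds_zero.add_const (c * fderiv ℂ f 0 (1, 0))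
  rw [zero_add] at h3
  refine h3.congr' ?_
  filter_upwards [self_mem_nhdsWithin] with t ht
  have : t ≠ 0 := ht
  field_simp
  ring

/-- The action of the differential of an equivalence of models on the quadratic forms. -/
theorem IsSymmGerm.eventually_quadratic_eq (hT : IsSymmGerm T) (hT' : IsSymmGerm T')
    (hH : H₀.IsHermitian) (hu : IsUnit H₀.det)
    (hψ : IsLocalEquiv ψ (modelFun H₀ T) (modelFun H₀ T')) {b : ℝ}
    (hb : ∀ v, (fderiv ℂ ψ 0 v).1 = b * v.1) :
    ∀ᶠ ζ in 𝓝 (0 : Fin m → ℂ), ∀ z χ : Fin s → ℂ,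
      b * (z ⬝ᵥ H₀ *ᵥ χ + (1 / 2) * (χ ⬝ᵥ (H₀ᵀ * T ζ * H₀) *ᵥ χ))
        = (fderiv ℂ ψ (0, 0, ζ) (0, z, 0)).2.1 ⬝ᵥ H₀ *ᵥ
            star (fderiv ℂ ψ 0 (0, star χ, 0)).2.1
          + (1 / 2) * (star (fderiv ℂ ψ 0 (0, star χ, 0)).2.1 ⬝ᵥ
            (H₀ᵀ * T' (ψ (0, 0, ζ)).2.2 * H₀) *ᵥ star (fderiv ℂ ψ 0 (0, star χ, 0)).2.1) := by
  obtain ⟨r', h'⟩ := hT'.exists_isPolarization hH hu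
  have hψc := analyticAt_conjMap hψ.holomorphic
  have hψc0 := conjMap_zero hψ.map_zero
  have hstep := hT.eventually_fst_eq_zero hT' hH hu hψ
  have t1 : Tendsto (fun ζ : Fin m → ℂ => ((0, 0, ζ) : Amb s m)) (𝓝 0) (𝓝 0) :=
    Continuous.tendsto' (by fun_prop) _ _ rfl
  have t2 : Tendsto (fun ζ : Fin m → ℂ => (((0, 0, ζ), 0) : Amb s m × Amb s m)) (𝓝 0) (𝓝 0) :=
    Continuous.tendsto' (by fun_prop) _ _ rfl
  have t4 : Tendsto (fun ζ : Fin m → ℂ => ((ψ (0, 0, ζ)).2.2, (0 : Fin m → ℂ))) (𝓝 0) (𝓝 0) := by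
    have h1 := hψ.holomorphic.continuousAt.tendsto.comp t1
    rw [hψ.map_zero] at h1
    have h2 : Tendsto (fun q : Amb s m => (q.2.2, (0 : Fin m → ℂ))) (𝓝 0) (𝓝 0) :=
      Continuous.tendsto' (by fun_prop) _ _ rfl
    exact h2.comp h1
  have t5 : Tendsto (fun ζ : Fin m → ℂ => ((0, ζ) : (Fin s → ℂ) × (Fin m → ℂ))) (𝓝 0) (𝓝 0) :=
    Continuous.tendsto' (by fun_prop) _ _ rfl
  filter_upwards [t5.eventually hstep.eventually_nhds, t1.eventually hψ.holomorphic.eventually_analyticAt,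
    t2.eventually (hT.eventually_polFun_eq_zero hT' hH hu hψ).eventually_nhds,
    t4.eventually (Metric.ball_mem_nhds 0 h'.pos),
    hT.eventually_snd_fst_eq_zero hT' hH hu hψ] with ζ a3 a1 a2 a4 a5 z χ
  set Q₁ := z ⬝ᵥ H₀ *ᵥ χ + (1 / 2) * (χ ⬝ᵥ (H₀ᵀ * T ζ * H₀) *ᵥ χ) with hQ₁
  -- The two arguments run through (0, tz, ζ) and (2t²Q₁, tχ, 0), a pair on the complexified model
  -- because τ = 2t²Q₁ solves its equation. The identity arises by dividing the equation of the
  -- image by t² and letting t tend to 0.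
  let P : ℂ → Amb s m := fun t => ψ (0, t • z, ζ)
  let R : ℂ → Amb s m := fun t => conjMap ψ (t * t * (2 * Q₁), t • χ, 0)
  have hP0 : (P 0).2.1 = 0 := by simpa [P] using a5
  have hR0 : R 0 = 0 := by
    simp only [R, mul_zero, zero_mul, zero_smul]
    exact hψc0
  have hP : HasDerivAt P (fderiv ℂ ψ (0, 0, ζ) (0, z, 0)) 0 := by
    have h1 : HasDerivAt (fun t : ℂ => ((0, t • z, ζ) : Amb s m)) (0, z, 0) 0 :=
      (hasDerivAt_const _ _).prodMk ((by simpa using (hasDerivAt_id (0 : ℂ)).smul_const z :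
        HasDerivAt (fun t : ℂ => t • z) z 0).prodMk (hasDerivAt_const _ _))
    exact HasFDerivAt.comp_hasDerivAt (l := ψ) (f := fun t : ℂ => ((0, t • z, ζ) : Amb s m)) (0 : ℂ)
      (by rw [zero_smul]; exact a1.differentiableAt.hasFDerivAt) h1
  have hR : HasDerivAt R (fderiv ℂ (conjMap ψ) 0 (0, χ, 0)) 0 := by
    have h1 : HasDerivAt (fun t : ℂ => ((t * t * (2 * Q₁), t • χ, 0) : Amb s m)) (0, χ, 0) 0 := by
      refine HasDerivAt.prodMk ?_ ((by simpa using (hasDerivAt_id (0 : ℂ)).smul_const χ :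
        HasDerivAt (fun t : ℂ => t • χ) χ 0).prodMk (hasDerivAt_const _ _))
      simpa using ((hasDerivAt_id (0 : ℂ)).mul (hasDerivAt_id (0 : ℂ))).mul_const (2 * Q₁)
    refine HasFDerivAt.comp_hasDerivAt (l := conjMap ψ)
      (f := fun t : ℂ => ((t * t * (2 * Q₁), t • χ, 0) : Amb s m)) (0 : ℂ) ?_ h1
    have e : ((0 * 0 * (2 * Q₁), (0 : ℂ) • χ, 0) : Amb s m) = 0 := by simp
    rw [e]
    exact hψc.differentiableAt.hasFDerivAt
  have hz : HasDerivAt (fun t => (P t).2.1) (fderiv ℂ ψ (0, 0, ζ) (0, z, 0)).2.1 0 :=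
    ((ContinuousLinearMap.fst ℂ (Fin s → ℂ) (Fin m → ℂ)).comp
      (ContinuousLinearMap.snd ℂ ℂ ((Fin s → ℂ) × (Fin m → ℂ)))).hasFDerivAt.comp_hasDerivAt
      (0 : ℂ) hP
  have hχ : HasDerivAt (fun t => (R t).2.1) (fderiv ℂ (conjMap ψ) 0 (0, χ, 0)).2.1 0 :=
    ((ContinuousLinearMap.fst ℂ (Fin s → ℂ) (Fin m → ℂ)).comp
      (ContinuousLinearMap.snd ℂ ℂ ((Fin s → ℂ) × (Fin m → ℂ)))).hasFDerivAt.comp_hasDerivAt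
      (0 : ℂ) hR
  have lz := tendsto_inv_smul hz hP0
  have lχ := tendsto_inv_smul hχ (by rw [hR0]; rfl)
  have lP : Tendsto P (𝓝[≠] 0) (𝓝 (ψ (0, 0, ζ))) := by
    have := hP.continuousAt.tendsto.mono_left (nhdsWithin_le_nhds (s := {0}ᶜ))
    simpa only [P, zero_smul] using this
  have lR : Tendsto R (𝓝[≠] 0) (𝓝 0) := by
    have := hR.continuousAt.tendsto.mono_left (nhdsWithin_le_nhds (s := {0}ᶜ))
    rwa [hR0] at this
  let Q' := polQuad (polModelH H₀ T') (polModelS H₀ T') (polModelSd H₀ T')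
  have lQ : Tendsto (fun t => Q' ((0, t⁻¹ • (P t).2.1, (P t).2.2), (0, t⁻¹ • (R t).2.1, (R t).2.2)))
      (𝓝[≠] 0) (𝓝 (Q' ((0, (fderiv ℂ ψ (0, 0, ζ) (0, z, 0)).2.1, (ψ (0, 0, ζ)).2.2),
        (0, (fderiv ℂ (conjMap ψ) 0 (0, χ, 0)).2.1, 0)))) := by
    have ha : AnalyticAt ℂ Q' ((0, (fderiv ℂ ψ (0, 0, ζ) (0, z, 0)).2.1, (ψ (0, 0, ζ)).2.2),
        (0, (fderiv ℂ (conjMap ψ) 0 (0, χ, 0)).2.1, 0)) := h'.analyticAt_polQuad a4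
    have s2 : Continuous fun q : Amb s m => q.2.2 := by fun_prop
    refine ha.continuousAt.tendsto.comp ?_
    exact ((tendsto_const_nhds).prodMk_nhds (lz.prodMk_nhds ((s2.tendsto _).comp lP))).prodMk_nhds
      ((tendsto_const_nhds).prodMk_nhds (lχ.prodMk_nhds ((s2.tendsto _).comp lR)))
  -- The conjugate of ψ preserves {w = 0} as well, so its w-component at the second point is of
  -- order t² with limit coefficient 2bQ₁; that of P vanishes identically.
  have lW := tendsto_div_sq (f := fun q : Amb s m => (conjMap ψ q).1)
    (analyticAt_fst.comp hψc) (by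
      have ht : Tendsto (fun q : (Fin s → ℂ) × (Fin m → ℂ) => star q) (𝓝 0) (𝓝 0) :=
        Continuous.tendsto' (by fun_prop) _ _ (star_zero _)
      filter_upwards [ht.eventually hstep] with q hq
      have e : star ((0, q) : Amb s m) = (0, star q) := Prod.ext (star_zero _) rfl
      change (star (ψ (star (0, q)))).1 = 0
      rw [e, Prod.fst_star, hq, star_zero]) (2 * Q₁) (χ, 0)
  have hfd : fderiv ℂ (fun q : Amb s m => (conjMap ψ q).1) 0 (1, 0) = b := by
    have h1 : HasFDerivAt (fun q : Amb s m => (conjMap ψ q).1)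
        ((ContinuousLinearMap.fst ℂ ℂ ((Fin s → ℂ) × (Fin m → ℂ))).comp
          (fderiv ℂ (conjMap ψ) 0)) 0 :=
      (ContinuousLinearMap.fst ℂ ℂ ((Fin s → ℂ) × (Fin m → ℂ))).hasFDerivAt.comp 0
        hψc.differentiableAt.hasFDerivAt
    rw [h1.fderiv]
    change (fderiv ℂ (conjMap ψ) 0 (1, 0)).1 = b
    rw [fderiv_conjMap hψ.holomorphic, Prod.fst_star, hb, Prod.fst_star, star_one, mul_one]
    exact Complex.conj_ofReal b
  rw [hfd] at lW
  have hev : ∀ᶠ t : ℂ in 𝓝[≠] 0, (t * t)⁻¹ * (conjMap ψ (t * t * (2 * Q₁), t • (χ, 0))).1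
      = 2 * Q' ((0, t⁻¹ • (P t).2.1, (P t).2.2), (0, t⁻¹ • (R t).2.1, (R t).2.2)) := by
    have hx : Tendsto (fun t : ℂ => (((0, t • z, ζ), (t * t * (2 * Q₁), t • χ, 0)) :
        Amb s m × Amb s m)) (𝓝[≠] 0) (𝓝 ((0, 0, ζ), 0)) :=
      (Continuous.tendsto' (by fun_prop) _ _ (by simp)).mono_left nhdsWithin_le_nhds
    have hq : Tendsto (fun t : ℂ => ((t • z, ζ) : (Fin s → ℂ) × (Fin m → ℂ))) (𝓝[≠] 0)
        (𝓝 (0, ζ)) :=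
      (Continuous.tendsto' (by fun_prop) _ _ (by simp)).mono_left nhdsWithin_le_nhds
    filter_upwards [hx.eventually a2, hq.eventually a3, self_mem_nhdsWithin] with t e1 e2 e3
    have ht : t ≠ 0 := e3
    have e4 : polFun (polModelH H₀ T) (polModelS H₀ T) (polModelSd H₀ T)
        ((0, t • z, ζ), (t * t * (2 * Q₁), t • χ, 0)) = 0 := by
      rw [polFun, polQuad_smul, polQuad_model_zeta_zero hT, ← hQ₁]
      ring
    have e5 := e1 e4
    have e6 : polQuad (polModelH H₀ T') (polModelS H₀ T') (polModelSd H₀ T') (P t, R t)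
        = t * (t * Q' ((0, t⁻¹ • (P t).2.1, (P t).2.2), (0, t⁻¹ • (R t).2.1, (R t).2.2))) := by
      have := polQuad_smul (H := polModelH H₀ T') (S := polModelS H₀ T') (S' := polModelSd H₀ T')
        (P t).1 (R t).1 t (t⁻¹ • (P t).2.1) (t⁻¹ • (R t).2.1) (P t).2.2 (R t).2.2
      rw [smul_inv_smul₀ ht, smul_inv_smul₀ ht] at this
      exact this
    have e7 : (1 / 2) * ((P t).1 + (R t).1) - polQuad (polModelH H₀ T') (polModelS H₀ T')
        (polModelSd H₀ T') (P t, R t) = 0 := e5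
    have e8 : (P t).1 = 0 := e2
    have e9 : (conjMap ψ (t * t * (2 * Q₁), t • (χ, 0))).1 = (R t).1 := by
      rw [Prod.smul_mk, smul_zero]
    rw [e6, e8, zero_add] at e7
    rw [e9, inv_mul_eq_iff_eq_mul₀ (mul_ne_zero ht ht)]
    linear_combination 2 * e7
  have := tendsto_nhds_unique (lW.congr' hev) (lQ.const_mul 2)
  have e : star ((0, χ, 0) : Amb s m) = (0, star χ, 0) :=
    Prod.ext (star_zero _) (Prod.ext rfl (star_zero _))
  rw [fderiv_conjMap hψ.holomorphic, e] at this
  simp only [Q'] at this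
  rw [polQuad_model_zeta_zero hT'] at this
  change 2 * Q₁ * b = 2 * (_ ⬝ᵥ H₀ *ᵥ star (fderiv ℂ ψ 0 (0, star χ, 0)).2.1
    + (1 / 2) * (star (fderiv ℂ ψ 0 (0, star χ, 0)).2.1 ⬝ᵥ _ *ᵥ
      star (fderiv ℂ ψ 0 (0, star χ, 0)).2.1)) at this
  linear_combination (1 / 2 : ℂ) * this

theorem conjM_mulVec_eq (A : Matrix (Fin s) (Fin s) ℂ) (z : Fin s → ℂ) :
    conjM A *ᵥ z = star (A *ᵥ star z) := by
  rw [← conjM_mulVec, star_star]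

theorem eq_of_dotProduct_mulVec {n : Type*} [Fintype n] {A B : Matrix n n ℂ}
    (h : ∀ z x, z ⬝ᵥ A *ᵥ x = z ⬝ᵥ B *ᵥ x) : A = B := by
  classical
  ext i j
  simpa using h (Pi.single i 1) (Pi.single j 1)

theorem eq_of_dotProduct_mulVec_self {n : Type*} [Fintype n] {A B : Matrix n n ℂ} (hA : Aᵀ = A)
    (hB : Bᵀ = B) (h : ∀ z, z ⬝ᵥ A *ᵥ z = z ⬝ᵥ B *ᵥ z) : A = B := by
  have h1 : ∀ z, z ⬝ᵥ (A - B) *ᵥ z = 0 := fun z => by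
    rw [sub_mulVec, dotProduct_sub, h, sub_self]
  have h2 := add_transpose_eq_zero_of_dotProduct h1
  rw [transpose_sub, hA, hB, ← two_smul ℂ, smul_eq_zero] at h2
  exact sub_eq_zero.1 (h2.resolve_left two_ne_zero)

/-- The linear part of an equivalence of models transforms `𝐇` and `𝐒`. -/
theorem IsSymmGerm.exists_linearPart (hT : IsSymmGerm T) (hT' : IsSymmGerm T')
    (hH : H₀.IsHermitian) (hu : IsUnit H₀.det)
    (hψ : IsLocalEquiv ψ (modelFun H₀ T) (modelFun H₀ T')) :
    ∃ (b : ℝ) (B : Matrix (Fin s) (Fin s) ℂ), b ≠ 0 ∧ (∀ v, (fderiv ℂ ψ 0 v).1 = b * v.1) ∧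
      (∀ z, B *ᵥ z = (fderiv ℂ ψ 0 (0, z, 0)).2.1) ∧ Bᵀ * H₀ * conjM B = (b : ℂ) • H₀ ∧
      ∀ᶠ ζ in 𝓝 0, (b : ℂ) • T' (ψ (0, 0, ζ)).2.2 = B * T ζ * Bᵀ := by
  obtain ⟨r, h⟩ := hT.exists_isPolarization hH hu
  obtain ⟨b, hb0, hb⟩ := hT'.exists_fderiv_fst_eq hH hu h hψ
  have hbC : (b : ℂ) ≠ 0 := Complex.ofReal_ne_zero.2 hb0
  let L : (Fin s → ℂ) →ₗ[ℂ] (Fin s → ℂ) :=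
    { toFun := fun z => (fderiv ℂ ψ 0 (0, z, 0)).2.1
      map_add' := fun z z' => by
        have : ((0, z + z', 0) : Amb s m) = (0, z, 0) + (0, z', 0) := by simp
        rw [this, _root_.map_add]
        rfl
      map_smul' := fun c z => by
        have : ((0, c • z, 0) : Amb s m) = c • (0, z, 0) := by simp
        rw [this, _root_.map_smul]
        rfl }
  have hB : ∀ z, LinearMap.toMatrix' L *ᵥ z = (fderiv ℂ ψ 0 (0, z, 0)).2.1 := fun z => by
    rw [LinearMap.toMatrix'_mulVec]
    rfl
  have hquad := hT.eventually_quadratic_eq hT' hH hu hψ hb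
  generalize LinearMap.toMatrix' L = B at hB
  have hBH : Bᵀ * H₀ * conjM B = (b : ℂ) • H₀ := by
    -- At ζ = 0 both 𝐒 and 𝐒' vanish, which leaves the relation for 𝐇.
    have h0 := hquad.self_of_nhds
    have e0 : ((0, 0, 0) : Amb s m) = 0 := rfl
    rw [e0, hψ.map_zero, Prod.snd_zero, Prod.snd_zero, hT.map_zero, hT'.map_zero] at h0
    refine eq_of_dotProduct_mulVec fun z x => ?_
    have := h0 z x
    simp only [Matrix.zero_mul, zero_mulVec, dotProduct_zero, mul_zero,
      add_zero] at this
    rw [← hB, ← hB, ← conjM_mulVec_eq, mulVec_dotProduct_eq] at this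
    rw [smul_mulVec, dotProduct_smul, smul_eq_mul, this]
    simp only [mulVec_mulVec, mul_assoc]
  refine ⟨b, B, hb0, hb, hB, hBH, ?_⟩
  have hBu : IsUnit B.det := by
    have := congrArg Matrix.det hBH
    rw [det_mul, det_mul, det_transpose, det_smul] at this
    have h2 : IsUnit ((b : ℂ) ^ Fintype.card (Fin s) * H₀.det) :=
      (IsUnit.mk0 _ (pow_ne_zero _ hbC)).mul hu
    rw [← this] at h2
    exact isUnit_of_mul_isUnit_left (isUnit_of_mul_isUnit_left h2)
  have tf : Tendsto (fun ζ : Fin m → ℂ => (ψ (0, 0, ζ)).2.2) (𝓝 0) (𝓝 0) := by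
    have t1 : Tendsto (fun ζ : Fin m → ℂ => ((0, 0, ζ) : Amb s m)) (𝓝 0) (𝓝 0) :=
      Continuous.tendsto' (by fun_prop) _ _ rfl
    have h1 := hψ.holomorphic.continuousAt.tendsto.comp t1
    rw [hψ.map_zero] at h1
    exact ((continuous_snd.comp continuous_snd).tendsto' (0 : Amb s m) 0 rfl).comp h1
  have hBt : IsUnit (Bᵀ).det := by rwa [det_transpose]
  have hut : IsUnit (H₀ᵀ).det := by rwa [det_transpose]
  have hHB : H₀ * conjM B = (b : ℂ) • ((Bᵀ)⁻¹ * H₀) := by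
    rw [← Matrix.mul_smul, ← hBH, mul_assoc, ← mul_assoc, nonsing_inv_mul _ hBt, one_mul]
  filter_upwards [hquad, hT.symmetric, tf.eventually hT'.symmetric] with ζ h1 h2 h3
  generalize (ψ (0, 0, ζ)).2.2 = η at h1 h3 ⊢
  -- Setting z = 0 leaves the terms quadratic in χ. Symmetric matrices are determined by their
  -- quadratic forms.
  have e1 : (b : ℂ) • (H₀ᵀ * T ζ * H₀) = (H₀ * conjM B)ᵀ * T' η * (H₀ * conjM B) := by
    refine eq_of_dotProduct_mulVec_self ?_ ?_ fun x => ?_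
    · simp only [transpose_smul, transpose_mul, transpose_transpose, h2.eq, mul_assoc]
    · simp only [transpose_mul, transpose_transpose, h3.eq, mul_assoc]
    · have := h1 0 x
      have e0 : ((0, 0, 0) : Amb s m) = 0 := rfl
      rw [e0, _root_.map_zero, ← hB, ← conjM_mulVec_eq] at this
      simp only [zero_dotProduct, Prod.snd_zero, Prod.fst_zero, zero_add] at this
      rw [mulVec_dotProduct_eq] at this
      rw [smul_mulVec, dotProduct_smul, smul_eq_mul]
      rw [mul_left_comm] at this
      have e2 := mul_left_cancel₀ (one_div_ne_zero (two_ne_zero' ℂ)) this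
      rw [e2]
      simp only [mulVec_mulVec, transpose_mul, mul_assoc]
  rw [hHB] at e1
  have e4 : T ζ = (b : ℂ) • (B⁻¹ * T' η * (Bᵀ)⁻¹) := by
    have e5 : (b : ℂ) • (H₀ᵀ * T ζ * H₀)
        = (b : ℂ) • (H₀ᵀ * ((b : ℂ) • (B⁻¹ * T' η * (Bᵀ)⁻¹)) * H₀) := by
      rw [e1]
      simp only [transpose_smul, transpose_mul, transpose_nonsing_inv, transpose_transpose,
        Matrix.smul_mul, Matrix.mul_smul, mul_assoc]
    have e6 := congrArg (fun M => (H₀ᵀ)⁻¹ * M * H₀⁻¹) (smul_right_injective _ hbC e5)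
    simpa only [mul_assoc, mul_nonsing_inv _ hu, mul_one, ← mul_assoc (H₀ᵀ)⁻¹ H₀ᵀ,
      nonsing_inv_mul _ hut, one_mul] using e6
  rw [e4, Matrix.mul_smul, Matrix.smul_mul]
  congr 1
  rw [← mul_assoc, ← mul_assoc, mul_nonsing_inv _ hBu, one_mul, mul_assoc, nonsing_inv_mul _ hBt,
    mul_one]

end SymbolAction

/-! ### The symbol group acts on normal forms -/

section GroupAction

variable {s m : ℕ} {ψ : Amb s m → Amb s m} {H₀ U : Matrix (Fin s) (Fin s) ℂ}
  {T T' : (Fin m → ℂ) → Matrix (Fin s) (Fin s) ℂ} {g : (Fin m → ℂ) → (Fin m → ℂ)} {ε : ℝ}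

theorem ofReal_mul_self_eq_one (hε : ε * ε = 1) : (ε : ℂ) * ε = 1 := by
  rw [← Complex.ofReal_mul, hε, Complex.ofReal_one]

theorem ofReal_ne_zero_of_mul_self (hε : ε * ε = 1) : (ε : ℂ) ≠ 0 := fun h => by
  have := ofReal_mul_self_eq_one hε
  rw [h, zero_mul] at this
  exact zero_ne_one this

theorem isUnit_det_of_unitary (hu : IsUnit H₀.det) {c : ℂ} (hc : c ≠ 0)
    (hU : Uᵀ * H₀ * conjM U = c • H₀) : IsUnit U.det := by
  have := congrArg Matrix.det hU
  rw [det_mul, det_mul, det_transpose, det_smul] at this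
  have h2 : IsUnit (c ^ Fintype.card (Fin s) * H₀.det) :=
    (IsUnit.mk0 _ (pow_ne_zero _ hc)).mul hu
  rw [← this] at h2
  exact isUnit_of_mul_isUnit_left (isUnit_of_mul_isUnit_left h2)

/-- The relation for U makes Uᵀ intertwine the two matrices 1 - 𝐇 conj(𝐒) 𝐇ᵀ 𝐒: there the signs ε
from 𝐒, conj 𝐒 and the two copies of 𝐇 cancel. One factor ε is left from the outer 𝐇. -/
theorem model_transform (hu : IsUnit H₀.det) (hε : ε * ε = 1)
    (hU : Uᵀ * H₀ * conjM U = (ε : ℂ) • H₀) {ζ η : Fin m → ℂ}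
    (hT : T' η = (ε : ℂ) • (U * T ζ * Uᵀ)) :
    Uᵀ * modelH H₀ T' η * conjM U = (ε : ℂ) • modelH H₀ T ζ ∧
    (conjM U)ᵀ * modelS H₀ T' η * conjM U = (ε : ℂ) • modelS H₀ T ζ := by
  have hεC := ofReal_mul_self_eq_one hε
  have hUu := isUnit_det_of_unitary hu (ofReal_ne_zero_of_mul_self hε) hU
  have hUt : IsUnit (Uᵀ).det := by rwa [det_transpose]
  have hV : (conjM U)ᵀ * H₀ᵀ * U = (ε : ℂ) • H₀ᵀ := by
    have := congrArg Matrix.transpose hU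
    simpa only [transpose_mul, transpose_transpose, transpose_smul, mul_assoc] using this
  have hTc : conjM (T' η) = (ε : ℂ) • (conjM U * conjM (T ζ) * (conjM U)ᵀ) := by
    rw [hT, conjM_smul, conjM_mul, conjM_mul, conjM_transpose]
    congr 1
    exact Complex.conj_ofReal ε
  set D := 1 - H₀ * conjM (T ζ) * H₀ᵀ * T ζ with hD
  set D' := 1 - H₀ * conjM (T' η) * H₀ᵀ * T' η with hD'
  have h1 : Uᵀ * D' = D * Uᵀ := by
    rw [hD, hD', mul_sub, sub_mul, mul_one, one_mul, hTc, hT]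
    congr 1
    calc Uᵀ * (H₀ * ((ε : ℂ) • (conjM U * conjM (T ζ) * (conjM U)ᵀ)) * H₀ᵀ
          * ((ε : ℂ) • (U * T ζ * Uᵀ)))
        = ((ε : ℂ) * ε) • ((Uᵀ * H₀ * conjM U) * conjM (T ζ) * ((conjM U)ᵀ * H₀ᵀ * U)
            * T ζ * Uᵀ) := by
          simp only [Matrix.smul_mul, Matrix.mul_smul, mul_assoc, smul_smul]
      _ = _ := by
          rw [hU, hV, hεC, one_smul]
          simp only [Matrix.smul_mul, Matrix.mul_smul, smul_smul, hεC, one_smul]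
  have h2 : Uᵀ * D'⁻¹ = D⁻¹ * Uᵀ := by
    have e : D' = (Uᵀ)⁻¹ * D * Uᵀ := by
      rw [mul_assoc, ← h1, ← mul_assoc, nonsing_inv_mul _ hUt, one_mul]
    rw [e, Matrix.mul_inv_rev, Matrix.mul_inv_rev, nonsing_inv_nonsing_inv _ hUt,
      ← mul_assoc, mul_nonsing_inv _ hUt, one_mul]
  have hHe : ∀ (T : (Fin m → ℂ) → Matrix (Fin s) (Fin s) ℂ) ζ,
      modelH H₀ T ζ = (1 - H₀ * conjM (T ζ) * H₀ᵀ * T ζ)⁻¹ * H₀ := fun T ζ => by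
    rw [modelH_eq]
    simp only [mul_assoc]
  refine ⟨?_, ?_⟩
  · rw [hHe, hHe, ← hD, ← hD', ← mul_assoc, h2, mul_assoc, mul_assoc, ← mul_assoc Uᵀ, hU,
      Matrix.mul_smul]
  · rw [modelS_eq, modelS_eq, ← hD, ← hD', hT]
    calc (conjM U)ᵀ * (H₀ᵀ * ((ε : ℂ) • (U * T ζ * Uᵀ) * D'⁻¹) * H₀) * conjM U
        = (ε : ℂ) • (((conjM U)ᵀ * H₀ᵀ * U) * T ζ * (Uᵀ * D'⁻¹) * H₀ * conjM U) := by
          simp only [Matrix.smul_mul, Matrix.mul_smul, mul_assoc]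
      _ = (ε : ℂ) • ((ε : ℂ) • H₀ᵀ * T ζ * D⁻¹ * (Uᵀ * H₀ * conjM U)) := by
          rw [h2, hV]
          simp only [mul_assoc]
      _ = _ := by
          rw [hU]
          simp only [Matrix.smul_mul, Matrix.mul_smul, mul_assoc, smul_smul, hεC]
          rw [mul_one]

theorem modelFun_linMap (hu : IsUnit H₀.det) (hε : ε * ε = 1)
    (hU : Uᵀ * H₀ * conjM U = (ε : ℂ) • H₀) {q : Amb s m}
    (hT : T' (q.2.2 + g q.2.2) = (ε : ℂ) • (U * T q.2.2 * Uᵀ)) :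
    modelFun H₀ T' (linMap ε U g q) = ε * modelFun H₀ T q := by
  obtain ⟨w, z, ζ⟩ := q
  obtain ⟨h1, h2⟩ := model_transform hu hε hU hT
  dsimp only at h1 h2
  have hstar : star (U *ᵥ z) = conjM U *ᵥ star z := (conjM_mulVec _ _).symm
  have t1 : (U *ᵥ z) ⬝ᵥ modelH H₀ T' (ζ + g ζ) *ᵥ star (U *ᵥ z)
      = ε * (z ⬝ᵥ modelH H₀ T ζ *ᵥ star z) := by
    rw [hstar, mulVec_dotProduct_eq, mulVec_mulVec, mulVec_mulVec, h1, smul_mulVec,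
      dotProduct_smul, smul_eq_mul]
  have t2 : star (U *ᵥ z) ⬝ᵥ modelS H₀ T' (ζ + g ζ) *ᵥ star (U *ᵥ z)
      = ε * (star z ⬝ᵥ modelS H₀ T ζ *ᵥ star z) := by
    rw [hstar, mulVec_dotProduct_eq, mulVec_mulVec, mulVec_mulVec, h2, smul_mulVec,
      dotProduct_smul, smul_eq_mul]
  simp only [modelFun, defFun, linMap]
  rw [t1, t2, Complex.re_ofReal_mul, Complex.re_ofReal_mul, Complex.re_ofReal_mul]
  ring

theorem hasFDerivAt_linMap (c : ℂ) (hg : AnalyticAt ℂ g 0) :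
    AnalyticAt ℂ (linMap c U g : Amb s m → Amb s m) 0 ∧ ∀ v : Amb s m,
      fderiv ℂ (linMap c U g) 0 v = (c * v.1, U *ᵥ v.2.1, fderiv ℂ (fun ζ => ζ + g ζ) 0 v.2.2) := by
  let πw : Amb s m →L[ℂ] ℂ := ContinuousLinearMap.fst ℂ ℂ ((Fin s → ℂ) × (Fin m → ℂ))
  let πz : Amb s m →L[ℂ] (Fin s → ℂ) := (ContinuousLinearMap.fst ℂ (Fin s → ℂ) (Fin m → ℂ)).comp
    (ContinuousLinearMap.snd ℂ ℂ ((Fin s → ℂ) × (Fin m → ℂ)))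
  let πζ : Amb s m →L[ℂ] (Fin m → ℂ) := (ContinuousLinearMap.snd ℂ (Fin s → ℂ) (Fin m → ℂ)).comp
    (ContinuousLinearMap.snd ℂ ℂ ((Fin s → ℂ) × (Fin m → ℂ)))
  let LU : (Fin s → ℂ) →L[ℂ] (Fin s → ℂ) := LinearMap.toContinuousLinearMap (Matrix.mulVecLin U)
  have hf : AnalyticAt ℂ (fun ζ => ζ + g ζ) 0 := analyticAt_id.fun_add hg
  have h3 : AnalyticAt ℂ (fun q : Amb s m => (fun ζ => ζ + g ζ) (πζ q)) 0 :=
    AnalyticAt.comp (g := fun ζ => ζ + g ζ) (f := πζ) (by simpa using hf) (πζ.analyticAt 0)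
  have e : (linMap c U g : Amb s m → Amb s m)
      = fun q => ((c • πw) q, (LU.comp πz) q, (fun ζ => ζ + g ζ) (πζ q)) := rfl
  refine ⟨?_, fun v => ?_⟩
  · rw [e]
    exact ((c • πw).analyticAt 0).prod (((LU.comp πz).analyticAt 0).prod h3)
  · have hd : HasFDerivAt (fun q : Amb s m => (fun ζ => ζ + g ζ) (πζ q))
        ((fderiv ℂ (fun ζ => ζ + g ζ) 0).comp πζ) 0 :=
      HasFDerivAt.comp (g := fun ζ => ζ + g ζ) (f := πζ) (0 : Amb s m)
        (by simpa using hf.differentiableAt.hasFDerivAt) πζ.hasFDerivAt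
    have := ((c • πw).hasFDerivAt (x := 0)).prodMk (((LU.comp πz).hasFDerivAt (x := 0)).prodMk hd)
    rw [e, this.fderiv]
    rfl

/-- The linear maps of the symbol group transform models. -/
theorem isLocalEquiv_linMap (hu : IsUnit H₀.det) (hε : ε * ε = 1)
    (hU : Uᵀ * H₀ * conjM U = (ε : ℂ) • H₀) (hg : AnalyticAt ℂ g 0) (hg0 : g 0 = 0)
    (hb : Function.Bijective (fderiv ℂ (fun ζ => ζ + g ζ) 0))
    (hT : ∀ᶠ ζ in 𝓝 0, T' (ζ + g ζ) = (ε : ℂ) • (U * T ζ * Uᵀ)) :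
    IsLocalEquiv (linMap ε U g) (modelFun H₀ T) (modelFun H₀ T') := by
  have hε0 := ofReal_ne_zero_of_mul_self hε
  have hUu := isUnit_det_of_unitary hu hε0 hU
  obtain ⟨han, hder⟩ := hasFDerivAt_linMap (U := U) (ε : ℂ) hg
  refine ⟨han, by simp [linMap, hg0], bijective_of_injective_fderiv _ fun v hv => ?_, ?_⟩
  · rw [hder] at hv
    obtain ⟨h1, h2⟩ := Prod.mk.inj hv
    obtain ⟨h2, h3⟩ := Prod.mk.inj h2
    refine Prod.ext ((mul_eq_zero.1 h1).resolve_left hε0)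
      (Prod.ext ?_ (hb.1 (h3.trans (map_zero _).symm)))
    have := congrArg (fun y => U⁻¹ *ᵥ y) h2
    simpa [mulVec_mulVec, nonsing_inv_mul _ hUu] using this
  · have hζ : Tendsto (fun q : Amb s m => q.2.2) (𝓝 0) (𝓝 0) :=
      (continuous_snd.comp continuous_snd).tendsto' _ _ rfl
    filter_upwards [hζ.eventually hT] with q hq
    rw [modelFun_linMap hu hε hU hq, mul_eq_zero]
    exact ⟨Or.inr, fun h => h.resolve_left (Complex.ofReal_ne_zero.1 hε0)⟩

variable {W : Submodule ℂ (Matrix (Fin s) (Fin s) ℂ)} {p : Fin m → Fin s × Fin s}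

theorem matDerivL_conj (hT : MatAnalyticAt T 0) (c : ℂ) (v : Fin m → ℂ) :
    matDerivL (fun ζ => c • (U * T ζ * Uᵀ)) v = c • (U * matDerivL T v * Uᵀ) := by
  have h1 : MatAnalyticAt (fun ζ => c • U * T ζ) 0 := (MatAnalyticAt.const (c • U)).mul hT
  have e : (fun ζ => c • (U * T ζ * Uᵀ)) = fun ζ => c • U * T ζ * Uᵀ := by
    funext ζ
    simp only [Matrix.smul_mul]
  change matDeriv _ 0 v = c • (U * matDeriv T 0 v * Uᵀ)
  rw [e, matDeriv_mul h1 (.const _), matDeriv_mul (.const _) hT]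
  simp only [matDeriv_const, Matrix.zero_mul, Matrix.mul_zero, zero_add, add_zero, Matrix.smul_mul]

theorem conj_injective (hU : IsUnit U.det) : Function.Injective fun A => U * A * Uᵀ := by
  have hUt : IsUnit (Uᵀ).det := by rwa [det_transpose]
  intro A A' h
  have := congrArg (fun M => U⁻¹ * M * (Uᵀ)⁻¹) h
  simpa only [mul_assoc, mul_nonsing_inv _ hUt, mul_one, ← mul_assoc U⁻¹ U,
    nonsing_inv_mul _ hU, one_mul] using this

/-- The symbol group acts on normal forms. -/
theorem exists_isNormalized_conj (hW : ∀ A ∈ W, (∀ β, A (p β).1 (p β).2 = 0) → A = 0)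
    (hT : IsNormalized W p T) (hu : IsUnit U.det) (hU : ∀ A, U * A * Uᵀ ∈ W ↔ A ∈ W) :
    (∃ T', IsNormalized W p T' ∧
      ∀ᶠ ζ in 𝓝 0, T' (entriesAt p (fun ζ => U * T ζ * Uᵀ) ζ) = U * T ζ * Uᵀ) ∧
    AnalyticAt ℂ (entriesAt p fun ζ => U * T ζ * Uᵀ) 0 ∧
    entriesAt p (fun ζ => U * T ζ * Uᵀ) 0 = 0 ∧
    Function.Bijective (fderiv ℂ (entriesAt p fun ζ => U * T ζ * Uᵀ) 0) := by
  have hTan : MatAnalyticAt T 0 := hT.holomorphic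
  have han : MatAnalyticAt (fun ζ => U * T ζ * Uᵀ) 0 :=
    ((MatAnalyticAt.const U).mul hTan).mul (.const Uᵀ)
  have hL : ∀ v, matDerivL (fun ζ => U * T ζ * Uᵀ) v = U * matDerivL T v * Uᵀ := fun v => by
    have := matDerivL_conj (U := U) hTan 1 v
    simpa only [one_smul] using this
  have hUt : IsUnit (Uᵀ).det := by rwa [det_transpose]
  have hrange : LinearMap.range (matDerivL T) = W := by rw [← span_partialAt hTan, hT.span_eq]
  have hind : LinearIndependent ℂ (partialAt fun ζ => U * T ζ * Uᵀ) := by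
    rw [linearIndependent_partialAt_iff han]
    intro v v' h
    rw [hL, hL] at h
    exact (linearIndependent_partialAt_iff hTan).1 hT.independent (conj_injective hu h)
  have hspan : Submodule.span ℂ (Set.range (partialAt fun ζ => U * T ζ * Uᵀ)) = W := by
    rw [span_partialAt han]
    refine le_antisymm ?_ fun A hA => ?_
    · rintro _ ⟨v, rfl⟩
      rw [hL, hU, ← hrange]
      exact LinearMap.mem_range_self _ v
    · have e : U * (U⁻¹ * A * (Uᵀ)⁻¹) * Uᵀ = A := by
        simp only [mul_assoc, nonsing_inv_mul _ hUt, mul_one]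
        rw [← mul_assoc, mul_nonsing_inv _ hu, one_mul]
      have h1 : U⁻¹ * A * (Uᵀ)⁻¹ ∈ LinearMap.range (matDerivL T) := by
        rw [hrange, ← hU, e]
        exact hA
      obtain ⟨v, hv⟩ := h1
      exact ⟨v, by rw [hL, hv, e]⟩
  have hsymm : ∀ᶠ ζ in 𝓝 0, (U * T ζ * Uᵀ).IsSymm := by
    filter_upwards [hT.symmetric] with ζ hζ
    simp only [Matrix.IsSymm, transpose_mul, transpose_transpose, hζ.eq, mul_assoc]
  have h0 : U * T 0 * Uᵀ = 0 := by rw [hT.map_zero, Matrix.mul_zero, Matrix.zero_mul]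
  exact ⟨exists_isNormalized_comp hW han hsymm h0 hind hspan, analyticAt_entriesAt han,
    by funext β; simp [entriesAt, h0], bijective_fderiv_entriesAt hW han hind hspan⟩

/-- Uniqueness of the normal form: an equivalence gives an element of the symbol group. -/
theorem exists_linMap_of_isLocalEquiv (hH : H₀.IsHermitian) (hu : IsUnit H₀.det)
    (hT : IsNormalized W p T) (hT' : IsNormalized W p T')
    (hψ : IsLocalEquiv ψ (modelFun H₀ T) (modelFun H₀ T')) (hε : ε * ε = 1) {b : ℝ}
    (hb : ∀ v, (fderiv ℂ ψ 0 v).1 = b * v.1) (hεb : 0 < ε * b) :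
    ∃ U ∈ symbolGroup (ε : ℂ) H₀ W, ∃ g : (Fin m → ℂ) → (Fin m → ℂ), AnalyticAt ℂ g 0 ∧ g 0 = 0 ∧
      IsLocalEquiv (linMap ε U g) (modelFun H₀ T) (modelFun H₀ T') := by
  obtain ⟨b', B, hb0, hb', hB, hBH, hBT⟩ := hT.isSymmGerm.exists_linearPart hT'.isSymmGerm hH hu hψ
  have hbb : b' = b := by
    have := (hb' (1, 0, 0)).symm.trans (hb (1, 0, 0))
    simpa using this
  subst hbb
  have hεC := ofReal_mul_self_eq_one hε
  have hε0 := ofReal_ne_zero_of_mul_self hε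
  have hbC : (b' : ℂ) ≠ 0 := Complex.ofReal_ne_zero.2 hb0
  -- With k² = εb and U = B/k the factor b in the relation for 𝐇 becomes b/(εb) = ε. Reality of k
  -- matters because the relation contains conj U.
  obtain ⟨k, hk⟩ : ∃ k : ℝ, k * k = ε * b' := ⟨√(ε * b'), Real.mul_self_sqrt hεb.le⟩
  have hkk : (k : ℂ) * k = ε * b' := by exact_mod_cast hk
  have hcoef : (k : ℂ)⁻¹ * (k : ℂ)⁻¹ * b' = ε := by
    rw [← mul_inv, hkk, mul_inv, mul_assoc, inv_mul_cancel₀ hbC, mul_one]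
    exact inv_eq_of_mul_eq_one_left hεC
  set U : Matrix (Fin s) (Fin s) ℂ := (k : ℂ)⁻¹ • B with hUdef
  have hUH : Uᵀ * H₀ * conjM U = (ε : ℂ) • H₀ := by
    have hs : star ((k : ℂ)⁻¹) = (k : ℂ)⁻¹ := by
      rw [star_inv₀]
      congr 1
      exact Complex.conj_ofReal k
    rw [hUdef, transpose_smul, conjM_smul, hs, Matrix.smul_mul, Matrix.smul_mul, Matrix.mul_smul,
      hBH, smul_smul, smul_smul, hcoef]
  have hUu := isUnit_det_of_unitary hu hε0 hUH
  let f : (Fin m → ℂ) → (Fin m → ℂ) := fun ζ => (ψ (0, 0, ζ)).2.2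
  let ι : (Fin m → ℂ) →L[ℂ] Amb s m :=
    (ContinuousLinearMap.inr ℂ ℂ ((Fin s → ℂ) × (Fin m → ℂ))).comp
      (ContinuousLinearMap.inr ℂ (Fin s → ℂ) (Fin m → ℂ))
  let πz : Amb s m →L[ℂ] (Fin s → ℂ) := (ContinuousLinearMap.fst ℂ (Fin s → ℂ) (Fin m → ℂ)).comp
    (ContinuousLinearMap.snd ℂ ℂ ((Fin s → ℂ) × (Fin m → ℂ)))
  let πζ : Amb s m →L[ℂ] (Fin m → ℂ) := (ContinuousLinearMap.snd ℂ (Fin s → ℂ) (Fin m → ℂ)).comp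
    (ContinuousLinearMap.snd ℂ ℂ ((Fin s → ℂ) × (Fin m → ℂ)))
  have hι0 : ι 0 = 0 := _root_.map_zero _
  have hψι : HasFDerivAt (fun ζ => ψ (ι ζ)) ((fderiv ℂ ψ 0).comp ι) 0 :=
    HasFDerivAt.comp (g := ψ) (f := ι) (0 : Fin m → ℂ)
      (by rw [hι0]; exact hψ.holomorphic.differentiableAt.hasFDerivAt) ι.hasFDerivAt
  have hf : AnalyticAt ℂ f 0 := by
    have h1 : AnalyticAt ℂ (fun ζ => ψ (ι ζ)) 0 :=
      AnalyticAt.comp (g := ψ) (f := ι) (by rw [hι0]; exact hψ.holomorphic) (ι.analyticAt 0)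
    exact AnalyticAt.comp (g := πζ) (f := fun ζ => ψ (ι ζ)) (πζ.analyticAt _) h1
  have hf0 : f 0 = 0 := by
    change (ψ 0).2.2 = 0
    rw [hψ.map_zero]
    rfl
  have hf' : ∀ κ, fderiv ℂ ψ 0 (0, 0, κ) = (0, 0, fderiv ℂ f 0 κ) := fun κ => by
    have h3 : HasFDerivAt f (πζ.comp ((fderiv ℂ ψ 0).comp ι)) 0 :=
      HasFDerivAt.comp (g := πζ) (f := fun ζ => ψ (ι ζ)) (0 : Fin m → ℂ) πζ.hasFDerivAt hψι
    have h2 : HasFDerivAt (fun ζ => πz (ψ (ι ζ))) (πz.comp ((fderiv ℂ ψ 0).comp ι)) 0 :=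
      HasFDerivAt.comp (g := πz) (f := fun ζ => ψ (ι ζ)) (0 : Fin m → ℂ) πz.hasFDerivAt hψι
    -- ψ maps the ζ-space to itself, so its differential there has no z-part. This makes the
    -- differential of f injective.
    have h2z : πz.comp ((fderiv ℂ ψ 0).comp ι) = 0 :=
      h2.unique ((hasFDerivAt_const (0 : Fin s → ℂ) (0 : Fin m → ℂ)).congr_of_eventuallyEq
        (hT.isSymmGerm.eventually_snd_fst_eq_zero hT'.isSymmGerm hH hu hψ))
    refine Prod.ext ?_ (Prod.ext ?_ ?_)
    · rw [hb]
      simp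
    · exact DFunLike.congr_fun h2z κ
    · rw [h3.fderiv]
      rfl
  have hfb : Function.Bijective (fderiv ℂ f 0) := by
    refine bijective_of_injective_fderiv _ fun κ hκ => ?_
    have h1 := hf' κ
    rw [hκ] at h1
    have h2 := hψ.bijective.1 (h1.trans (_root_.map_zero (fderiv ℂ ψ 0)).symm)
    exact (Prod.mk.inj (Prod.mk.inj h2).2).2
  -- From b𝐒'(f) = B𝐒Bᵀ = k²U𝐒Uᵀ and k² = εb.
  have hfT : ∀ᶠ ζ in 𝓝 0, T' (f ζ) = (ε : ℂ) • (U * T ζ * Uᵀ) := by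
    filter_upwards [hBT] with ζ hζ
    have e : (b' : ℂ) * ε * (k : ℂ)⁻¹ * (k : ℂ)⁻¹ = 1 := by
      linear_combination (ε : ℂ) * hcoef + hεC
    refine smul_right_injective _ hbC ?_
    change (b' : ℂ) • T' (f ζ) = (b' : ℂ) • _
    rw [hζ, hUdef, transpose_smul, Matrix.smul_mul, Matrix.smul_mul, Matrix.mul_smul, smul_smul,
      smul_smul, smul_smul, e, one_smul]
  clear_value U
  have hTan : MatAnalyticAt T 0 := hT.holomorphic
  have hTan' : MatAnalyticAt T' 0 := hT'.holomorphic
  have hrange : LinearMap.range (matDerivL T) = W := by rw [← span_partialAt hTan, hT.span_eq]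
  have hrange' : LinearMap.range (matDerivL T') = W := by rw [← span_partialAt hTan', hT'.span_eq]
  have hder : ∀ v, matDerivL T' (fderiv ℂ f 0 v) = (ε : ℂ) • (U * matDerivL T v * Uᵀ) := fun v => by
    have h1 := matDeriv_comp (M := T') (f := f) (x := 0) (by rwa [hf0]) hf.differentiableAt v
    rw [hf0, matDeriv_congr hfT] at h1
    exact h1.symm.trans (matDerivL_conj hTan _ v)
  -- The derivatives of 𝐒 and 𝐒' at 0 both have range W, and `hder` says that A ↦ εUAUᵀ carries one
  -- to the other; the sign is irrelevant for a subspace.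
  have hUW : ∀ A, U * A * Uᵀ ∈ W ↔ A ∈ W := fun A => by
    constructor
    · intro hA
      rw [← hrange'] at hA
      obtain ⟨w, hw⟩ := hA
      obtain ⟨v, rfl⟩ := hfb.2 w
      rw [hder] at hw
      have h1 : A = (ε : ℂ) • matDerivL T v := by
        refine conj_injective hUu ?_
        change U * A * Uᵀ = U * ((ε : ℂ) • matDerivL T v) * Uᵀ
        rw [← hw, Matrix.mul_smul, Matrix.smul_mul]
      rw [h1, ← hrange]
      exact Submodule.smul_mem _ _ (LinearMap.mem_range_self _ _)
    · intro hA
      rw [← hrange] at hA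
      obtain ⟨v, rfl⟩ := hA
      have h1 : U * matDerivL T v * Uᵀ = (ε : ℂ) • matDerivL T' (fderiv ℂ f 0 v) := by
        rw [hder, smul_smul, hεC, one_smul]
      rw [h1, ← hrange']
      exact Submodule.smul_mem _ _ (LinearMap.mem_range_self _ _)
  have hfg : (fun ζ => ζ + (f ζ - ζ)) = f := by
    funext ζ
    rw [add_sub_cancel]
  refine ⟨U, ⟨hUH, hUW⟩, fun ζ => f ζ - ζ, hf.fun_sub analyticAt_id, by simp [hf0],
    isLocalEquiv_linMap hu hε hUH (hf.fun_sub analyticAt_id) (by simp [hf0]) ?_ ?_⟩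
  · rwa [hfg]
  · simpa only [add_sub_cancel] using hfT

/-- The reparametrization accompanying an element of the symbol group. -/
theorem eventually_eq_entriesAt (hH : H₀.IsHermitian) (hu : IsUnit H₀.det)
    (hT : IsNormalized W p T) (hT' : IsNormalized W p T')
    (hψ : IsLocalEquiv (linMap 1 U g) (modelFun H₀ T) (modelFun H₀ T')) :
    ∀ᶠ ζ in 𝓝 0, ζ + g ζ = entriesAt p (fun ζ => U * T ζ * Uᵀ) ζ := by
  obtain ⟨b, B, hb0, hb, hB, -, hBT⟩ := hT.isSymmGerm.exists_linearPart hT'.isSymmGerm hH hu hψ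
  let πw : Amb s m →L[ℂ] ℂ := ContinuousLinearMap.fst ℂ ℂ ((Fin s → ℂ) × (Fin m → ℂ))
  let πz : Amb s m →L[ℂ] (Fin s → ℂ) := (ContinuousLinearMap.fst ℂ (Fin s → ℂ) (Fin m → ℂ)).comp
    (ContinuousLinearMap.snd ℂ ℂ ((Fin s → ℂ) × (Fin m → ℂ)))
  let LU : (Fin s → ℂ) →L[ℂ] (Fin s → ℂ) := LinearMap.toContinuousLinearMap (Matrix.mulVecLin U)
  have hd := hψ.holomorphic.differentiableAt.hasFDerivAt
  have h1 : πw.comp (fderiv ℂ (linMap 1 U g) 0) = πw := by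
    refine (πw.hasFDerivAt.comp (0 : Amb s m) hd).unique ?_
    refine (πw.hasFDerivAt (x := 0)).congr_of_eventuallyEq (Eventually.of_forall fun q => ?_)
    exact one_mul _
  have h2 : πz.comp (fderiv ℂ (linMap 1 U g) 0) = LU.comp πz := by
    refine (πz.hasFDerivAt.comp (0 : Amb s m) hd).unique ?_
    exact ((LU.comp πz).hasFDerivAt (x := 0)).congr_of_eventuallyEq
      (Eventually.of_forall fun q => rfl)
  -- For a map of this special form the linear part is read off directly: b = 1 and B = U.
  have hb1 : (b : ℂ) = 1 := by
    have := (hb (1, 0, 0)).symm.trans (DFunLike.congr_fun h1 (1, 0, 0))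
    simpa [πw] using this
  have hBU : B = U := by
    refine eq_of_dotProduct_mulVec fun z x => ?_
    rw [hB x]
    exact congrArg (z ⬝ᵥ ·) (DFunLike.congr_fun h2 (0, x, 0))
  have tf : Tendsto (fun ζ : Fin m → ℂ => ζ + g ζ) (𝓝 0) (𝓝 0) := by
    have t1 : Tendsto (fun ζ : Fin m → ℂ => ((0, 0, ζ) : Amb s m)) (𝓝 0) (𝓝 0) :=
      Continuous.tendsto' (by fun_prop) _ _ rfl
    have h1 := hψ.holomorphic.continuousAt.tendsto.comp t1
    rw [hψ.map_zero] at h1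
    exact ((continuous_snd.comp continuous_snd).tendsto' (0 : Amb s m) 0 rfl).comp h1
  filter_upwards [hBT, tf.eventually hT'.entries] with ζ e1 e2
  funext α
  rw [hb1, one_smul, hBU] at e1
  -- By normalization the entries of T' at the positions p are its argument, so this relation
  -- determines ζ + g(ζ) from U and T alone.
  have e3 : T' (ζ + g ζ) = U * T ζ * Uᵀ := e1
  rw [← e2 α, e3]
  rfl

end GroupAction

/-! ### Transition maps between two normalizations -/

section Transition

variable {s m : ℕ}

/-- The transition map is φ' ∘ φ⁻¹. The chain rule is recorded because the behaviour on sides is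
read from the differentials. -/
theorem IsLocalEquiv.exists_transition {φ φ' : Amb s m → Amb s m} {ρ ρ₁ ρ₂ : Amb s m → ℝ}
    (hφ : IsLocalEquiv φ ρ ρ₁) (hφ' : IsLocalEquiv φ' ρ ρ₂) :
    ∃ ψ, IsLocalEquiv ψ ρ₁ ρ₂ ∧ ∀ v, fderiv ℂ ψ 0 (fderiv ℂ φ 0 v) = fderiv ℂ φ' 0 v := by
  obtain ⟨χ, hχ, hχ0, hχφ, hφχ, hχb⟩ :=
    exists_analytic_inverse hφ.holomorphic hφ.map_zero hφ.bijective
  have hψ : AnalyticAt ℂ (fun q => φ' (χ q)) 0 :=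
    AnalyticAt.comp (g := φ') (f := χ) (by rw [hχ0]; exact hφ'.holomorphic) hχ
  have hd : fderiv ℂ (fun q => φ' (χ q)) 0 = (fderiv ℂ φ' 0).comp (fderiv ℂ χ 0) :=
    (HasFDerivAt.comp (g := φ') (f := χ) (0 : Amb s m)
      (by rw [hχ0]; exact hφ'.holomorphic.differentiableAt.hasFDerivAt)
      hχ.differentiableAt.hasFDerivAt).fderiv
  refine ⟨fun q => φ' (χ q), ⟨hψ, by simp only [hχ0, hφ'.map_zero], ?_, ?_⟩, fun v => ?_⟩
  · rw [hd]
    exact hφ'.bijective.comp hχb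
  · have ht : Tendsto χ (𝓝 0) (𝓝 0) := by
      have := hχ.continuousAt.tendsto
      rwa [hχ0] at this
    filter_upwards [ht.eventually hφ.germ, ht.eventually hφ'.germ, hφχ] with q h1 h2 h3
    rw [h3] at h1
    exact h1.symm.trans h2
  · have h1 : HasFDerivAt (fun q => φ' (χ (φ q)))
        ((fderiv ℂ (fun q => φ' (χ q)) 0).comp (fderiv ℂ φ 0)) 0 :=
      HasFDerivAt.comp (g := fun q => φ' (χ q)) (f := φ) (0 : Amb s m)
        (by rw [hφ.map_zero]; exact hψ.differentiableAt.hasFDerivAt)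
        hφ.holomorphic.differentiableAt.hasFDerivAt
    have h2 : HasFDerivAt (fun q => φ' (χ (φ q))) (fderiv ℂ φ' 0) 0 :=
      hφ'.holomorphic.differentiableAt.hasFDerivAt.congr_of_eventuallyEq
        (hχφ.mono fun q hq => congrArg φ' hq)
    exact DFunLike.congr_fun (h1.unique h2) v

end Transition

end CRModel

end

/-! ### Proof of the theorem -/

theorem mainTheorem4 (s m : ℕ)
    (H S : (Fin m → ℂ) → Matrix (Fin s) (Fin s) ℂ)
    (hH_an : ∀ j k, AnalyticAt ℝ (fun ζ => H ζ j k) 0)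
    (hS_an : ∀ j k, AnalyticAt ℝ (fun ζ => S ζ j k) 0)
    (hH_herm : ∀ᶠ ζ in 𝓝 0, (H ζ).IsHermitian)
    (hS_symm : ∀ᶠ ζ in 𝓝 0, (S ζ).IsSymm)
    (hH_nondeg : IsUnit (H 0).det)
    (hM : CRModel.IsUniformlyTwoNondegenerate (CRModel.defFun H S) s 0) :
    -- the positions exist
    (∃ p, CRModel.IsFirstPositions (CRModel.symbolMatrix H S) p) ∧
    ∀ p, CRModel.IsFirstPositions (CRModel.symbolMatrix H S) p →
      -- existence of the normal form
      (∃ T φ, CRModel.IsNormalized (CRModel.symbolSpan H S) p T ∧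
        CRModel.IsLocalEquiv φ (CRModel.defFun H S) (CRModel.modelFun (H 0) T) ∧
        CRModel.PreservesSides φ) ∧
      -- uniqueness up to the group action
      (∀ T T' φ φ', CRModel.IsNormalized (CRModel.symbolSpan H S) p T →
        CRModel.IsNormalized (CRModel.symbolSpan H S) p T' →
        CRModel.IsLocalEquiv φ (CRModel.defFun H S) (CRModel.modelFun (H 0) T) →
        CRModel.IsLocalEquiv φ' (CRModel.defFun H S) (CRModel.modelFun (H 0) T') →
        ((CRModel.PreservesSides φ ↔ CRModel.PreservesSides φ') →
          ∃ U ∈ CRModel.symbolGroup 1 (H 0) (CRModel.symbolSpan H S),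
          ∃ g : (Fin m → ℂ) → (Fin m → ℂ), AnalyticAt ℂ g 0 ∧ g 0 = 0 ∧
            CRModel.IsLocalEquiv (CRModel.linMap 1 U g)
              (CRModel.modelFun (H 0) T) (CRModel.modelFun (H 0) T')) ∧
        (¬ (CRModel.PreservesSides φ ↔ CRModel.PreservesSides φ') →
          ∃ U ∈ CRModel.symbolGroup (-1) (H 0) (CRModel.symbolSpan H S),
          ∃ g : (Fin m → ℂ) → (Fin m → ℂ), AnalyticAt ℂ g 0 ∧ g 0 = 0 ∧
            CRModel.IsLocalEquiv (CRModel.linMap (-1) U g)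
              (CRModel.modelFun (H 0) T) (CRModel.modelFun (H 0) T'))) ∧
      -- the group acts on normal forms, and the reparametrization is determined by the matrix
      (∀ T, CRModel.IsNormalized (CRModel.symbolSpan H S) p T →
        (∃ φ, CRModel.IsLocalEquiv φ (CRModel.defFun H S) (CRModel.modelFun (H 0) T)) →
        ∀ U ∈ CRModel.symbolGroup 1 (H 0) (CRModel.symbolSpan H S),
          ∃ g : (Fin m → ℂ) → (Fin m → ℂ), AnalyticAt ℂ g 0 ∧ g 0 = 0 ∧
            (∃ T', CRModel.IsNormalized (CRModel.symbolSpan H S) p T' ∧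
              CRModel.IsLocalEquiv (CRModel.linMap 1 U g)
                (CRModel.modelFun (H 0) T) (CRModel.modelFun (H 0) T')) ∧
            ∀ g' : (Fin m → ℂ) → (Fin m → ℂ),
              (∃ T', CRModel.IsNormalized (CRModel.symbolSpan H S) p T' ∧
                CRModel.IsLocalEquiv (CRModel.linMap 1 U g')
                  (CRModel.modelFun (H 0) T) (CRModel.modelFun (H 0) T')) →
              g' =ᶠ[𝓝 0] g) := by
  obtain ⟨Hc, Sc, Sd, r, hpol⟩ :=
    CRModel.exists_isPolarization hH_an hS_an hH_herm hS_symm hH_nondeg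
  have hH : (H 0).IsHermitian := hH_herm.self_of_nhds
  -- The constant rank is used at all nearby points of the hypersurface, the vanishing of 𝒦₃ only at
  -- the origin.
  have hmin := hpol.isMinimalRank (hM.mono fun q hq h => (hq h).1)
  have hind : LinearIndependent ℂ (CRModel.symbolMatrix H S) :=
    hpol.linearIndependent_symbolMatrix hH_nondeg
      (hM.self_of_nhds (CRModel.defFun_zero_zero H S 0)).2.2
  refine ⟨CRModel.exists_isFirstPositions hind, fun p hp => ⟨?_, ?_, ?_⟩⟩
  · exact CRModel.exists_normalForm hpol hmin hH_nondeg hind hp.1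
  · intro T T' φ φ' hT hT' hφ hφ'
    obtain ⟨ψ, hψ, hψd⟩ := hφ.exists_transition hφ'
    obtain ⟨c, hc0, hc⟩ := hT.isSymmGerm.exists_fderiv_fst_eq hH hH_nondeg hpol hφ
    obtain ⟨b, B, hb0, hb, -⟩ :=
      hT.isSymmGerm.exists_linearPart hT'.isSymmGerm hH hH_nondeg hψ
    have hside : CRModel.PreservesSides φ ↔ 0 < c := by
      rw [CRModel.PreservesSides, hc, mul_one, Complex.ofReal_re]
    have hside' : CRModel.PreservesSides φ' ↔ 0 < b * c := by
      rw [CRModel.PreservesSides, ← hψd, hb, hc, mul_one, ← Complex.ofReal_mul, Complex.ofReal_re]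
    rw [hside, hside']
    -- φ, ψ and φ' have the real normal derivatives c, b and bc, so φ and φ' agree on sides exactly
    -- when b > 0.
    have hpos : (0 < c ↔ 0 < b * c) ↔ 0 < b := by
      rcases hb0.lt_or_gt with hb1 | hb1 <;> rcases hc0.lt_or_gt with hc1 | hc1
      · simp [hb1.le.not_gt, hc1.le.not_gt, mul_pos_of_neg_of_neg hb1 hc1]
      · simp [hb1.le.not_gt, hc1, (mul_neg_of_neg_of_pos hb1 hc1).le.not_gt]
      · simp [hb1, hc1.le.not_gt, (mul_neg_of_pos_of_neg hb1 hc1).le.not_gt]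
      · simp [hb1, hc1]
    rw [hpos]
    constructor
    · intro h
      have := CRModel.exists_linMap_of_isLocalEquiv (ε := 1) hH hH_nondeg hT hT' hψ (one_mul 1) hb
        (by rwa [one_mul])
      simpa only [Complex.ofReal_one] using this
    · intro h
      have := CRModel.exists_linMap_of_isLocalEquiv (ε := -1) hH hH_nondeg hT hT' hψ (by norm_num)
        hb (by linarith [lt_of_le_of_ne (not_lt.1 h) hb0])
      simpa only [Complex.ofReal_neg, Complex.ofReal_one] using this
  · intro T hT _ U hU
    have hW : ∀ A ∈ CRModel.symbolSpan H S, (∀ β, A (p β).1 (p β).2 = 0) → A = 0 :=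
      fun A hA hz => hp.1.eq_zero hA hz
    have hUu := CRModel.isUnit_det_of_unitary hH_nondeg one_ne_zero hU.1
    obtain ⟨⟨T', hT', hTT'⟩, hf, hf0, hfb⟩ := CRModel.exists_isNormalized_conj hW hT hUu hU.2
    -- The new coordinates are the entries of U𝐒Uᵀ at the positions p, so the required germ is g(ζ)
    -- = f(ζ) - ζ.
    set f := CRModel.entriesAt p fun ζ => U * T ζ * Uᵀ with hf_def
    have hg : AnalyticAt ℂ (fun ζ => f ζ - ζ) 0 := hf.fun_sub analyticAt_id
    have hfg : (fun ζ => ζ + (f ζ - ζ)) = f := by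
      funext ζ
      rw [add_sub_cancel]
    refine ⟨fun ζ => f ζ - ζ, hg, by simp [hf0], ⟨T', hT', ?_⟩, ?_⟩
    · have := CRModel.isLocalEquiv_linMap (ε := 1) (g := fun ζ => f ζ - ζ) (T := T) (T' := T')
        hH_nondeg (one_mul 1) (by simpa only [Complex.ofReal_one] using hU.1) hg (by simp [hf0])
        (by rwa [hfg]) (by simpa only [add_sub_cancel, Complex.ofReal_one, one_smul] using hTT')
      simpa only [Complex.ofReal_one] using this
    · rintro g' ⟨T₁, hT₁, hψ⟩
      filter_upwards [CRModel.eventually_eq_entriesAt hH hH_nondeg hT hT₁ hψ] with ζ hζ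
      exact eq_sub_of_add_eq' hζ
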